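/- Let $p$ be a prime number, let $k$ be a $p$-adic field (a finite extension of $\mathbb{Q}_p$), let $C$ be a smooth projective geometrically integral curve over $k$, and let $K=k(C)$ be its function field. For a closed point $w$ of $C$, let $K_w$ denote the completion of $K$ with respect to the discrete valuation whose valuation ring is the local ring $\mathcal{O}_{C,w}$. Let $Z$ be a smooth geometrically integral $K$-variety (a separated $K$-scheme of finite type). Let $T$ be a finite set of closed points of $C$. Fix a finite field extension $L$ of $K$ and, for each $w\in T$, a finite field extension $M^{(w)}$ of $K_w$ such that $Z(M^{(w)})\neq\emptyset$. Then there exists a finite field extension $M$ of $K$ satisfying the following properties: (i) $Z(M)\neq\emptyset$; (ii) for each $w\in T$, there exists a $K$-embedding $M\hookrightarrow M^{(w)}$; (iii) the extensions $L/K$ and $M/K$ are linearly disjoint, that is, for all $K$-embeddings of $L$ and $M$ into an algebraic closure $\overline{K}$ of $K$, the images are linearly disjoint over $K$. -/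

import Mathlib

universe u

namespace LocGlob

open IsLocalRing TensorProduct AlgebraicGeometry CategoryTheory

section LocalRings

/-- The local ring of a one-dimensional standard smooth algebra over a field of characteristic
zero at a maximal ideal is a discrete valuation ring. -/
theorem isDVR_of_isStandardSmooth {k A R : Type*} [Field k] [CharZero k] [CommRing A]
    [Algebra k A] [Algebra.IsStandardSmoothOfRelativeDimension 1 k A]
    (P : Ideal A) [P.IsMaximal] [CommRing R] [IsDomain R] [Algebra A R]
    [IsLocalization.AtPrime R P] : IsDiscreteValuationRing R := by
  have : IsLocalRing R := IsLocalization.AtPrime.isLocalRing R P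
  let : Algebra k R := ((algebraMap A R).comp (algebraMap k A)).toAlgebra
  have : IsScalarTower k A R := .of_algebraMap_eq' rfl
  have : Algebra.IsStandardSmooth k A :=
    Algebra.IsStandardSmoothOfRelativeDimension.isStandardSmooth 1
  have : Algebra.FormallyEtale A R := .of_isLocalization P.primeCompl
  have : Algebra.FormallySmooth k R := .comp k A R
  have : Algebra.FiniteType k A := inferInstance
  have : IsNoetherianRing A := Algebra.FiniteType.isNoetherianRing k A
  have : IsNoetherianRing R := IsLocalization.isNoetherianRing P.primeCompl R ‹_›
  let κ := ResidueField R
  have hsurjA : Function.Surjective (algebraMap A κ) := by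
    intro x
    obtain ⟨r, rfl⟩ := residue_surjective x
    obtain ⟨a, t, rfl⟩ := IsLocalization.exists_mk'_eq P.primeCompl r
    obtain ⟨b, hb⟩ := Ideal.Quotient.exists_inv
      (show Ideal.Quotient.mk P t ≠ 0 from fun h => t.2 (Ideal.Quotient.eq_zero_iff_mem.1 h))
    obtain ⟨b, rfl⟩ := Ideal.Quotient.mk_surjective b
    have hP : ∀ p ∈ P, algebraMap A κ p = 0 := fun p hp =>
      (residue_eq_zero_iff (algebraMap A R p)).2
        ((IsLocalization.AtPrime.to_map_mem_maximal_iff R P p).2 hp)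
    have h1 : algebraMap A κ (t * b) = 1 := by
      rw [← sub_eq_zero, ← map_one (algebraMap A κ), ← map_sub]
      exact hP _ (Ideal.Quotient.eq.1 (by simpa using hb))
    have h2 : residue R (IsLocalization.mk' R a t) * algebraMap A κ t = algebraMap A κ a := by
      have := congrArg (residue R) (IsLocalization.mk'_spec R a t)
      rwa [map_mul] at this
    refine ⟨a * b, ?_⟩
    rw [map_mul, ← h2, mul_assoc, ← map_mul, h1, mul_one]
  have hft : Algebra.FiniteType k κ :=
    Algebra.FiniteType.of_surjective (IsScalarTower.toAlgHom k A κ) hsurjA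
  have hfin : Module.Finite k κ := finite_of_finite_type_of_isJacobsonRing k κ
  have : Algebra.FormallyEtale k κ := .of_isSeparable k κ
  have hs : Function.Surjective (algebraMap R κ) := residue_surjective
  obtain ⟨l, hl⟩ := (Algebra.FormallySmooth.iff_split_injection (R := k) (P := R) (A := κ) hs).1
    inferInstance
  have hker : RingHom.ker (algebraMap R κ) = maximalIdeal R := ker_residue
  have hbij : Function.Bijective (KaehlerDifferential.kerCotangentToTensor k R κ) := by
    refine ⟨Function.LeftInverse.injective (g := l) (fun x => LinearMap.congr_fun hl x), fun y => ?_⟩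
    exact (KaehlerDifferential.exact_kerCotangentToTensor_mapBaseChange k R κ hs y).1
      (Subsingleton.elim _ _)
  have : Nontrivial A := (algebraMap A R).domain_nontrivial
  have hrk : Module.finrank κ (κ ⊗[R] Ω[R⁄k]) = 1 := by
    have e := KaehlerDifferential.tensorKaehlerEquivOfFormallyEtale k A R
    have hA : Module.rank A Ω[A⁄k] = 1 := by
      simpa using Algebra.IsStandardSmoothOfRelativeDimension.rank_kaehlerDifferential
        (R := k) (S := A) 1
    have : Module.Free R Ω[R⁄k] := Module.Free.of_equiv e
    rw [Module.finrank_baseChange, ← e.finrank_eq, Module.finrank_baseChange, Module.finrank, hA]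
    simp
  rw [← IsLocalRing.finrank_CotangentSpace_eq_one_iff, ← hrk]
  have he : Nonempty ((maximalIdeal R).Cotangent ≃ₗ[R]
      (RingHom.ker (algebraMap R κ)).Cotangent) := by
    rw [hker]
    exact ⟨.refl _ _⟩
  let e₀ : CotangentSpace R ≃ₗ[R] κ ⊗[R] Ω[R⁄k] := he.some ≪≫ₗ (LinearEquiv.ofBijective _ hbij)
  exact (e₀.extendScalarsOfSurjective hs).finrank_eq

/-- The local ring of a smooth integral curve at a closed point is a discrete valuation ring. -/
theorem isDVR_stalk {k : Type u} [Field k] [CharZero k] {X : Scheme.{u}} [IsIntegral X]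
    (f : X ⟶ Spec (.of k)) [SmoothOfRelativeDimension 1 f] {x : X} (hx : x ∈ closedPoints X) :
    IsDiscreteValuationRing (X.presheaf.stalk x) := by
  obtain ⟨U, hU, V, hV, hxV, e, hf⟩ :=
    SmoothOfRelativeDimension.exists_isStandardSmoothOfRelativeDimension (n := 1) (f := f) x
  obtain rfl : U = ⊤ := by
    ext y
    have : y = f x := Subsingleton.elim _ _
    simpa [this] using e hxV
  let ek : Γ(Spec (.of k), ⊤) ≃+* k := (Scheme.ΓSpecIso (.of k)).commRingCatIsoToRingEquiv
  let : Field Γ(Spec (.of k), ⊤) := (ek.toMulEquiv.isField (Field.toIsField k)).toField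
  have : CharZero Γ(Spec (.of k), ⊤) := charZero_of_injective_ringHom ek.symm.injective
  let := (f.appLE ⊤ V e).hom.toAlgebra
  have : Algebra.IsStandardSmoothOfRelativeDimension 1 Γ(Spec (.of k), ⊤) Γ(X, V) := hf
  have : (hV.primeIdealOf ⟨x, hxV⟩).asIdeal.IsMaximal :=
    hV.primeIdealOf_isMaximal_of_isClosed ⟨x, hxV⟩ hx
  let := X.presheaf.algebra_section_stalk (U := V) ⟨x, hxV⟩
  have := hV.isLocalization_stalk ⟨x, hxV⟩
  exact isDVR_of_isStandardSmooth (k := Γ(Spec (.of k), ⊤)) (hV.primeIdealOf ⟨x, hxV⟩).asIdeal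

end LocalRings

section Geometry

attribute [local instance] MvPolynomial.gradedAlgebra

/-- The structure morphism `ℙⁿ_k ⟶ Spec k` of `ℙⁿ_k = Proj k[x₀, …, xₙ]`. -/
noncomputable def projectiveSpaceHom (k : Type u) [Field k] (n : ℕ) :
    Proj (MvPolynomial.homogeneousSubmodule (Fin (n + 1)) k) ⟶ Spec (.of k) :=
  Proj.toSpecZero _ ≫ Spec.map (CommRingCat.ofHom
    (algebraMap k (MvPolynomial.homogeneousSubmodule (Fin (n + 1)) k 0)))

/-- A `k`-scheme is projective if it is a closed `k`-subscheme of some `ℙⁿ_k`. -/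
def IsProjective {k : Type u} [Field k] {X : Scheme.{u}} (f : X ⟶ Spec (.of k)) : Prop :=
  ∃ (n : ℕ) (i : X ⟶ Proj (MvPolynomial.homogeneousSubmodule (Fin (n + 1)) k)),
    IsClosedImmersion i ∧ i ≫ projectiveSpaceHom k n = f

/-- A smooth projective geometrically integral curve over a field `k`. -/
structure SmoothProjectiveCurve (k : Type u) [Field k] where
  /-- The underlying scheme. -/
  carrier : Scheme.{u}
  /-- The structure morphism. -/
  hom : carrier ⟶ Spec (.of k)
  smooth : SmoothOfRelativeDimension 1 hom
  geometricallyIntegral : GeometricallyIntegral hom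
  projective : IsProjective hom

/-- A variety over `K`: a separated `K`-scheme of finite type. -/
structure IsVariety {K : Type u} [Field K] {Z : Scheme.{u}} (π : Z ⟶ Spec (.of K)) : Prop where
  separated : IsSeparated π
  locallyOfFiniteType : LocallyOfFiniteType π
  quasiCompact : QuasiCompact π

/-- `Z(F) ≠ ∅`: there is a `K`-morphism `Spec F ⟶ Z`, where `F` is a field extension of `K`. -/
def HasPoint {K : Type u} [Field K] {Z : Scheme.{u}} (π : Z ⟶ Spec (.of K))
    (F : Type u) [Field F] [Algebra K F] : Prop :=
  ∃ s : Spec (.of F) ⟶ Z, s ≫ π = Spec.map (CommRingCat.ofHom (algebraMap K F))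

end Geometry

namespace SmoothProjectiveCurve

variable {k : Type u} [Field k] (C : SmoothProjectiveCurve k)

instance : SmoothOfRelativeDimension 1 C.hom := C.smooth

instance : IsIntegral C.carrier :=
  have := C.geometricallyIntegral
  GeometricallyIntegral.isIntegral_of_subsingleton C.hom

/-- The function field `K = k(C)`. -/
abbrev functionField : Type u := C.carrier.functionField

/-- The set `C⁽¹⁾` of closed points of `C`. -/
abbrev ClosedPoint : Type u := closedPoints C.carrier

variable {C}

/-- The local ring `𝒪_{C,w}`, a subring of `k(C)`. -/
abbrev localRing (w : C.ClosedPoint) : Type u := C.carrier.presheaf.stalk w.1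

instance [CharZero k] (w : C.ClosedPoint) : IsDiscreteValuationRing (localRing w) :=
  isDVR_stalk C.hom w.2

/-- The completion `K_w` of `K = k(C)` for the discrete valuation with valuation ring
`𝒪_{C,w}`. -/
abbrev completion [CharZero k] (w : C.ClosedPoint) : Type u :=
  (IsDiscreteValuationRing.maximalIdeal (localRing w)).adicCompletion C.functionField

end SmoothProjectiveCurve

/-- Linear disjointness of two algebraic extensions `L / K` and `M / K`, not given inside a common
field: all their images in an algebraic closure of `K` are linearly disjoint over `K`. -/
def LinearlyDisjoint (K L M : Type*) [Field K] [Field L] [Field M] [Algebra K L]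
    [Algebra K M] : Prop :=
  ∀ (i : L →ₐ[K] AlgebraicClosure K) (j : M →ₐ[K] AlgebraicClosure K),
    i.fieldRange.LinearDisjoint j.fieldRange

end LocGlob

/-!
The variety `Z` is replaced by an affine chart `Spec B`, and `B` by a hypersurface model: up to a
denominator `q(t)`, `B` is `K[t₁, …, t_d, y]` with a single relation `f(t, y) = 0`
(`exists_primitive_model`). A finite extension of `K` with a point on `Z` is then obtained from a
polynomial `P ∈ K[Y]` of the form `f(g₁(Y), …, g_d(Y), Y)`, as the field `K[Y]/(P)` with the point
`t_i = g_i(Y)`. It embeds into `M^(w)` if `P` has a root there, and it is linearly disjoint from `L`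
if `P` is irreducible over a field that contains all the conjugates of `L`. So a suitable family `g`
has to be found.

The local conditions are open. As `Z` is smooth, its points over the complete field `M^(w)` are
Zariski dense (`exists_algHom_apply_ne_zero`), so there is one in the chart where `q` and `∂f/∂Y` do
not vanish. After a generic change of the variable `y`, its coordinates `t_i` are polynomials over
`K_w` in the coordinate `y`, and these can be chosen with zero derivative at `y`
(`exists_model_of_points`); then `y` is a simple root of the corresponding `P`, and a root persists
when the coefficients move a little (`eventually_exists_point`). The valuations of distinct closed
points are inequivalent, since the curve is separated (`SmoothProjectiveCurve.eq_of_localRing_le`),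
and weak approximation gives `g_i` over `K` and a nonzero `ϖ ∈ K`, small at every `w`, such that the
families `g_i(Y) + ϖ s_i` satisfy all the local conditions as long as the `s_i ∈ K` are bounded by
`2` at each `w`.

Irreducibility is arranged with the parameters `s_i`. The polynomial `Ψ(s, Y) = f(g(Y) + ϖ s, Y)`
arises from `f` by an automorphism of the polynomial ring, and `f` stays prime over every finite
extension of `K` because `Z` is geometrically integral. Let `N` be a finite extension of `K` that
contains the conjugates of `L` and is Galois over `k(ϖ)`; here `ϖ` is transcendental over `k`, and
`K` is finite over `k(ϖ)`. What is needed is Hilbert irreducibility over `N` with values `s_i` that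
are integral at all `w ∈ T`, and `s_i = α_i + β_i ϖ` with `α_i ∈ k` and `β_i ∈ ℕ` will do
(`exists_irreducible_map_eval`). Taking norms reduces the claim from `N` to `k(ϖ)`. There the field
`k` is uncountable: parameters are eliminated one at a time by `s = α + β ϖ`, with `α`
transcendental over the field generated by the coefficients. Only finitely many `β` fail
(`finite_setOf_not_irreducible_map`): if the specialised polynomial were reducible for infinitely
many `β`, two of them would share a factor over the algebraic closure, and the coefficients of such
a factor would be rational.

If `T` is empty, the argument is applied to one auxiliary closed point and to a local point that
exists by the Nullstellensatz.
-/

/-! ### Relatively algebraically closed subfields -/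

namespace LocGlob

open Polynomial
open scoped IntermediateField.algebraAdjoinAdjoin

section RelativelyClosed

variable {R Q E : Type*} [Field R] [Field Q] [Field E] [Algebra R Q] [Algebra Q E] [Algebra R E]
  [IsScalarTower R Q E]

/-- If `R` is relatively algebraically closed in `Q`, then `R(a)` is relatively algebraically closed
in `Q(a)` for every family `a` that is algebraically independent over `Q`: a suitable multiple of an
algebraic element is integral over `R[a]`, hence a polynomial in `a` over `Q`, with coefficients
integral over `R`. -/
theorem mem_adjoin_range_of_isAlgebraic [IsIntegrallyClosedIn R Q] {σ : Type*} {a : σ → E}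
    (ha : AlgebraicIndependent Q a) {y : E}
    (hy : y ∈ IntermediateField.adjoin Q (Set.range a))
    (hy' : IsAlgebraic (IntermediateField.adjoin R (Set.range a)) y) :
    y ∈ IntermediateField.adjoin R (Set.range a) := by
  classical
  let algR : Algebra (MvPolynomial σ R) E := (MvPolynomial.aeval a : _ →ₐ[R] E).toRingHom.toAlgebra
  let algQ : Algebra (MvPolynomial σ Q) E := (MvPolynomial.aeval a : _ →ₐ[Q] E).toRingHom.toAlgebra
  let alg2 : Algebra (MvPolynomial σ R) (MvPolynomial σ Q) := MvPolynomial.algebraMvPolynomial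
  have tow : IsScalarTower (MvPolynomial σ R) (MvPolynomial σ Q) E := .of_algebraMap_eq fun p => by
    change MvPolynomial.aeval a p = MvPolynomial.aeval a (MvPolynomial.map (algebraMap R Q) p)
    rw [MvPolynomial.aeval_map_algebraMap]
  have hmapinj : Function.Injective (algebraMap (MvPolynomial σ Q) E) := ha
  have h1 : IsAlgebraic (Algebra.adjoin R (Set.range a)) y :=
    (IsFractionRing.isAlgebraic_iff (Algebra.adjoin R (Set.range a))
      (IntermediateField.adjoin R (Set.range a)) E).2 hy'
  have h2 : IsAlgebraic (MvPolynomial σ R) y := by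
    let φ : MvPolynomial σ R →+* Algebra.adjoin R (Set.range a) :=
      (MvPolynomial.aeval a : _ →ₐ[R] E).toRingHom.codRestrict (Algebra.adjoin R (Set.range a))
        (fun p => by rw [Algebra.adjoin_range_eq_range_aeval]; exact ⟨p, rfl⟩)
    have hφ : Function.Surjective φ := by
      rintro ⟨z, hz⟩
      have hz' := hz
      rw [Algebra.adjoin_range_eq_range_aeval] at hz'
      obtain ⟨p, hp⟩ := hz'
      exact ⟨p, Subtype.ext hp⟩
    obtain ⟨f, hf, hf0⟩ := h1
    obtain ⟨g, rfl⟩ := Polynomial.map_surjective φ hφ f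
    refine ⟨g, fun h => hf (by simp [h]), ?_⟩
    rw [aeval_def, eval₂_map] at hf0
    exact hf0
  -- a multiple of `y` is integral over `R[a]`, hence lies in the normal ring `Q[a]`
  obtain ⟨d', hd0, hint⟩ := h2.exists_integral_multiple
  have hd'E : MvPolynomial.aeval a d' ≠ 0 := by
    have : Function.Injective (MvPolynomial.aeval a : MvPolynomial σ R →ₐ[R] E) :=
      ha.restrictScalars (algebraMap R Q).injective
    rwa [Ne, map_eq_zero_iff _ this]
  obtain ⟨r, s, rfl⟩ := (IntermediateField.mem_adjoin_range_iff Q a y).1 hy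
  set y := MvPolynomial.aeval a r / MvPolynomial.aeval a s with hydef
  rw [Algebra.smul_def] at hint
  change IsIntegral _ (MvPolynomial.aeval a d' * y) at hint
  have hs : MvPolynomial.aeval a s ≠ 0 ∨ y = 0 := by
    by_cases h : MvPolynomial.aeval a s = 0
    · right; rw [hydef, h, div_zero]
    · exact Or.inl h
  have hex : ∃ P : MvPolynomial σ Q, MvPolynomial.aeval a P = MvPolynomial.aeval a d' * y := by
    rcases hs with hs | hs
    · let K' := FractionRing (MvPolynomial σ Q)
      let ι : K' →ₐ[MvPolynomial σ Q] E := IsFractionRing.liftAlgHom (g := Algebra.ofId _ E) hmapinj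
      let z : K' := algebraMap _ K' (MvPolynomial.map (algebraMap R Q) d') *
        (algebraMap _ K' r / algebraMap _ K' s)
      have hz : ι z = MvPolynomial.aeval a d' * y := by
        simp only [z, map_mul, map_div₀, AlgHom.commutes]
        change MvPolynomial.aeval a (MvPolynomial.map (algebraMap R Q) d') *
          (MvPolynomial.aeval a r / MvPolynomial.aeval a s) = _
        rw [MvPolynomial.aeval_map_algebraMap]
      have hzi : IsIntegral (MvPolynomial σ Q) z := by
        rw [← isIntegral_algHom_iff ι ι.injective, hz]
        exact hint.tower_top
      obtain ⟨P, hP⟩ := IsIntegrallyClosed.isIntegral_iff.1 hzi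
      refine ⟨P, ?_⟩
      rw [← hz, ← hP, AlgHom.commutes]; rfl
    · exact ⟨0, by simp [hs]⟩
  obtain ⟨P, hP⟩ := hex
  have hPi : IsIntegral (MvPolynomial σ R) P := by
    rw [← isIntegral_algHom_iff (IsScalarTower.toAlgHom (MvPolynomial σ R) (MvPolynomial σ Q) E)
      hmapinj]
    change IsIntegral _ (MvPolynomial.aeval a P)
    rwa [hP]
  -- the coefficients of `P` are integral over `R`, hence belong to `R`
  have hco := MvPolynomial.isIntegral_iff_isIntegral_coeff.1 hPi
  have hmem : P ∈ Set.range (MvPolynomial.map (algebraMap R Q) : MvPolynomial σ R →+* _) := by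
    rw [MvPolynomial.mem_range_map_iff_coeffs_subset]
    intro c hc
    obtain ⟨n, -, rfl⟩ := MvPolynomial.mem_coeffs_iff.1 hc
    exact IsIntegrallyClosedIn.isIntegral_iff.1 (hco n)
  obtain ⟨P0, rfl⟩ := hmem
  rw [MvPolynomial.aeval_map_algebraMap] at hP
  have : y = MvPolynomial.aeval a P0 / MvPolynomial.aeval a d' := by
    rw [hP, mul_div_cancel_left₀ _ hd'E]
  rw [this]
  exact (IntermediateField.mem_adjoin_range_iff R a _).2 ⟨_, _, rfl⟩

/-- In characteristic zero, a field `Q` in which `R` is relatively algebraically closed is linearly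
disjoint over `R` from every finite extension `W` of `R`: the minimal polynomial over `Q` of a
primitive element of `W` has coefficients in `Q` that are algebraic over `R`, hence in `R`. -/
theorem linearDisjoint_of_isIntegrallyClosedIn {R Ω : Type*} [Field R] [CharZero R] [Field Ω]
    [Algebra R Ω] (Q W : IntermediateField R Ω) [FiniteDimensional R W]
    [IsIntegrallyClosedIn R Q] : Q.LinearDisjoint W := by
  obtain ⟨w, hw⟩ := Field.exists_primitive_element R W
  have hwi : IsIntegral R w := Algebra.IsIntegral.isIntegral w
  have hwΩ : IsIntegral R (w : Ω) := (isIntegral_algebraMap_iff (algebraMap W Ω).injective).2 hwi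
  have hmp : minpoly R (w : Ω) = minpoly R w :=
    minpoly.algebraMap_eq (algebraMap W Ω).injective w
  -- the minimal polynomial over `Q` has coefficients algebraic over `R`
  have hlift : minpoly Q (w : Ω) ∈ lifts (algebraMap R Q) := by
    rw [lifts_iff_coeff_lifts]
    intro n
    have := isIntegral_coeff_of_dvd _ _ (minpoly.monic hwΩ) (minpoly.monic hwΩ.tower_top)
      (minpoly.dvd_map_of_isScalarTower R Q (w : Ω)) n
    exact IsIntegrallyClosedIn.isIntegral_iff.1 this
  obtain ⟨g, hg, hgd, hgm⟩ := lifts_and_natDegree_eq_and_monic hlift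
    (minpoly.monic hwΩ.tower_top)
  have hdeg : (minpoly Q (w : Ω)).natDegree = (minpoly R w).natDegree := by
    apply le_antisymm
    · rw [← hmp, ← (minpoly.monic hwΩ).natDegree_map (algebraMap R Q)]
      exact natDegree_le_of_dvd (minpoly.dvd_map_of_isScalarTower R Q (w : Ω))
        ((minpoly.monic hwΩ).map _).ne_zero
    · rw [← hgd, ← hmp]
      refine natDegree_le_of_dvd (minpoly.dvd R _ ?_) hgm.ne_zero
      have := minpoly.aeval Q (w : Ω)
      rwa [← hg, aeval_map_algebraMap] at this
  let pb : PowerBasis R W := (IntermediateField.adjoin.powerBasis hwi).map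
    ((IntermediateField.equivOfEq hw).trans IntermediateField.topEquiv)
  have hgen : pb.gen = w := by
    simp only [pb, PowerBasis.map_gen]
    rfl
  have hdim : pb.dim = (minpoly R w).natDegree := by
    rw [← pb.natDegree_minpoly, hgen]
  refine .of_basis_right pb.basis ?_
  have hli := linearIndependent_pow (K := Q) (w : Ω)
  let e : Fin pb.dim ≃ Fin (minpoly Q (w : Ω)).natDegree := finCongr (hdim.trans hdeg.symm)
  have := hli.comp e e.injective
  have heq : (W.val ∘ pb.basis : Fin pb.dim → Ω) = (fun i : Fin _ => (w : Ω) ^ (i : ℕ)) ∘ e := by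
    funext i
    simp [e, hgen]
  rw [heq]
  exact this

end RelativelyClosed

end LocGlob

namespace LocGlob

open Polynomial IntermediateField

section LinearlyDisjoint

/-- If `R` is relatively algebraically closed in `Q` and `W` is algebraic over `R`, then `Q ∩ W(b) =
R(b)` for `b ∈ Q` transcendental over `R`. By linear disjointness, a relation `p(b) = c q(b)` with
coefficients in `W` can be nontrivial only if `1` and `c` are linearly dependent over `R(b)`. -/
theorem mem_adjoin_simple_of_mem {R Ω : Type*} [Field R] [CharZero R] [Field Ω] [Algebra R Ω]
    (Q W : IntermediateField R Ω) [IsIntegrallyClosedIn R Q] [Algebra.IsAlgebraic R W] {b c : Ω}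
    (hb : b ∈ Q) (hbt : Transcendental R b) (hc : c ∈ Q)
    (hcW : c ∈ IntermediateField.adjoin W {b}) : c ∈ R⟮b⟯ := by
  classical
  by_contra hcb
  obtain ⟨p, q, hpq⟩ := (mem_adjoin_simple_iff W c).1 hcW
  have hc0 : c ≠ 0 := fun h => hcb (h ▸ zero_mem _)
  have hq0 : aeval b q ≠ 0 := fun h => hc0 (by rw [hpq, h, div_zero])
  -- only finitely many elements of `W` are involved
  let S : Set Ω := (fun w : W => (w : Ω)) '' ((p.coeffs ∪ q.coeffs : Finset W) : Set W)
  have hSf : S.Finite := (Finset.finite_toSet _).image _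
  have : Finite S := hSf
  have hSi : ∀ x ∈ S, IsIntegral R x := by
    rintro _ ⟨w, -, rfl⟩
    exact (isIntegral_algebraMap_iff (algebraMap W Ω).injective).2 (Algebra.IsIntegral.isIntegral w)
  let W' : IntermediateField R Ω := IntermediateField.adjoin R S
  have : FiniteDimensional R W' := finiteDimensional_adjoin hSi
  have hdis := linearDisjoint_of_isIntegrallyClosedIn Q W'
  have hmem : ∀ r : W[X], r.coeffs ⊆ p.coeffs ∪ q.coeffs → ∀ n, (r.coeff n : Ω) ∈ W' := by
    intro r hr n
    by_cases h : r.coeff n = 0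
    · simp [h]
    · exact subset_adjoin R S ⟨_, hr (coeff_mem_coeffs h), rfl⟩
  have hp' := hmem p Finset.subset_union_left
  have hq' := hmem q Finset.subset_union_right
  let bQ : Q := ⟨b, hb⟩
  let cQ : Q := ⟨c, hc⟩
  let bb : R⟮b⟯ := ⟨b, mem_adjoin_simple_self R b⟩
  have hle : R⟮b⟯ ≤ Q := adjoin_simple_le_iff.2 hb
  let algbQ : Algebra R⟮b⟯ Q := (inclusion hle).toRingHom.toAlgebra
  have tow : IsScalarTower R R⟮b⟯ Q := .of_algebraMap_eq fun _ => rfl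
  have h1 : LinearIndependent R (fun i : ℕ => bb ^ i) := by
    have hbb : Transcendental R bb := fun h => hbt (h.algebraMap (A := Ω))
    have := (basisMonomials R).linearIndependent.map' (aeval bb).toLinearMap
      (LinearMap.ker_eq_bot.2 (transcendental_iff_injective.1 hbb))
    have heq : (fun i : ℕ => bb ^ i) = (aeval bb).toLinearMap ∘ basisMonomials R := by
      funext i
      simp
    rw [heq]
    exact this
  have h2 : LinearIndependent R⟮b⟯ ![(1 : Q), cQ] := by
    rw [LinearIndependent.pair_iff' one_ne_zero]
    intro t ht
    apply hcb
    have : (t : Ω) = c := by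
      have := congrArg (fun z : Q => (z : Ω)) ht
      rw [Algebra.smul_def, mul_one] at this
      exact this
    exact this ▸ t.2
  -- if `c ∉ R(b)`, the products `b ^ i` and `b ^ i * c` are independent over `R`, hence over `W'`
  have h3 := hdis.linearIndependent_left (linearIndependent_smul h1 h2)
  rw [linearIndependent_iff'] at h3
  let N := max p.natDegree q.natDegree + 1
  let g : ℕ × Fin 2 → W' := fun x => ![⟨_, hp' x.1⟩, -⟨_, hq' x.1⟩] x.2
  have hsum : ∀ r : W[X], r.natDegree < N →
      ∑ i ∈ Finset.range N, (r.coeff i : Ω) * b ^ i = aeval b r := by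
    intro r hr
    rw [aeval_eq_sum_range' hr]
    rfl
  have h4 := h3 (Finset.range N ×ˢ Finset.univ) g (by
    rw [Finset.sum_product]
    simp only [Fin.sum_univ_two, g, Function.comp_apply, Algebra.smul_def]
    have e1 : aeval b p - c * aeval b q = 0 := by
      rw [hpq, div_mul_cancel₀ _ hq0, sub_self]
    rw [← e1, ← hsum p (Nat.lt_succ_of_le (le_max_left _ _)),
      ← hsum q (Nat.lt_succ_of_le (le_max_right _ _)), Finset.mul_sum, ← Finset.sum_sub_distrib]
    refine Finset.sum_congr rfl fun i _ => ?_
    change (p.coeff i : Ω) * (b ^ i * 1) + -(q.coeff i : Ω) * (b ^ i * c) = _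
    ring)
  apply hq0
  rw [← hsum q (Nat.lt_succ_of_le (le_max_right _ _))]
  refine Finset.sum_eq_zero fun i hi => ?_
  have := h4 (i, 1) (by simpa using hi)
  have h5 : (-(q.coeff i : Ω)) = 0 := congrArg (fun z : W' => (z : Ω)) this
  rw [neg_eq_zero.1 h5, zero_mul]

/-- Let `W₁` be algebraic over `F(a)`, and let `F` be relatively algebraically closed in `W₂ ∋ b`.
An element of both `W₁(b)` and `W₂(a)` lies in `F(a, b)`: this is `mem_adjoin_simple_of_mem` over
the base `F(a)`, which is relatively algebraically closed in `W₂(a)`. -/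
theorem mem_adjoin_pair_of_mem {F Ω : Type*} [Field F] [CharZero F] [Field Ω] [Algebra F Ω]
    (W₁ W₂ : IntermediateField F Ω) [IsIntegrallyClosedIn F W₂] {a b c : Ω} (ha : a ∈ W₁)
    (hb : b ∈ W₂) (hW : ∀ w ∈ W₁, IsAlgebraic F⟮a⟯ w) (hat : Transcendental W₂ a)
    (hbt : Transcendental F⟮a⟯ b)
    (h₁ : c ∈ IntermediateField.adjoin W₁ {b}) (h₂ : c ∈ IntermediateField.adjoin W₂ {a}) :
    c ∈ IntermediateField.adjoin F {a, b} := by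
  have hle₁ : F⟮a⟯ ≤ W₁ := adjoin_simple_le_iff.2 ha
  have hle₂ : F⟮a⟯ ≤ (IntermediateField.adjoin W₂ {a}).restrictScalars F :=
    adjoin_simple_le_iff.2 (mem_adjoin_simple_self W₂ a)
  let W : IntermediateField F⟮a⟯ Ω := extendScalars hle₁
  let Q : IntermediateField F⟮a⟯ Ω := extendScalars hle₂
  have : Algebra.IsAlgebraic F⟮a⟯ W := ⟨fun w => by
    have := hW w.1 w.2
    exact (isAlgebraic_algebraMap_iff (algebraMap W Ω).injective).1 this⟩
  have hai : AlgebraicIndependent W₂ (fun _ : Unit => a) :=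
    (algebraicIndependent_unique_type_iff).2 hat
  have hr : Set.range (fun _ : Unit => a) = {a} := by simp
  have : IsIntegrallyClosedIn F⟮a⟯ Q := by
    rw [isIntegrallyClosedIn_iff]
    refine ⟨fun _ _ h => Subtype.ext (congrArg (fun z : Q => (z : Ω)) h), fun {x} hx => ?_⟩
    have hx' : IsAlgebraic F⟮a⟯ (x : Ω) := hx.isAlgebraic.algebraMap
    have hx2 : (x : Ω) ∈ IntermediateField.adjoin W₂ {a} := x.2
    have := mem_adjoin_range_of_isAlgebraic (R := F) hai (y := (x : Ω))
    rw [hr] at this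
    exact ⟨⟨x, this hx2 hx'⟩, Subtype.ext rfl⟩
  have hbQ : b ∈ Q := by
    have : algebraMap W₂ Ω ⟨b, hb⟩ ∈ IntermediateField.adjoin W₂ {a} :=
      IntermediateField.algebraMap_mem _ _
    exact this
  have := mem_adjoin_simple_of_mem Q W hbQ hbt h₂ h₁
  rw [← adjoin_simple_adjoin_simple F a b]
  exact this

end LinearlyDisjoint

/-! ### Reducible members of a pencil -/

section Pencil

theorem isAlgebraic_adjoin_image_iff {F E E' : Type*} [Field F] [Field E] [Field E'] [Algebra F E]
    [Algebra F E'] (φ : E →ₐ[F] E') (S : Set E) (y : E) :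
    IsAlgebraic (IntermediateField.adjoin F (φ '' S)) (φ y) ↔
      IsAlgebraic (IntermediateField.adjoin F S) y := by
  let e : IntermediateField.adjoin F S ≃ₐ[F] IntermediateField.adjoin F (φ '' S) :=
    (IntermediateField.equivMap _ φ).trans (equivOfEq (adjoin_map F S φ))
  refine isAlgebraic_ringHom_iff_of_comp_eq e φ φ.injective ?_
  ext z
  rfl

variable {F U Ω Ω' : Type*} [Field F] [Field U] [Field Ω] [Field Ω'] [Algebra F U] [Algebra F Ω]
  [Algebra F Ω'] [Algebra U Ω'] [IsScalarTower F U Ω']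

/-- Let `Θ` embed an algebraically closed field `Ω` into `Ω'`, and let `c ∈ Ω` be algebraic over
`F(x, a)`. If `Θ a` lies in a field `U` in which `F` is relatively algebraically closed, `Θ x` is
transcendental over `U`, and `Θ c` lies in `U(Θ x)`, then already `c ∈ W(x)` for an algebraic
extension `W` of `F(a)` inside `Ω` in which `F` is relatively algebraically closed. The field `W` is
the preimage under `Θ` of the algebraic closure of `F(α)` in `U`, where `α = Θ a`. -/
theorem exists_intermediateField_mem_adjoin [IsAlgClosed Ω] [IsIntegrallyClosedIn F U]
    (Θ : Ω →ₐ[F] Ω') {x a c : Ω} {α : U} (ha : Θ a = algebraMap U Ω' α)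
    (hx : Transcendental U (Θ x)) (hc : IsAlgebraic (IntermediateField.adjoin F {x, a}) c)
    (hc' : Θ c ∈ IntermediateField.adjoin U {Θ x}) :
    ∃ W : IntermediateField F Ω, a ∈ W ∧ (∀ w ∈ W, IsAlgebraic F⟮a⟯ w) ∧
      IsIntegrallyClosedIn F W ∧ Transcendental W x ∧ c ∈ IntermediateField.adjoin W {x} := by
  let j : U →ₐ[F] Ω' := IsScalarTower.toAlgHom F U Ω'
  let V : IntermediateField F U := (algebraicClosure F⟮α⟯ U).restrictScalars F
  let W : IntermediateField F Ω := (V.map j).comap Θ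
  have hV : ∀ v : U, v ∈ V ↔ IsAlgebraic F⟮α⟯ v := fun v => mem_algebraicClosure_iff
  have hW : ∀ w : Ω, w ∈ W ↔ ∃ v ∈ V, j v = Θ w := fun w => Iff.rfl
  have hαV : α ∈ V := (hV α).2 (isAlgebraic_algebraMap (⟨α, mem_adjoin_simple_self F α⟩ : F⟮α⟯))
  have hj : ∀ v : U, IsAlgebraic F⟮Θ a⟯ (j v) ↔ IsAlgebraic F⟮α⟯ v := by
    intro v
    have := isAlgebraic_adjoin_image_iff j {α} v
    rw [Set.image_singleton] at this
    rw [← this, ha]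
    rfl
  have hΘ : ∀ w : Ω, IsAlgebraic F⟮Θ a⟯ (Θ w) ↔ IsAlgebraic F⟮a⟯ w := by
    intro w
    have := isAlgebraic_adjoin_image_iff Θ {a} w
    rwa [Set.image_singleton] at this
  have hWalg : ∀ w ∈ W, IsAlgebraic F⟮a⟯ w := by
    intro w hw
    obtain ⟨v, hv, hvw⟩ := (hW w).1 hw
    rw [← hΘ, ← hvw, hj, ← hV]
    exact hv
  -- every element of `V` comes from `W`
  have hlift : ∀ v ∈ V, ∃ w ∈ W, Θ w = j v := by
    intro v hv
    have h1 : IsAlgebraic F⟮Θ a⟯ (j v) := (hj v).2 ((hV v).1 hv)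
    let algΘ : Algebra Ω Ω' := Θ.toRingHom.toAlgebra
    have h2 : IsAlgebraic Ω (j v) := by
      have hle : F⟮Θ a⟯ ≤ Θ.fieldRange := adjoin_simple_le_iff.2 ⟨a, rfl⟩
      let i : F⟮Θ a⟯ →+* Ω := (AlgEquiv.ofInjectiveField Θ).symm.toRingEquiv.toRingHom.comp
        (inclusion hle).toRingHom
      refine h1.ringHom_of_comp_eq i (RingHom.id Ω') i.injective ?_
      ext z
      have : AlgEquiv.ofInjectiveField Θ ((AlgEquiv.ofInjectiveField Θ).symm (inclusion hle z)) =
        inclusion hle z := AlgEquiv.apply_symm_apply _ _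
      exact congrArg Subtype.val this
    have h3 : IsIntegral Ω (j v) := h2.isIntegral
    have hsp := IsAlgClosed.splits (minpoly Ω (j v))
    have := IsAlgClosed.degree_eq_one_of_irreducible Ω (minpoly.irreducible h3)
    obtain ⟨w, hw⟩ := minpoly.mem_range_of_degree_eq_one Ω (j v) this
    exact ⟨w, (hW w).2 ⟨v, hv, hw.symm⟩, hw⟩
  have hxW : Transcendental W x := by
    intro h
    apply hx
    let i : W →+* U := (AlgEquiv.ofInjectiveField j).symm.toRingEquiv.toRingHom.comp
      ((Θ.toRingHom.comp (algebraMap W Ω)).codRestrict j.fieldRange (fun w => by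
        obtain ⟨v, -, hv⟩ := (hW w).1 w.2
        exact ⟨v, hv⟩))
    refine h.ringHom_of_comp_eq i Θ i.injective ?_
    ext z
    have : ∀ y : j.fieldRange, j ((AlgEquiv.ofInjectiveField j).symm y) = y := fun y =>
      congrArg Subtype.val (AlgEquiv.apply_symm_apply (AlgEquiv.ofInjectiveField j) y)
    exact this _
  refine ⟨W, (hW a).2 ⟨α, hαV, ha.symm⟩, hWalg, ?_, hxW, ?_⟩
  · rw [isIntegrallyClosedIn_iff]
    refine ⟨(algebraMap F W).injective, fun {w} hw => ?_⟩
    obtain ⟨v, -, hv⟩ := (hW w).1 w.2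
    have h1 : IsIntegral F (Θ w) := (hw.algebraMap (B := Ω)).map Θ
    rw [← hv] at h1
    have h2 : IsIntegral F v := (isIntegral_algHom_iff j j.injective).1 h1
    obtain ⟨y, rfl⟩ := IsIntegrallyClosedIn.isIntegral_iff.1 h2
    refine ⟨y, Subtype.ext (Θ.injective ?_)⟩
    change Θ _ = Θ _
    rw [← hv, AlgHom.commutes]
    exact Θ.commutes y
  · have : IsIntegrallyClosedIn V U := by
      rw [isIntegrallyClosedIn_iff]
      refine ⟨(algebraMap V U).injective, fun {u} hu => ?_⟩
      have h1 : IsAlgebraic (algebraicClosure F⟮α⟯ U) u := hu.isAlgebraic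
      have h2 : u ∈ algebraicClosure (algebraicClosure F⟮α⟯ U) U := mem_algebraicClosure_iff.2 h1
      rw [algebraicClosure.algebraicClosure_eq_bot] at h2
      obtain ⟨y, hy⟩ := IntermediateField.mem_bot.1 h2
      exact ⟨y, hy⟩
    have hai : AlgebraicIndependent U (fun _ : Unit => Θ x) :=
      (algebraicIndependent_unique_type_iff).2 hx
    have key := mem_adjoin_range_of_isAlgebraic (R := V) hai (y := Θ c)
    rw [Set.range_const] at key
    have hcV : IsAlgebraic (IntermediateField.adjoin V {Θ x}) (Θ c) := by
      have h1 := (isAlgebraic_adjoin_image_iff Θ {x, a} c).2 hc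
      have hle : IntermediateField.adjoin F (Θ '' {x, a}) ≤
          (IntermediateField.adjoin V {Θ x}).restrictScalars F := by
        rw [adjoin_le_iff]
        rintro _ ⟨z, rfl | rfl, rfl⟩
        · exact mem_adjoin_simple_self V _
        · rw [ha]
          exact IntermediateField.algebraMap_mem (IntermediateField.adjoin V {Θ x})
            (⟨α, hαV⟩ : V)
      exact h1.ringHom_of_comp_eq (inclusion hle) (RingHom.id Ω') (inclusion hle).injective rfl
    obtain ⟨p, q, hpq⟩ := (mem_adjoin_simple_iff V _).1 (key hc' hcV)
    choose! lw hlw hlw' using hlift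
    have hpoly : ∀ r : V[X], ∃ r' : W[X], Θ (aeval x r') = aeval (Θ x) r := by
      intro r
      refine ⟨∑ i ∈ Finset.range (r.natDegree + 1), monomial i ⟨lw (r.coeff i),
        hlw _ (r.coeff i).2⟩, ?_⟩
      rw [aeval_eq_sum_range (x := Θ x), map_sum, map_sum]
      refine Finset.sum_congr rfl fun i _ => ?_
      rw [aeval_monomial, map_mul, map_pow, Algebra.smul_def]
      congr 1
      exact hlw' _ (r.coeff i).2
    obtain ⟨p', hp'⟩ := hpoly p
    obtain ⟨q', hq'⟩ := hpoly q
    rw [mem_adjoin_simple_iff]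
    refine ⟨p', q', Θ.injective ?_⟩
    change Θ _ = Θ _
    rw [hpq, map_div₀, hp', hq']

/-- A Bertini type statement for the pencil `s = α + β x`. Let `D = F(x, s)` and `G = U(x')`, where
`F` is relatively algebraically closed in `U` and `x'` is transcendental over `U`. An irreducible
polynomial over `D` stays irreducible under the specialisations `x ↦ x'`, `s ↦ α + β x'` for all but
finitely many natural numbers `β`.

If two of the specialisations are reducible, with factors that come from the same factor over the
algebraic closure of `D`, then a coefficient of this factor is rational in the direction `x` over
algebraic extensions of both `F(s - β₁ x)` and `F(s - β₂ x)`, and `mem_adjoin_pair_of_mem` places it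
in `F(s - β₁ x, s - β₂ x) = D`. -/
theorem finite_setOf_not_irreducible_map {F U D G : Type*} [Field F] [CharZero F] [Field U]
    [Field D] [Field G] [Algebra F U] [Algebra F D] [Algebra F G] [Algebra U G]
    [IsScalarTower F U G] [IsIntegrallyClosedIn F U] {x s : D}
    (hD : IntermediateField.adjoin F {x, s} = ⊤) {x' : G} (hx' : Transcendental U x')
    (hG : IntermediateField.adjoin U {x'} = ⊤) {α : U} (θ : ℕ → D →ₐ[F] G)
    (hθx : ∀ β, θ β x = x') (hθs : ∀ β, θ β s = algebraMap U G α + β * x')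
    {H : D[X]} (hH : Irreducible H) : {β | ¬ Irreducible (H.map (θ β : D →+* G))}.Finite := by
  classical
  have : CharZero D := charZero_of_injective_algebraMap (algebraMap F D).injective
  by_contra hinf
  let Ω := AlgebraicClosure D
  let Ω' := AlgebraicClosure G
  have hΘ : ∀ β, ∃ Θ : Ω →ₐ[F] Ω', ∀ d : D, Θ (algebraMap D Ω d) = algebraMap G Ω' (θ β d) := by
    intro β
    let : Algebra D Ω' := ((algebraMap G Ω').comp (θ β : D →+* G)).toAlgebra
    have : IsScalarTower F D Ω' := .of_algebraMap_eq fun y => by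
      change _ = algebraMap G Ω' (θ β (algebraMap F D y))
      rw [AlgHom.commutes, ← IsScalarTower.algebraMap_apply]
    let Θ : Ω →ₐ[D] Ω' := IsAlgClosed.lift
    exact ⟨Θ.restrictScalars F, fun d => Θ.commutes d⟩
  choose Θ hΘ using hΘ
  have hH0 : H ≠ 0 := hH.ne_zero
  have hcomp : ∀ β, (Θ β : Ω →+* Ω').comp (algebraMap D Ω) =
      (algebraMap G Ω').comp (θ β : D →+* G) := fun β => RingHom.ext (hΘ β)
  -- a nontrivial factor of a reducible specialisation lifts to the algebraic closure of `D`
  have hfac : ∀ β, ¬ Irreducible (H.map (θ β : D →+* G)) → ∃ B : Polynomial Ω, B.Monic ∧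
      B ∣ H.map (algebraMap D Ω) ∧ 0 < B.natDegree ∧ B.natDegree < H.natDegree ∧
      ∀ n, Θ β (B.coeff n) ∈ Set.range (algebraMap G Ω') := by
    intro β hβ
    have hdeg : (H.map (θ β : D →+* G)).natDegree = H.natDegree := natDegree_map _
    have hHpos : 0 < H.natDegree := hH.natDegree_pos
    have hne : H.map (θ β : D →+* G) ≠ 0 := by simpa using hH0
    have hnu : ¬ IsUnit (H.map (θ β : D →+* G)) := fun h => by
      have := natDegree_eq_zero_of_isUnit h
      omega
    obtain ⟨A, hAd, hA0, hAlt⟩ : ∃ A : G[X], A ∣ H.map (θ β : D →+* G) ∧ 0 < A.natDegree ∧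
        A.natDegree < H.natDegree := by
      rw [irreducible_iff] at hβ
      push Not at hβ
      obtain ⟨A, B, hAB, hA, hB⟩ := hβ hnu
      have hA0 : A ≠ 0 := by rintro rfl; simp [hAB] at hne
      have hB0 : B ≠ 0 := by rintro rfl; simp [hAB] at hne
      have h1 := natDegree_mul hA0 hB0
      rw [← hAB, hdeg] at h1
      have h2 : A.natDegree ≠ 0 := fun h => hA (isUnit_iff_degree_eq_zero.2
        (by rw [degree_eq_natDegree hA0, h]; rfl))
      have h3 : B.natDegree ≠ 0 := fun h => hB (isUnit_iff_degree_eq_zero.2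
        (by rw [degree_eq_natDegree hB0, h]; rfl))
      exact ⟨A, ⟨B, hAB⟩, by omega, by omega⟩
    have hA0' : A ≠ 0 := by rintro rfl; simp at hA0
    let A₁ := normalize A
    have hA₁m : A₁.Monic := monic_normalize hA0'
    have hA₁d : A₁ ∣ H.map (θ β : D →+* G) := normalize_dvd_iff.2 hAd
    have hA₁deg : A₁.natDegree = A.natDegree := by
      rw [natDegree_eq_of_degree_eq (degree_normalize)]
    have hlifts : A₁.map (algebraMap G Ω') ∈ lifts (Θ β : Ω →+* Ω') := by
      refine Splits.mem_lift_of_roots_mem_range (IsAlgClosed.splits _) (hA₁m.map _) _ ?_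
      intro r hr
      have hr1 : (A₁.map (algebraMap G Ω')).IsRoot r := isRoot_of_mem_roots hr
      have hr2 : ((H.map (algebraMap D Ω)).map (Θ β : Ω →+* Ω')).IsRoot r := by
        rw [Polynomial.map_map, hcomp, ← Polynomial.map_map]
        exact hr1.dvd (Polynomial.map_dvd _ hA₁d)
      have hsp : (H.map (algebraMap D Ω)).Splits := IsAlgClosed.splits _
      have hmem : r ∈ ((H.map (algebraMap D Ω)).map (Θ β : Ω →+* Ω')).roots := by
        rw [mem_roots (by simpa using hH0)]
        exact hr2
      rw [hsp.roots_map] at hmem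
      obtain ⟨w, -, hw⟩ := Multiset.mem_map.1 hmem
      exact ⟨w, hw⟩
    obtain ⟨B, hBmap, hBdeg, hBm⟩ := lifts_and_natDegree_eq_and_monic hlifts (hA₁m.map _)
    refine ⟨B, hBm, ?_, ?_, ?_, ?_⟩
    · rw [← Polynomial.map_dvd_map' (Θ β : Ω →+* Ω'), hBmap, Polynomial.map_map, hcomp,
        ← Polynomial.map_map]
      exact Polynomial.map_dvd _ hA₁d
    · rw [hBdeg, natDegree_map, hA₁deg]; exact hA0
    · rw [hBdeg, natDegree_map, hA₁deg]; exact hAlt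
    · intro n
      refine ⟨A₁.coeff n, ?_⟩
      rw [← coeff_map, ← hBmap, coeff_map]
      rfl
  choose! B hBm hBd hB0 hBlt hBc using hfac
  -- by the pigeonhole principle, two reducible specialisations share the factor
  have hfin : {P : Polynomial Ω | P.Monic ∧ P ∣ H.map (algebraMap D Ω)}.Finite := by
    have := fintypeSubtypeMonicDvd (H.map (algebraMap D Ω)) (by simpa using hH0)
    refine (Set.finite_range (fun P : {g : Polynomial Ω // g.Monic ∧ g ∣ H.map (algebraMap D Ω)} =>
      (P : Polynomial Ω))).subset fun P hP => ⟨⟨P, hP⟩, rfl⟩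
  obtain ⟨β₁, hβ₁, β₂, hβ₂, hne, hBB⟩ :=
    Set.Infinite.exists_ne_map_eq_of_mapsTo (f := B) (Set.not_finite.1 hinf)
      (fun β hβ => by exact ⟨hBm β hβ, hBd β hβ⟩) hfin
  have hδ : ((β₁ : Ω) - β₂) ≠ 0 := sub_ne_zero.2 (by exact_mod_cast hne)
  let X : Ω := algebraMap D Ω x
  let S : Ω := algebraMap D Ω s
  have hpair : IntermediateField.adjoin F {X, S} =
      (IsScalarTower.toAlgHom F D Ω).fieldRange := by
    rw [AlgHom.fieldRange_eq_map, ← hD, adjoin_map, Set.image_pair]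
    rfl
  -- the coefficients of the common factor lie in `D`
  have hcoeff : ∀ n, (B β₁).coeff n ∈ Set.range (algebraMap D Ω) := by
    intro n
    set c := (B β₁).coeff n with hcdef
    have hone : ∀ β, Θ β c ∈ Set.range (algebraMap G Ω') →
        ∃ W : IntermediateField F Ω, S - β * X ∈ W ∧ (∀ w ∈ W, IsAlgebraic F⟮S - β * X⟯ w) ∧
        IsIntegrallyClosedIn F W ∧ Transcendental W X ∧ c ∈ IntermediateField.adjoin W {X} := by
      rintro β ⟨g, hg⟩
      have hΘX : Θ β X = algebraMap G Ω' x' := by rw [hΘ, hθx]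
      refine exists_intermediateField_mem_adjoin (Θ β) (α := α) ?_ ?_ ?_ ?_
      · rw [map_sub, map_mul, map_natCast, hΘ, hΘX, hθs, map_add, map_mul, map_natCast,
          add_sub_cancel_right, ← IsScalarTower.algebraMap_apply]
      · rw [hΘX]
        exact fun h => hx' ((isAlgebraic_algebraMap_iff (algebraMap G Ω').injective).1 h)
      · have h1 : IsAlgebraic D c := Algebra.IsAlgebraic.isAlgebraic c
        have hle : (IsScalarTower.toAlgHom F D Ω).fieldRange ≤
            IntermediateField.adjoin F {X, S - β * X} := by
          rw [← hpair, adjoin_le_iff]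
          have hX : X ∈ IntermediateField.adjoin F {X, S - β * X} := subset_adjoin _ _ (by simp)
          have hS : S - β * X ∈ IntermediateField.adjoin F {X, S - β * X} :=
            subset_adjoin _ _ (by simp)
          rintro z (rfl | rfl)
          · exact hX
          · have := add_mem hS (mul_mem (_root_.natCast_mem _ β) hX)
            rwa [sub_add_cancel] at this
        let i : D →+* IntermediateField.adjoin F {X, S - β * X} :=
          (algebraMap D Ω).codRestrict _ (fun d => hle ⟨d, rfl⟩)
        exact h1.ringHom_of_comp_eq i (RingHom.id Ω) i.injective rfl
      · have hgm : g ∈ IntermediateField.adjoin U {x'} := hG ▸ mem_top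
        obtain ⟨p, q, rfl⟩ := (mem_adjoin_simple_iff U g).1 hgm
        rw [mem_adjoin_simple_iff]
        refine ⟨p, q, ?_⟩
        rw [← hg, hΘX, map_div₀, aeval_algebraMap_apply, aeval_algebraMap_apply]
    obtain ⟨W₁, ha, hW₁, -, hX₁, hc₁⟩ := hone β₁ (hBc β₁ hβ₁ n)
    obtain ⟨W₂, hb, -, hW₂, hX₂, hc₂⟩ := hone β₂ (by rw [hcdef, hBB]; exact hBc β₂ hβ₂ n)
    set a := S - β₁ * X with hadef
    set b := S - β₂ * X with hbdef
    have hXab : X = (b - a) / (β₁ - β₂) := by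
      rw [eq_div_iff hδ, hadef, hbdef]; ring
    have hXmem : ∀ {F' : Type _} [Field F'] [Algebra F' Ω] (Q : IntermediateField F' Ω),
        a ∈ Q → b ∈ Q → X ∈ Q := fun Q h₁ h₂ => by
      rw [hXab]
      exact div_mem (sub_mem h₂ h₁) (sub_mem (_root_.natCast_mem _ _) (_root_.natCast_mem _ _))
    have htr : ∀ (W : IntermediateField F Ω), Transcendental W X → ∀ y ∈ W, ∀ m : ℤ, m ≠ 0 →
        Transcendental W (y + m * X) := by
      intro W hW y hy m hm h
      apply hW
      have h1 : IsAlgebraic W (y : Ω) := isAlgebraic_algebraMap (⟨y, hy⟩ : W)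
      have h2 : IsAlgebraic W ((m : Ω)) := isAlgebraic_intCast m
      have h3 := (h.sub h1).mul h2.inv
      have : (y + m * X - y) * (m : Ω)⁻¹ = X := by
        have : (m : Ω) ≠ 0 := by exact_mod_cast hm
        rw [add_sub_cancel_left, mul_comm, inv_mul_cancel_left₀ this]
      rwa [this] at h3
    have hmem := mem_adjoin_pair_of_mem W₁ W₂ ha hb hW₁ (c := c) ?_ ?_ ?_ ?_
    · have hle : IntermediateField.adjoin F {a, b} ≤ IntermediateField.adjoin F {X, S} := by
        rw [adjoin_le_iff]
        have hX : X ∈ IntermediateField.adjoin F {X, S} := subset_adjoin _ _ (by simp)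
        have hS : S ∈ IntermediateField.adjoin F {X, S} := subset_adjoin _ _ (by simp)
        rintro z (rfl | rfl)
        · exact sub_mem hS (mul_mem (_root_.natCast_mem _ _) hX)
        · exact sub_mem hS (mul_mem (_root_.natCast_mem _ _) hX)
      have := hle hmem
      rw [hpair] at this
      exact this
    · have := htr W₂ hX₂ b hb ((β₂ : ℤ) - β₁) (by omega)
      convert this using 1
      rw [hadef, hbdef]; push_cast; ring
    · have := htr W₁ hX₁ a ha ((β₁ : ℤ) - β₂) (by omega)
      have hle : F⟮a⟯ ≤ W₁ := adjoin_simple_le_iff.2 ha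
      intro h
      apply this
      have h' := h.ringHom_of_comp_eq (inclusion hle) (RingHom.id Ω) (inclusion hle).injective rfl
      convert h' using 1
      change _ = b
      rw [hadef, hbdef]; push_cast; ring
    · refine (adjoin_simple_le_iff.2 (hXmem _ ?_ ?_) : IntermediateField.adjoin W₁ {X} ≤ _) hc₁
      · exact IntermediateField.algebraMap_mem (IntermediateField.adjoin W₁ {b}) (⟨a, ha⟩ : W₁)
      · exact mem_adjoin_simple_self _ _
    · refine (adjoin_simple_le_iff.2 (hXmem _ ?_ ?_) : IntermediateField.adjoin W₂ {X} ≤ _) hc₂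
      · exact mem_adjoin_simple_self _ _
      · exact IntermediateField.algebraMap_mem (IntermediateField.adjoin W₂ {a}) (⟨b, hb⟩ : W₂)
  obtain ⟨B', hB', hB'd, -⟩ := lifts_and_natDegree_eq_and_monic
    ((lifts_iff_coeff_lifts _).2 hcoeff) (hBm β₁ hβ₁)
  have hdvd : B' ∣ H := by
    rw [← Polynomial.map_dvd_map' (algebraMap D Ω), hB']
    exact hBd β₁ hβ₁
  obtain ⟨Q, hQ⟩ := hdvd
  have h0 := hB0 β₁ hβ₁
  have hlt := hBlt β₁ hβ₁
  rcases hH.isUnit_or_isUnit hQ with h | h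
  · have := natDegree_eq_zero_of_isUnit h
    omega
  · have h1 := natDegree_eq_zero_of_isUnit h
    have hB'0 : B' ≠ 0 := by rintro rfl; simp [hQ] at hH0
    have h2 := natDegree_mul hB'0 h.ne_zero
    rw [← hQ] at h2
    omega

end Pencil

/-! ### Elimination of one parameter -/

section Iteration

theorem irreducible_of_irreducible_map_field {E E' : Type*} [Field E] [Field E'] (f : E →+* E')
    {P : E[X]} (h : Irreducible (P.map f)) : Irreducible P := by
  have : IsLocalHom (mapRingHom f) := ⟨fun Q hQ => by
    have h0 : Q ≠ 0 := by rintro rfl; simp at hQ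
    have := natDegree_eq_zero_of_isUnit hQ
    rw [coe_mapRingHom, natDegree_map] at this
    rw [isUnit_iff_degree_eq_zero, degree_eq_natDegree h0, this]
    rfl⟩
  exact Irreducible.of_map (f := mapRingHom f) h

/-- An uncountable field `k` has elements that are transcendental over a relatively algebraically
closed subfield containing a given finite set, since that subfield can be taken countable. -/
theorem exists_transcendental_of_uncountable (k : Type*) [Field k] [CharZero k]
    (hk : Cardinal.aleph0 < Cardinal.mk k) {S : Set k} (hS : S.Finite) :
    ∃ k₀ : Subfield k, S ⊆ k₀ ∧ IsIntegrallyClosedIn k₀ k ∧ ∃ α : k, Transcendental k₀ α := by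
  let k₁ := Subfield.closure S
  let k₀ := (algebraicClosure k₁ k).toSubfield
  have hle : k₁ ≤ k₀ := fun x hx => (algebraicClosure k₁ k).algebraMap_mem ⟨x, hx⟩
  have hclosed : IsIntegrallyClosedIn k₀ k := by
    rw [isIntegrallyClosedIn_iff]
    refine ⟨(algebraMap k₀ k).injective, fun {u} hu => ?_⟩
    have h1 : IsAlgebraic (algebraicClosure k₁ k) u := hu.isAlgebraic
    have h2 : u ∈ algebraicClosure (algebraicClosure k₁ k) k := mem_algebraicClosure_iff.2 h1
    rw [algebraicClosure.algebraicClosure_eq_bot] at h2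
    obtain ⟨y, hy⟩ := IntermediateField.mem_bot.1 h2
    exact ⟨y, hy⟩
  -- an algebraic extension of a countable field is countable
  have hcard : Cardinal.mk k₀ ≤ Cardinal.aleph0 := by
    have h1 : Cardinal.mk k₁ ≤ Cardinal.aleph0 :=
      (Subfield.cardinalMk_closure_le_max S).trans (by
        have := hS.countable
        simpa using this)
    exact (Algebra.IsAlgebraic.cardinalMk_le_max k₁ (algebraicClosure k₁ k)).trans
      (max_le h1 le_rfl)
  refine ⟨k₀, (Subfield.subset_closure.trans hle), hclosed, ?_⟩
  by_contra h
  push Not at h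
  have hsurj : Function.Surjective (algebraMap k₀ k) := fun x => by
    have := h x
    rw [Transcendental, not_not] at this
    exact IsIntegrallyClosedIn.isIntegral_iff.1 this.isIntegral
  exact absurd ((Cardinal.mk_le_of_surjective hsurj).trans hcard) (not_le.2 hk)

/-- The field `k(σ)` of rational functions in the indeterminates `σ`, realised as the fraction field
of `MvPolynomial σ k`. -/
abbrev MvFrac (σ k : Type*) [Field k] : Type _ := FractionRing (MvPolynomial σ k)

/-- If `k₀` is relatively algebraically closed in `k`, then `k₀(σ)` is relatively algebraically
closed in `k(σ)`. The embedding `k₀(σ) → k(σ)` is given by an algebra structure compatible with the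
map of polynomial rings. -/
theorem isIntegrallyClosedIn_mvFrac {k₀ k : Type*} [Field k₀] [Field k] [Algebra k₀ k]
    [IsIntegrallyClosedIn k₀ k] (σ : Type*) [Algebra (MvFrac σ k₀) (MvFrac σ k)]
    (hcomp : ∀ p : MvPolynomial σ k₀, algebraMap (MvFrac σ k₀) (MvFrac σ k)
      (algebraMap _ _ p) = algebraMap _ _ (MvPolynomial.map (algebraMap k₀ k) p)) :
    IsIntegrallyClosedIn (MvFrac σ k₀) (MvFrac σ k) := by
  rw [isIntegrallyClosedIn_iff]
  refine ⟨(algebraMap (MvFrac σ k₀) (MvFrac σ k)).injective, fun {y} hy => ?_⟩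
  let a : σ → MvFrac σ k := fun i => algebraMap (MvPolynomial σ k) _ (MvPolynomial.X i)
  have haev : ∀ p : MvPolynomial σ k, MvPolynomial.aeval a p = algebraMap _ (MvFrac σ k) p :=
    fun p => by
      have : MvPolynomial.aeval a = IsScalarTower.toAlgHom k (MvPolynomial σ k) (MvFrac σ k) := by
        ext; simp [a]
      rw [this]
      rfl
  have haev₀ : ∀ p : MvPolynomial σ k₀, MvPolynomial.aeval a p =
      algebraMap (MvFrac σ k₀) (MvFrac σ k) (algebraMap _ _ p) := fun p => by
    rw [hcomp, ← haev, MvPolynomial.aeval_map_algebraMap]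
  have ha : AlgebraicIndependent k a := by
    intro p q hpq
    rw [haev, haev] at hpq
    exact IsFractionRing.injective _ _ hpq
  have h1 : y ∈ IntermediateField.adjoin k (Set.range a) := by
    obtain ⟨p, q, -, rfl⟩ := IsFractionRing.div_surjective (A := MvPolynomial σ k) y
    rw [mem_adjoin_range_iff]
    exact ⟨p, q, by rw [haev, haev]⟩
  have h2 : IsAlgebraic (IntermediateField.adjoin k₀ (Set.range a)) y := by
    have hmem : ∀ z : MvFrac σ k₀, algebraMap (MvFrac σ k₀) (MvFrac σ k) z ∈
        IntermediateField.adjoin k₀ (Set.range a) := by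
      intro z
      obtain ⟨p, q, -, rfl⟩ := IsFractionRing.div_surjective (A := MvPolynomial σ k₀) z
      rw [mem_adjoin_range_iff]
      exact ⟨p, q, by rw [map_div₀, haev₀, haev₀]⟩
    let i : MvFrac σ k₀ →+* IntermediateField.adjoin k₀ (Set.range a) :=
      (algebraMap (MvFrac σ k₀) (MvFrac σ k)).codRestrict _ hmem
    exact hy.isAlgebraic.ringHom_of_comp_eq i (RingHom.id _) i.injective rfl
  obtain ⟨p, q, rfl⟩ := (mem_adjoin_range_iff k₀ a y).1 (mem_adjoin_range_of_isAlgebraic ha h1 h2)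
  exact ⟨algebraMap _ _ p / algebraMap _ _ q, by rw [map_div₀, haev₀, haev₀]⟩

/-- If `α` is transcendental over `k₀`, the substitution `X_{m+1} ↦ α + β X₀` is injective on the
polynomials in `X₀, …, X_{m+1}` with coefficients in `k₀`. -/
theorem injective_aeval_snoc_comp_map {k₀ k : Type*} [Field k₀] [Field k] [Algebra k₀ k] {α : k}
    (hα : Transcendental k₀ α) (m : ℕ) (β : ℕ) :
    Function.Injective ((MvPolynomial.aeval (Fin.snoc MvPolynomial.X
      (MvPolynomial.C α + (β : MvPolynomial (Fin (m + 1)) k) * MvPolynomial.X 0)) :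
        MvPolynomial (Fin (m + 2)) k →ₐ[k] MvPolynomial (Fin (m + 1)) k).toRingHom.comp
      (MvPolynomial.map (algebraMap k₀ k))) := by
  let G := MvPolynomial (Fin (m + 1)) k
  let y : Fin (m + 1) → G := MvPolynomial.X
  have hy : AlgebraicIndependent k y := MvPolynomial.algebraicIndependent_X (Fin (m + 1)) k
  have hy₀ : AlgebraicIndependent k₀ y := hy.restrictScalars (algebraMap k₀ k).injective
  have h1 : AlgebraicIndependent k₀ (Sum.elim y (algebraMap k G ∘ fun _ : Unit => α)) :=
    AlgebraicIndependent.sumElim_comp (algebraicIndependent_unique_type_iff.2 hα) hy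
  have h2 : AlgebraicIndependent k₀ (fun o : Option (Fin (m + 1)) =>
      o.elim (algebraMap k G α) y) := by
    rw [← algebraicIndependent_equiv (Equiv.optionEquivSumPUnit.{0} (Fin (m + 1))).symm]
    convert h1 using 1
    funext i
    rcases i with i | i <;> simp
  have h3 := (hy₀.option_iff_transcendental _).1 h2
  have h4 : Transcendental (Algebra.adjoin k₀ (Set.range y))
      (algebraMap k G α + β * y 0) := by
    intro h
    apply h3
    have h5 : IsAlgebraic (Algebra.adjoin k₀ (Set.range y)) ((β : G) * y 0) :=
      isAlgebraic_algebraMap (⟨(β : G) * y 0, mul_mem (_root_.natCast_mem _ _)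
        (Algebra.subset_adjoin ⟨0, rfl⟩)⟩ : Algebra.adjoin k₀ (Set.range y))
    have := h.sub h5
    rwa [add_sub_cancel_right] at this
  have h5 := (hy₀.option_iff_transcendental _).2 h4
  rw [← algebraicIndependent_equiv (finSuccEquivLast (n := m + 1))] at h5
  refine (congrArg Function.Injective ?_).mp h5
  funext p
  have h7 : ((MvPolynomial.aeval (R := k₀) ((fun o : Option (Fin (m + 1)) =>
      o.elim (algebraMap k G α + β * y 0) y) ∘ finSuccEquivLast) : _ →ₐ[k₀] G) : _ →+* G) =
      (MvPolynomial.aeval (Fin.snoc MvPolynomial.X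
      (MvPolynomial.C α + (β : MvPolynomial (Fin (m + 1)) k) * MvPolynomial.X 0)) :
        MvPolynomial (Fin (m + 2)) k →ₐ[k] MvPolynomial (Fin (m + 1)) k).toRingHom.comp
      (MvPolynomial.map (algebraMap k₀ k)) := by
    refine MvPolynomial.ringHom_ext (fun r => ?_) (fun i => ?_)
    · simp [G, MvPolynomial.algebraMap_eq, IsScalarTower.algebraMap_apply k₀ k G]
    · induction i using Fin.lastCases with
      | last => simp [G, y, MvPolynomial.algebraMap_eq]
      | cast i => simp [y]
  exact RingHom.congr_fun h7 p

set_option maxHeartbeats 1000000 in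
/-- Elimination of one parameter: over an uncountable field, an irreducible polynomial with
parameters `X₀, …, X_{m+1}` stays irreducible after a suitable substitution `X_{m+1} ↦ α + β X₀`.
Here `α` is transcendental over a relatively algebraically closed subfield `k₀` that contains the
coefficients, and `finite_setOf_not_irreducible_map` applies with `F = k₀(X₁, …, X_m)` and `U =
k(X₁, …, X_m)`. -/
theorem exists_irreducible_map_snoc (k : Type*) [Field k] [CharZero k]
    (hk : Cardinal.aleph0 < Cardinal.mk k) (m : ℕ) (H : Polynomial (MvPolynomial (Fin (m + 2)) k))
    (hH : Irreducible (H.map (algebraMap _ (MvFrac (Fin (m + 2)) k)))) :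
    ∃ (α : k) (β : ℕ), Irreducible ((H.map (MvPolynomial.aeval (Fin.snoc MvPolynomial.X
      (MvPolynomial.C α + (β : MvPolynomial (Fin (m + 1)) k) * MvPolynomial.X 0)) :
        MvPolynomial (Fin (m + 2)) k →ₐ[k] MvPolynomial (Fin (m + 1)) k).toRingHom).map
      (algebraMap _ (MvFrac (Fin (m + 1)) k))) := by
  classical
  let S : Set k := ((H.coeffs.biUnion fun P => P.coeffs : Finset k) : Set k)
  obtain ⟨k₀, hS, hclosed, α, hα⟩ := exists_transcendental_of_uncountable k hk
    (S := S) (Finset.finite_toSet _)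
  -- descent of `H` to `k₀`
  obtain ⟨H₀, hH₀⟩ : ∃ H₀ : Polynomial (MvPolynomial (Fin (m + 2)) k₀),
      H₀.map (MvPolynomial.map (algebraMap k₀ k)) = H := by
    rw [← Polynomial.mem_lifts, lifts_iff_coeff_lifts]
    intro n
    rw [MvPolynomial.mem_range_map_iff_coeffs_subset]
    intro c hc
    by_cases h0 : H.coeff n = 0
    · simp [h0] at hc
    · exact ⟨⟨c, hS (Finset.mem_coe.2 (Finset.mem_biUnion.2 ⟨_, coeff_mem_coeffs h0, hc⟩))⟩, rfl⟩
  -- `D = F(x, s)` with `x = X₀` and `s = X_{m+1}`, and `G = U(x')` with `x' = X₀`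
  let F := MvFrac (Fin m) k₀
  let U := MvFrac (Fin m) k
  let D := MvFrac (Fin (m + 2)) k₀
  let G := MvFrac (Fin (m + 1)) k
  let iFU₀ : MvPolynomial (Fin m) k₀ →+* MvPolynomial (Fin m) k :=
    MvPolynomial.map (algebraMap k₀ k)
  have hiFU₀ : Function.Injective iFU₀ := MvPolynomial.map_injective _ (algebraMap k₀ k).injective
  let iFD₀ : MvPolynomial (Fin m) k₀ →+* MvPolynomial (Fin (m + 2)) k₀ :=
    (MvPolynomial.rename fun i => i.succ.castSucc).toRingHom
  have hiFD₀ : Function.Injective iFD₀ := MvPolynomial.rename_injective _ fun i j h => by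
    simpa using h
  let iUG₀ : MvPolynomial (Fin m) k →+* MvPolynomial (Fin (m + 1)) k :=
    (MvPolynomial.rename Fin.succ).toRingHom
  have hiUG₀ : Function.Injective iUG₀ := MvPolynomial.rename_injective _ (Fin.succ_injective m)
  let iFU : F →+* U := IsFractionRing.map hiFU₀
  let iFD : F →+* D := IsFractionRing.map hiFD₀
  let iUG : U →+* G := IsFractionRing.map hiUG₀
  have eFU : ∀ p, iFU (algebraMap _ _ p) = algebraMap _ _ (iFU₀ p) :=
    IsLocalization.map_eq _
  have eFD : ∀ p, iFD (algebraMap _ _ p) = algebraMap _ _ (iFD₀ p) :=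
    IsLocalization.map_eq _
  have eUG : ∀ p, iUG (algebraMap _ _ p) = algebraMap _ _ (iUG₀ p) :=
    IsLocalization.map_eq _
  let : Algebra F U := iFU.toAlgebra
  let : Algebra F D := iFD.toAlgebra
  let : Algebra U G := iUG.toAlgebra
  let : Algebra F G := (iUG.comp iFU).toAlgebra
  have : IsScalarTower F U G := .of_algebraMap_eq fun _ => rfl
  have : IsIntegrallyClosedIn F U := isIntegrallyClosedIn_mvFrac (Fin m) eFU
  have : CharZero F := charZero_of_injective_algebraMap (algebraMap k₀ F).injective
  let x : D := algebraMap (MvPolynomial (Fin (m + 2)) k₀) D (MvPolynomial.X 0)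
  let s : D := algebraMap (MvPolynomial (Fin (m + 2)) k₀) D (MvPolynomial.X (Fin.last _))
  let x' : G := algebraMap (MvPolynomial (Fin (m + 1)) k) G (MvPolynomial.X 0)
  let αU : U := algebraMap k U α
  have hD : IntermediateField.adjoin F {x, s} = ⊤ := by
    have hpol : ∀ p : MvPolynomial (Fin (m + 2)) k₀,
        algebraMap _ D p ∈ IntermediateField.adjoin F {x, s} := by
      intro p
      induction p using MvPolynomial.induction_on with
      | C a =>
        have : algebraMap (MvPolynomial (Fin (m + 2)) k₀) D (MvPolynomial.C a) =
            algebraMap F D (algebraMap (MvPolynomial (Fin m) k₀) F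
            (MvPolynomial.C a)) := by
          change _ = iFD _
          rw [eFD]
          simp [iFD₀]
        rw [this]
        exact IntermediateField.algebraMap_mem _ _
      | add p q hp hq => rw [map_add]; exact add_mem hp hq
      | mul_X p i hp =>
        rw [map_mul]
        refine mul_mem hp ?_
        induction i using Fin.lastCases with
        | last => exact subset_adjoin _ _ (by simp [s])
        | cast i =>
          induction i using Fin.cases with
          | zero => exact subset_adjoin _ _ (by simp [x])
          | succ i =>
            have : algebraMap (MvPolynomial (Fin (m + 2)) k₀) D (MvPolynomial.X i.succ.castSucc) =
                algebraMap F D (algebraMap (MvPolynomial (Fin m) k₀) F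
                (MvPolynomial.X i)) := by
              change _ = iFD _
              rw [eFD]
              simp [iFD₀]
            rw [this]
            exact IntermediateField.algebraMap_mem _ _
    rw [eq_top_iff]
    rintro z -
    obtain ⟨p, q, -, rfl⟩ := IsFractionRing.div_surjective (A := MvPolynomial (Fin (m + 2)) k₀) z
    exact div_mem (hpol p) (hpol q)
  have hG : IntermediateField.adjoin U {x'} = ⊤ := by
    have hpol : ∀ p : MvPolynomial (Fin (m + 1)) k,
        algebraMap _ G p ∈ IntermediateField.adjoin U {x'} := by
      intro p
      induction p using MvPolynomial.induction_on with
      | C a =>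
        have : algebraMap (MvPolynomial (Fin (m + 1)) k) G (MvPolynomial.C a) =
            algebraMap U G (algebraMap (MvPolynomial (Fin m) k) U
            (MvPolynomial.C a)) := by
          change _ = iUG _
          rw [eUG]
          simp [iUG₀]
        rw [this]
        exact IntermediateField.algebraMap_mem _ _
      | add p q hp hq => rw [map_add]; exact add_mem hp hq
      | mul_X p i hp =>
        rw [map_mul]
        refine mul_mem hp ?_
        induction i using Fin.cases with
        | zero => exact mem_adjoin_simple_self _ _
        | succ i =>
          have : algebraMap (MvPolynomial (Fin (m + 1)) k) G (MvPolynomial.X i.succ) =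
              algebraMap U G (algebraMap (MvPolynomial (Fin m) k) U
              (MvPolynomial.X i)) := by
            change _ = iUG _
            rw [eUG]
            simp [iUG₀]
          rw [this]
          exact IntermediateField.algebraMap_mem _ _
    rw [eq_top_iff]
    rintro z -
    obtain ⟨p, q, -, rfl⟩ := IsFractionRing.div_surjective (A := MvPolynomial (Fin (m + 1)) k) z
    exact div_mem (hpol p) (hpol q)
  have hx' : Transcendental U x' := by
    let : Algebra (MvPolynomial (Fin m) k) G := ((algebraMap _ G).comp iUG₀).toAlgebra
    have : IsScalarTower (MvPolynomial (Fin m) k) U G := .of_algebraMap_eq fun p => (eUG p).symm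
    intro h
    obtain ⟨P, hP0, hP⟩ := (IsFractionRing.isAlgebraic_iff (MvPolynomial (Fin m) k) U G).2 h
    rw [aeval_def] at hP
    change eval₂ ((algebraMap _ G).comp iUG₀) (algebraMap _ G (MvPolynomial.X 0)) P = 0 at hP
    rw [← hom_eval₂] at hP
    have h2 := IsFractionRing.injective (MvPolynomial (Fin (m + 1)) k) G
      (hP.trans (map_zero _).symm)
    have h3 := congrArg (MvPolynomial.finSuccEquiv k m).toRingHom h2
    rw [hom_eval₂, map_zero] at h3
    have h4 : (MvPolynomial.finSuccEquiv k m).toRingHom.comp iUG₀ = C := by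
      refine MvPolynomial.ringHom_ext (fun r => ?_) (fun i => ?_)
      · change MvPolynomial.finSuccEquiv k m (MvPolynomial.rename Fin.succ (MvPolynomial.C r)) = _
        rw [MvPolynomial.rename_C]
        exact (MvPolynomial.finSuccEquiv k m).commutes r
      · simp [iUG₀, MvPolynomial.finSuccEquiv_X_succ]
    rw [h4] at h3
    apply hP0
    have h5 : (MvPolynomial.finSuccEquiv k m).toRingHom (MvPolynomial.X 0) = X :=
      MvPolynomial.finSuccEquiv_X_zero
    rwa [h5, eval₂_C_X] at h3
  let sp (β : ℕ) : MvPolynomial (Fin (m + 2)) k →ₐ[k] MvPolynomial (Fin (m + 1)) k :=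
    MvPolynomial.aeval (Fin.snoc MvPolynomial.X
      (MvPolynomial.C α + (β : MvPolynomial (Fin (m + 1)) k) * MvPolynomial.X 0))
  let g (β : ℕ) : MvPolynomial (Fin (m + 2)) k₀ →+* G :=
    (algebraMap _ G).comp ((sp β).toRingHom.comp (MvPolynomial.map (algebraMap k₀ k)))
  have hg : ∀ β, Function.Injective (g β) := fun β =>
    (IsFractionRing.injective (MvPolynomial (Fin (m + 1)) k) G).comp
      (injective_aeval_snoc_comp_map hα m β)
  have hcm : ∀ β p, sp β (MvPolynomial.map (algebraMap k₀ k) (iFD₀ p)) = iUG₀ (iFU₀ p) := by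
    intro β p
    have : ((sp β).toRingHom.comp (MvPolynomial.map (algebraMap k₀ k))).comp iFD₀ =
        iUG₀.comp iFU₀ := by
      refine MvPolynomial.ringHom_ext (fun r => ?_) (fun i => ?_)
      · simp [iFD₀, iFU₀, iUG₀, sp]
      · simp [iFD₀, iFU₀, iUG₀, sp]
        rw [Fin.succ_castSucc, Fin.snoc_castSucc]
    exact RingHom.congr_fun this p
  let θ₀ (β : ℕ) : D →+* G := IsFractionRing.lift (hg β)
  have hθ₀ : ∀ β p, θ₀ β (algebraMap (MvPolynomial (Fin (m + 2)) k₀) D p) = g β p := fun β p =>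
    IsFractionRing.lift_algebraMap (hg β) p
  have hcomm₀ : ∀ β (p : MvPolynomial (Fin m) k₀),
      θ₀ β (iFD (algebraMap (MvPolynomial (Fin m) k₀) F p)) =
        iUG (iFU (algebraMap (MvPolynomial (Fin m) k₀) F p)) := by
    intro β p
    rw [eFD, eFU, eUG, hθ₀]
    exact congrArg (algebraMap (MvPolynomial (Fin (m + 1)) k) G) (hcm β p)
  have hcomm : ∀ β (z : F), θ₀ β (iFD z) = iUG (iFU z) := by
    intro β z
    obtain ⟨p, q, -, rfl⟩ := IsFractionRing.div_surjective (A := MvPolynomial (Fin m) k₀) z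
    rw [map_div₀, map_div₀, map_div₀, map_div₀, hcomm₀, hcomm₀]
  let θ (β : ℕ) : D →ₐ[F] G := { θ₀ β with commutes' := hcomm β }
  have hθ : ∀ β p, θ β (algebraMap (MvPolynomial (Fin (m + 2)) k₀) D p) = g β p := hθ₀
  have hHD : Irreducible (H₀.map (algebraMap _ D)) := by
    have hinj : Function.Injective (MvPolynomial.map (algebraMap k₀ k) :
        MvPolynomial (Fin (m + 2)) k₀ →+* _) :=
      MvPolynomial.map_injective _ (algebraMap k₀ k).injective
    let j : D →+* MvFrac (Fin (m + 2)) k := IsFractionRing.map hinj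
    apply irreducible_of_irreducible_map_field j
    rw [Polynomial.map_map]
    have hj : ∀ p, j (algebraMap (MvPolynomial (Fin (m + 2)) k₀) D p) =
        algebraMap _ (MvFrac (Fin (m + 2)) k) (MvPolynomial.map (algebraMap k₀ k) p) :=
      IsLocalization.map_eq _
    have : j.comp (algebraMap (MvPolynomial (Fin (m + 2)) k₀) D) =
        (algebraMap _ (MvFrac (Fin (m + 2)) k)).comp
        (MvPolynomial.map (algebraMap k₀ k)) := RingHom.ext hj
    rwa [this, ← Polynomial.map_map, hH₀]
  have hsp₀ : ∀ β, sp β (MvPolynomial.X 0) = MvPolynomial.X 0 := fun β => by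
    have := MvPolynomial.aeval_X (R := k) (Fin.snoc (α := fun _ => MvPolynomial (Fin (m + 1)) k)
      MvPolynomial.X (MvPolynomial.C α + (β : MvPolynomial (Fin (m + 1)) k) * MvPolynomial.X 0))
      (Fin.castSucc 0)
    rwa [Fin.snoc_castSucc] at this
  have hsp₁ : ∀ β, sp β (MvPolynomial.X (Fin.last _)) =
      MvPolynomial.C α + (β : MvPolynomial (Fin (m + 1)) k) * MvPolynomial.X 0 := fun β => by
    rw [MvPolynomial.aeval_X, Fin.snoc_last]
  have hθx : ∀ β, θ β x = x' := fun β => by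
    rw [hθ]
    change algebraMap (MvPolynomial (Fin (m + 1)) k) G (sp β (MvPolynomial.map _ _)) = _
    rw [MvPolynomial.map_X, hsp₀]
  have hθs : ∀ β, θ β s = algebraMap U G αU + β * x' := fun β => by
    have hα' : algebraMap U G αU = algebraMap (MvPolynomial (Fin (m + 1)) k) G
        (MvPolynomial.C α) := by
      change iUG (algebraMap (MvPolynomial (Fin m) k) U (MvPolynomial.C α)) = _
      rw [eUG]
      exact congrArg _ (MvPolynomial.rename_C _ _)
    rw [hθ, hα']
    change algebraMap (MvPolynomial (Fin (m + 1)) k) G (sp β (MvPolynomial.map _ _)) = _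
    rw [MvPolynomial.map_X, hsp₁, map_add, map_mul, map_natCast]
  have hfin := finite_setOf_not_irreducible_map hD hx' hG θ hθx hθs hHD
  obtain ⟨β, hβ⟩ := hfin.exists_notMem
  refine ⟨α, β, ?_⟩
  have hβ' : Irreducible ((H₀.map (algebraMap _ D)).map (θ β : D →+* G)) := by
    by_contra h
    exact hβ h
  rw [Polynomial.map_map] at hβ'
  have : (θ β : D →+* G).comp (algebraMap _ D) = g β := RingHom.ext (hθ β)
  rw [this] at hβ'
  rw [← hH₀, Polynomial.map_map, Polynomial.map_map]
  exact hβ'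

end Iteration

/-! ### Hilbert irreducibility over a rational function field -/

section Specialisation

/-- Elimination of all the parameters but `X₀`, by the substitutions `X_{i+1} ↦ α_i + β_i X₀`. -/
theorem exists_irreducible_map_cons (k : Type*) [Field k] [CharZero k]
    (hk : Cardinal.aleph0 < Cardinal.mk k) (m : ℕ) (H : Polynomial (MvPolynomial (Fin (m + 1)) k))
    (hH : Irreducible (H.map (algebraMap _ (MvFrac (Fin (m + 1)) k)))) :
    ∃ (α : Fin m → k) (β : Fin m → ℕ), Irreducible ((H.map (MvPolynomial.aeval
      (Fin.cons (MvPolynomial.X 0) fun i =>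
        MvPolynomial.C (α i) + (β i : MvPolynomial (Fin 1) k) * MvPolynomial.X 0) :
        MvPolynomial (Fin (m + 1)) k →ₐ[k] MvPolynomial (Fin 1) k).toRingHom).map
      (algebraMap _ (MvFrac (Fin 1) k))) := by
  induction m with
  | zero =>
    refine ⟨0, 0, ?_⟩
    convert hH
    rw [show (MvPolynomial.aeval (R := k) _ : MvPolynomial (Fin 1) k →ₐ[k] MvPolynomial (Fin 1) k)
      = AlgHom.id k _ from MvPolynomial.algHom_ext fun i => by
        rw [Subsingleton.elim i 0, MvPolynomial.aeval_X]; rfl]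
    exact Polynomial.map_id
  | succ m ih =>
    obtain ⟨α, β, h⟩ := exists_irreducible_map_snoc k hk m H hH
    obtain ⟨α', β', h'⟩ := ih _ h
    refine ⟨Fin.snoc (α := fun _ => k) α' α, Fin.snoc (α := fun _ => ℕ) β' β, ?_⟩
    convert h' using 2
    rw [Polynomial.map_map]
    congr 1
    refine MvPolynomial.ringHom_ext (fun r => ?_) (fun i => ?_)
    · simp
    · induction i using Fin.cases with
      | zero =>
        have : (Fin.snoc (α := fun _ => MvPolynomial (Fin (m + 1)) k) MvPolynomial.X
          (MvPolynomial.C α + (β : MvPolynomial (Fin (m + 1)) k) * MvPolynomial.X 0) :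
            Fin (m + 2) → _) 0 = MvPolynomial.X 0 := Fin.snoc_castSucc (i := 0) ..
        simp [this]
      | succ i =>
        induction i using Fin.lastCases with
        | last =>
          simp [MvPolynomial.algebraMap_eq]
        | cast i =>
          have : (Fin.snoc (α := fun _ => MvPolynomial (Fin (m + 1)) k) MvPolynomial.X
            (MvPolynomial.C α + (β : MvPolynomial (Fin (m + 1)) k) * MvPolynomial.X 0) :
            Fin (m + 2) → _) i.castSucc.succ = MvPolynomial.X i.succ := by
            rw [Fin.succ_castSucc, Fin.snoc_castSucc]
          simp [this]

variable {k : Type*} [Field k] {E : Type*} [Field E] [Algebra k E] {x : E}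

theorem isFractionRing_aeval_of_adjoin_eq_top (hx : Transcendental k x)
    (hE : IntermediateField.adjoin k {x} = ⊤) :
    letI := (aeval x : k[X] →ₐ[k] E).toAlgebra
    IsFractionRing k[X] E := by
  let : Algebra k[X] E := (aeval x : k[X] →ₐ[k] E).toAlgebra
  have hinj : Function.Injective (algebraMap k[X] E) := transcendental_iff_injective.1 hx
  have : FaithfulSMul k[X] E := (faithfulSMul_iff_algebraMap_injective _ _).2 hinj
  refine IsFractionRing.of_field k[X] E fun z => ?_
  have hz : z ∈ IntermediateField.adjoin k {x} := hE ▸ IntermediateField.mem_top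
  obtain ⟨p, q, rfl⟩ := (IntermediateField.mem_adjoin_simple_iff k z).1 hz
  exact ⟨p, q, rfl⟩

/-- The homomorphism `k[X₀, …, X_d] → E[X₀, …, X_{d-1}]` over `k` that replaces the first
indeterminate by the constant `x ∈ E` and shifts the others down by one. -/
noncomputable def consMap (k : Type*) [Field k] {E : Type*} [Field E] [Algebra k E] (x : E)
    (d : ℕ) : MvPolynomial (Fin (d + 1)) k →ₐ[k] MvPolynomial (Fin d) E :=
  MvPolynomial.aeval (Fin.cons (MvPolynomial.C x) MvPolynomial.X)

theorem consMap_eq (d : ℕ) (p : MvPolynomial (Fin (d + 1)) k) : consMap k x d p =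
    MvPolynomial.map (aeval x : k[X] →ₐ[k] E).toRingHom (MvPolynomial.optionEquivRight k (Fin d)
      (MvPolynomial.rename (_root_.finSuccEquiv d) p)) := by
  have : (consMap k x d : _ →+* _) =
    (MvPolynomial.map (aeval x : k[X] →ₐ[k] E).toRingHom).comp
      ((MvPolynomial.optionEquivRight k (Fin d)).toRingHom.comp
      (MvPolynomial.rename (R := k) (_root_.finSuccEquiv d)).toRingHom) := by
    refine MvPolynomial.ringHom_ext (fun r => ?_) (fun i => ?_)
    · simp [consMap, MvPolynomial.algebraMap_apply]
    · induction i using Fin.cases <;> simp [consMap]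
  exact RingHom.congr_fun this p

theorem consMap_injective (hx : Transcendental k x) (d : ℕ) :
    Function.Injective (consMap k x d) := by
  have h : ⇑(consMap k x d) = MvPolynomial.map (aeval x : k[X] →ₐ[k] E).toRingHom ∘
      (MvPolynomial.optionEquivRight k (Fin d)) ∘
      (MvPolynomial.rename (_root_.finSuccEquiv d)) := funext (consMap_eq d)
  rw [h]
  exact (MvPolynomial.map_injective _ (transcendental_iff_injective.1 hx)).comp
    ((MvPolynomial.optionEquivRight k (Fin d)).injective.comp
      (MvPolynomial.rename_injective _ (_root_.finSuccEquiv d).injective))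

/-- Clearing denominators: over `E = k(x)`, every polynomial with parameters is, up to a nonzero
constant of `E`, the image of a polynomial over `k` with `x` as an additional parameter. -/
theorem exists_map_consMap_eq (hx : Transcendental k x)
    (hE : IntermediateField.adjoin k {x} = ⊤) (d : ℕ) (H : Polynomial (MvPolynomial (Fin d) E)) :
    ∃ (c : E) (H' : Polynomial (MvPolynomial (Fin (d + 1)) k)), c ≠ 0 ∧
      H'.map (consMap k x d).toRingHom = C (MvPolynomial.C c) * H := by
  classical
  let : Algebra k[X] E := (aeval x : k[X] →ₐ[k] E).toAlgebra
  have := isFractionRing_aeval_of_adjoin_eq_top hx hE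
  obtain ⟨b, hb⟩ := IsLocalization.exist_integer_multiples_of_finset (nonZeroDivisors k[X])
    (H.coeffs.biUnion fun P => P.coeffs)
  refine ⟨algebraMap k[X] E b, ?_⟩
  have hb0 : algebraMap k[X] E b ≠ 0 :=
    IsFractionRing.to_map_ne_zero_of_mem_nonZeroDivisors b.2
  suffices h : C (MvPolynomial.C (algebraMap k[X] E b)) * H ∈
      lifts (consMap k x d).toRingHom by
    obtain ⟨H', hH'⟩ := (Polynomial.mem_lifts _).1 h
    exact ⟨H', hb0, hH'⟩
  rw [lifts_iff_coeff_lifts]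
  intro n
  rw [coeff_C_mul]
  obtain ⟨q, hq⟩ : MvPolynomial.C (algebraMap k[X] E b) * H.coeff n ∈
      Set.range (MvPolynomial.map (σ := Fin d) (algebraMap k[X] E)) := by
    rw [MvPolynomial.mem_range_map_iff_coeffs_subset]
    intro c hc
    obtain ⟨j, hj, rfl⟩ := MvPolynomial.mem_coeffs_iff.1 hc
    rw [MvPolynomial.mem_support_iff, MvPolynomial.coeff_C_mul] at hj
    have h1 : (H.coeff n).coeff j ≠ 0 := right_ne_zero_of_mul hj
    have h2 : H.coeff n ≠ 0 := by rintro h; simp [h] at h1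
    obtain ⟨y, hy⟩ := hb _ (Finset.mem_biUnion.2 ⟨_, coeff_mem_coeffs h2,
      MvPolynomial.coeff_mem_coeffs j h1⟩)
    refine ⟨y, ?_⟩
    rw [hy, MvPolynomial.coeff_C_mul, Algebra.smul_def]
  obtain ⟨p, hp⟩ : ∃ p, MvPolynomial.optionEquivRight k (Fin d)
      (MvPolynomial.rename (_root_.finSuccEquiv d) p) = q := by
    refine ⟨MvPolynomial.rename (_root_.finSuccEquiv d).symm
      ((MvPolynomial.optionEquivRight k (Fin d)).symm q), ?_⟩
    rw [MvPolynomial.rename_rename, Equiv.self_comp_symm, MvPolynomial.rename_id_apply,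
      AlgEquiv.apply_symm_apply]
  refine ⟨p, ?_⟩
  rw [← hq, ← hp]
  exact consMap_eq d p

/-- Hilbert irreducibility over the rational function field `E = k(x)` of an uncountable field: the
parameters can be given values of the form `α + β x`, with `α ∈ k` and `β ∈ ℕ`. The values have no
pole away from those of `x`, which keeps them bounded at the places where `x` is integral. -/
theorem exists_irreducible_map_eval_of_adjoin_eq_top [CharZero k]
    (hk : Cardinal.aleph0 < Cardinal.mk k) (hx : Transcendental k x)
    (hE : IntermediateField.adjoin k {x} = ⊤) (d : ℕ) (H : Polynomial (MvPolynomial (Fin d) E))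
    (hH : Irreducible (H.map (algebraMap _ (MvFrac (Fin d) E)))) :
    ∃ (α : Fin d → k) (β : Fin d → ℕ),
      Irreducible (H.map (MvPolynomial.eval fun i => algebraMap k E (α i) + β i * x)) := by
  obtain ⟨c, H', hc, hH'⟩ := exists_map_consMap_eq hx hE d H
  have hinj := consMap_injective hx d
  let j : MvFrac (Fin (d + 1)) k →+* MvFrac (Fin d) E :=
    IsFractionRing.map (j := (consMap k x d).toRingHom) hinj
  have hj : ∀ p, j (algebraMap (MvPolynomial (Fin (d + 1)) k) (MvFrac (Fin (d + 1)) k) p) =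
      algebraMap (MvPolynomial (Fin d) E) (MvFrac (Fin d) E) (consMap k x d p) :=
    IsLocalization.map_eq _
  have hcu : IsUnit (C (MvPolynomial.C c) : Polynomial (MvPolynomial (Fin d) E)) :=
    (isUnit_iff_ne_zero.2 hc).map ((C : _ →+* Polynomial (MvPolynomial (Fin d) E)).comp
      (MvPolynomial.C))
  have h1 : Irreducible (H'.map (algebraMap _ (MvFrac (Fin (d + 1)) k))) := by
    apply irreducible_of_irreducible_map_field j
    rw [Polynomial.map_map, show j.comp (algebraMap (MvPolynomial (Fin (d + 1)) k) _) =
      (algebraMap (MvPolynomial (Fin d) E) (MvFrac (Fin d) E)).comp (consMap k x d).toRingHom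
      from RingHom.ext hj, ← Polynomial.map_map, hH', Polynomial.map_mul]
    exact (irreducible_isUnit_mul (hcu.map (mapRingHom _))).2 hH
  obtain ⟨α, β, h2⟩ := exists_irreducible_map_cons k hk d H' h1
  refine ⟨α, β, ?_⟩
  -- `k(X₀) ≃ k(x)`
  let ev : MvPolynomial (Fin 1) k →ₐ[k] E := MvPolynomial.aeval fun _ => x
  have hev : Function.Injective ev := by
    have : AlgebraicIndependent k (fun _ : Fin 1 => x) :=
      algebraicIndependent_unique_type_iff.2 hx
    exact this
  let e : MvFrac (Fin 1) k →+* E := IsFractionRing.lift (g := ev.toRingHom) hev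
  have he : ∀ p, e (algebraMap (MvPolynomial (Fin 1) k) (MvFrac (Fin 1) k) p) = ev p :=
    fun p => IsFractionRing.lift_algebraMap hev p
  have hes : Function.Surjective e := by
    intro z
    have hz : z ∈ IntermediateField.adjoin k {x} := hE ▸ IntermediateField.mem_top
    obtain ⟨p, q, rfl⟩ := (IntermediateField.mem_adjoin_simple_iff k z).1 hz
    have hpol : ∀ p : k[X], ev (aeval (MvPolynomial.X 0) p) = aeval x p := fun p => by
      rw [← aeval_algHom_apply]; simp [ev]
    refine ⟨algebraMap (MvPolynomial (Fin 1) k) _ (aeval (MvPolynomial.X 0) p) /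
      algebraMap (MvPolynomial (Fin 1) k) _ (aeval (MvPolynomial.X 0) q), ?_⟩
    rw [map_div₀, he, he, hpol, hpol]
  let e' : MvFrac (Fin 1) k ≃+* E := RingEquiv.ofBijective e ⟨e.injective, hes⟩
  have h3 := (MulEquiv.irreducible_iff (Polynomial.mapEquiv e')).2 h2
  change Irreducible (Polynomial.map e _) at h3
  rw [Polynomial.map_map, Polynomial.map_map] at h3
  have h4 : (e.comp (algebraMap (MvPolynomial (Fin 1) k) _)).comp (MvPolynomial.aeval
      (Fin.cons (MvPolynomial.X 0) fun i =>
        MvPolynomial.C (α i) + (β i : MvPolynomial (Fin 1) k) * MvPolynomial.X 0) :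
        MvPolynomial (Fin (d + 1)) k →ₐ[k] MvPolynomial (Fin 1) k).toRingHom =
      (MvPolynomial.eval fun i => algebraMap k E (α i) + β i * x).comp
        (consMap k x d).toRingHom := by
    rw [show e.comp (algebraMap (MvPolynomial (Fin 1) k) _) = ev.toRingHom from RingHom.ext he]
    refine MvPolynomial.ringHom_ext (fun r => ?_) (fun i => ?_)
    · simp [consMap, ev, MvPolynomial.algebraMap_apply]
    · induction i using Fin.cases <;> simp [consMap, ev]
  rw [h4, ← Polynomial.map_map, hH', Polynomial.map_mul] at h3
  exact (irreducible_isUnit_mul (hcu.map (mapRingHom _))).1 h3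

end Specialisation

/-! ### Hilbert irreducibility over a Galois extension of a rational function field -/

section Norm

theorem coeff_pred_taylor {F : Type*} [Field F] (P : F[X]) (hn : 0 < P.natDegree) (a : F) :
    (taylor a P).coeff (P.natDegree - 1) =
      P.coeff (P.natDegree - 1) + P.natDegree * P.leadingCoeff * a := by
  obtain ⟨n, hn⟩ := Nat.exists_eq_succ_of_ne_zero hn.ne'
  rw [taylor_coeff, eq_X_add_C_of_natDegree_le_one (p := hasseDeriv (P.natDegree - 1) P)
    ((natDegree_hasseDeriv_le P _).trans (by omega)), hasseDeriv_coeff, hasseDeriv_coeff,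
    leadingCoeff, hn]
  simp only [Nat.succ_eq_add_one, Nat.add_sub_cancel, eval_add, eval_mul, eval_C, eval_X,
    add_comm 1 n, Nat.choose_succ_self_right, zero_add, Nat.choose_self, Nat.cast_one, one_mul]
  ring

/-- The second highest coefficient detects translations: if `P(Y + a)` and `Q(Y + b)` are
associated, then `a` and `b` satisfy an explicit linear relation. -/
theorem eq_of_associated_taylor {F : Type*} [Field F] {P Q : F[X]} (hP : 0 < P.natDegree)
    {a b : F} (h : Associated (taylor a P) (taylor b Q)) :
    P.coeff (P.natDegree - 1) / P.leadingCoeff + P.natDegree * a =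
      Q.coeff (P.natDegree - 1) / Q.leadingCoeff + P.natDegree * b := by
  obtain ⟨u, hu⟩ := h
  obtain ⟨c, hc, hcu⟩ := Polynomial.isUnit_iff.1 u.isUnit
  have hc0 : c ≠ 0 := hc.ne_zero
  rw [← hcu, mul_comm] at hu
  have hdeg : P.natDegree = Q.natDegree := by
    have := congrArg natDegree hu
    rwa [natDegree_C_mul hc0, natDegree_taylor, natDegree_taylor] at this
  have hP0 : P.leadingCoeff ≠ 0 := by
    rw [leadingCoeff_ne_zero]; rintro rfl; simp at hP
  have hlc : c * P.leadingCoeff = Q.leadingCoeff := by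
    have := congrArg leadingCoeff hu
    rwa [leadingCoeff_mul, leadingCoeff_C, leadingCoeff_taylor, leadingCoeff_taylor] at this
  have h1 := congrArg (fun R => coeff R (P.natDegree - 1)) hu
  simp only [coeff_C_mul] at h1
  rw [coeff_pred_taylor P hP, hdeg, coeff_pred_taylor Q (hdeg ▸ hP), ← hlc] at h1
  rw [← hlc, hdeg]
  field_simp
  linear_combination h1

theorem irreducible_taylor_iff {R : Type*} [CommRing R] {a : R} {P : R[X]} :
    Irreducible (taylor a P) ↔ Irreducible P :=
  MulEquiv.irreducible_iff (taylorEquiv a)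

variable {E N : Type*} [Field E] [Field N] [Algebra E N] [FiniteDimensional E N] [IsGalois E N]

theorem exists_map_eq_of_forall_map_eq (P : N[X])
    (hP : ∀ σ : N ≃ₐ[E] N, P.map (σ : N →+* N) = P) :
    ∃ Q : E[X], Q.map (algebraMap E N) = P := by
  rw [← Polynomial.mem_lifts, lifts_iff_coeff_lifts]
  intro n
  rw [IsGalois.mem_range_algebraMap_iff_fixed]
  intro σ
  conv_rhs => rw [← hP σ, coeff_map]
  rfl

theorem exists_map_map_eq_of_forall_map_eq {d : ℕ} (P : Polynomial (MvPolynomial (Fin d) N))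
    (hP : ∀ σ : N ≃ₐ[E] N, P.map (MvPolynomial.map (σ : N →+* N)) = P) :
    ∃ Q : Polynomial (MvPolynomial (Fin d) E), Q.map (MvPolynomial.map (algebraMap E N)) = P := by
  rw [← Polynomial.mem_lifts, lifts_iff_coeff_lifts]
  intro n
  rw [MvPolynomial.mem_range_map_iff_coeffs_subset]
  intro c hc
  obtain ⟨j, hj, rfl⟩ := MvPolynomial.mem_coeffs_iff.1 hc
  rw [IsGalois.mem_range_algebraMap_iff_fixed]
  intro σ
  conv_rhs => rw [← hP σ, coeff_map, MvPolynomial.coeff_map]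
  rfl

/-- If the norm `∏ σ, σ(P)` of `P` is irreducible over `E`, then `P` is irreducible over `N`, by the
multiplicativity of the norm. -/
theorem irreducible_of_prod_map_eq {P : N[X]} {Q : E[X]} (hQ : Irreducible Q)
    (h : Q.map (algebraMap E N) = ∏ σ : N ≃ₐ[E] N, P.map (σ : N →+* N)) : Irreducible P := by
  have hnorm (A : N[X]) : ∃ A' : E[X],
      A'.map (algebraMap E N) = ∏ σ : N ≃ₐ[E] N, A.map (σ : N →+* N) := by
    apply exists_map_eq_of_forall_map_eq
    intro τ
    rw [Polynomial.map_prod]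
    refine Fintype.prod_equiv (Equiv.mulLeft τ) _ _ fun σ => ?_
    rw [Polynomial.map_map]
    rfl
  have hunit (A : N[X]) (A' : E[X])
      (hA : A'.map (algebraMap E N) = ∏ σ : N ≃ₐ[E] N, A.map (σ : N →+* N))
      (hu : IsUnit A') : IsUnit A := by
    have h1 := hu.map (mapRingHom (algebraMap E N))
    rw [coe_mapRingHom, hA] at h1
    have h2 := isUnit_of_dvd_unit (Finset.dvd_prod_of_mem (fun σ : N ≃ₐ[E] N =>
      A.map (σ : N →+* N)) (Finset.mem_univ 1)) h1
    have h3 : A.map ((1 : N ≃ₐ[E] N) : N →+* N) = A := Polynomial.map_id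
    rwa [h3] at h2
  refine ⟨fun hu => hQ.not_isUnit ?_, fun A B hAB => ?_⟩
  · have h1 : IsUnit (Q.map (algebraMap E N)) := by
      rw [h]
      exact (Finset.univ.prod_induction _ IsUnit (fun _ _ => IsUnit.mul) isUnit_one)
        fun σ _ => hu.map (mapRingHom (σ : N →+* N))
    rwa [isUnit_map] at h1
  · obtain ⟨A', hA⟩ := hnorm A
    obtain ⟨B', hB⟩ := hnorm B
    have h1 : Q = A' * B' := by
      apply map_injective _ (algebraMap E N).injective
      rw [h, Polynomial.map_mul, hA, hB, ← Finset.prod_mul_distrib]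
      simp only [hAB, Polynomial.map_mul]
    exact (hQ.isUnit_or_isUnit h1).imp (hunit A A' hA) (hunit B B' hB)

set_option maxHeartbeats 1000000 in
/-- Hilbert irreducibility over a finite Galois extension `N` of `k(x)`, with parameters specialised
to elements `α + β x` of `k(x)`. After a translation of the variable that makes the conjugates of
the polynomial pairwise coprime, its norm is irreducible over `k(x)` with parameters, and an
irreducible specialisation of the norm forces the specialisation of the polynomial to be
irreducible. -/
theorem exists_irreducible_map_eval [CharZero N] {k : Type*} [Field k] [CharZero k] [Algebra k E]
    {x : E} (hk : Cardinal.aleph0 < Cardinal.mk k) (hx : Transcendental k x)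
    (hE : IntermediateField.adjoin k {x} = ⊤) (d : ℕ) (Ψ : Polynomial (MvPolynomial (Fin d) N))
    (hΨ : Irreducible (Ψ.map (algebraMap _ (MvFrac (Fin d) N)))) :
    ∃ (α : Fin d → k) (β : Fin d → ℕ), Irreducible (Ψ.map
      (MvPolynomial.eval fun i => algebraMap E N (algebraMap k E (α i) + β i * x))) := by
  classical
  obtain ⟨θ, hθ⟩ := Field.exists_primitive_element E N
  have hθσ : ∀ σ : N ≃ₐ[E] N, σ ≠ 1 → σ θ ≠ θ := by
    intro σ hσ h
    apply hσ
    ext z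
    have hz : z ∈ E⟮θ⟯ := hθ ▸ IntermediateField.mem_top
    obtain ⟨p, q, rfl⟩ := (IntermediateField.mem_adjoin_simple_iff E z).1 hz
    have hp (p : E[X]) : σ (aeval θ p) = aeval θ p := by
      rw [← aeval_algHom_apply, h]
    rw [map_div₀, hp, hp]
    rfl
  let R := MvPolynomial (Fin d) N
  let F := MvFrac (Fin d) N
  let m (σ : N ≃ₐ[E] N) : R →+* R := MvPolynomial.map (σ : N →+* N)
  have hm (σ : N ≃ₐ[E] N) : Function.Injective (m σ) := MvPolynomial.map_injective _ σ.injective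
  let mF (σ : N ≃ₐ[E] N) : F →+* F := IsFractionRing.map (hm σ)
  have hmF (σ) (p : R) : mF σ (algebraMap R F p) = algebraMap R F (m σ p) :=
    IsLocalization.map_eq _ p
  let c : N →+* F := (algebraMap R F).comp MvPolynomial.C
  have hmFc (σ) (a : N) : mF σ (c a) = c (σ a) := by
    change mF σ (algebraMap R F _) = _
    rw [hmF]
    exact congrArg (algebraMap R F) (MvPolynomial.map_C _ a)
  have hmF_mul (σ τ : N ≃ₐ[E] N) : (mF σ).comp (mF τ) = mF (σ * τ) := by
    apply IsLocalization.ringHom_ext (nonZeroDivisors R)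
    refine RingHom.ext fun p => ?_
    change mF σ (mF τ (algebraMap R F p)) = mF (σ * τ) (algebraMap R F p)
    rw [hmF, hmF, hmF]
    congr 1
    exact MvPolynomial.map_map _ _ _
  have hmF_one (P : F[X]) : P.map (mF 1) = P := by
    have : mF 1 = RingHom.id F := by
      apply IsLocalization.ringHom_ext (nonZeroDivisors R)
      refine RingHom.ext fun p => ?_
      change mF 1 (algebraMap R F p) = algebraMap R F p
      rw [hmF]
      congr 1
      exact MvPolynomial.map_id _
    rw [this, Polynomial.map_id]
  let ΨF : F[X] := Ψ.map (algebraMap R F)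
  have hdeg : 0 < ΨF.natDegree := natDegree_pos_iff_degree_pos.2 (degree_pos_of_irreducible hΨ)
  have hn0 : (ΨF.natDegree : F) ≠ 0 := by
    have : CharZero F := charZero_of_injective_ringHom c.injective
    exact Nat.cast_ne_zero.2 hdeg.ne'
  -- a translation making the conjugates pairwise non-associated
  obtain ⟨l, hl⟩ : ∃ l : ℕ, ∀ σ : N ≃ₐ[E] N, σ ≠ 1 →
      ¬ Associated (taylor (l * c (σ θ)) (ΨF.map (mF σ))) (taylor (l * c θ) ΨF) := by
    have hfin : (⋃ σ : {σ : N ≃ₐ[E] N // σ ≠ 1}, {l : ℕ |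
        Associated (taylor (l * c (σ.1 θ)) (ΨF.map (mF σ.1))) (taylor (l * c θ) ΨF)}).Finite := by
      refine Set.finite_iUnion fun σ => Set.Subsingleton.finite fun l₁ h₁ l₂ h₂ => ?_
      have e₁ := eq_of_associated_taylor (by rwa [natDegree_map]) h₁
      have e₂ := eq_of_associated_taylor (by rwa [natDegree_map]) h₂
      rw [natDegree_map] at e₁ e₂
      have h3 : (ΨF.natDegree : F) * (c (σ.1 θ) - c θ) * ((l₁ : F) - l₂) = 0 := by
        linear_combination e₁ - e₂
      have h4 : c (σ.1 θ) - c θ ≠ 0 := by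
        rw [sub_ne_zero, Ne, c.injective.eq_iff]
        exact hθσ _ σ.2
      have : CharZero F := charZero_of_injective_ringHom c.injective
      exact Nat.cast_injective (R := F)
        (sub_eq_zero.1 ((mul_eq_zero.1 h3).resolve_left (mul_ne_zero hn0 h4)))
    obtain ⟨l, hl⟩ := hfin.exists_notMem
    exact ⟨l, fun σ hσ h => hl (Set.mem_iUnion.2 ⟨⟨σ, hσ⟩, h⟩)⟩
  let Φ : Polynomial R := taylor (l * MvPolynomial.C θ) Ψ
  let ΦF : F[X] := Φ.map (algebraMap R F)
  have hΦF : ΦF = taylor (l * c θ) ΨF := by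
    simp only [ΦF, Φ, ΨF, map_taylor, map_mul, map_natCast]
    rfl
  have hΦσ (σ) : ΦF.map (mF σ) = taylor (l * c (σ θ)) (ΨF.map (mF σ)) := by
    rw [hΦF, map_taylor, map_mul, map_natCast, hmFc]
  have hΦirr : Irreducible ΦF := by
    rw [hΦF]
    exact irreducible_taylor_iff.2 hΨ
  have hΦσirr (σ) : Irreducible (ΦF.map (mF σ)) := by
    apply irreducible_of_irreducible_map_field (mF σ⁻¹)
    rwa [Polynomial.map_map, hmF_mul, inv_mul_cancel, hmF_one]
  have hpair : Pairwise (Function.onFun IsCoprime fun σ => ΦF.map (mF σ)) := by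
    intro σ τ hστ
    change IsCoprime _ _
    rw [(hΦσirr σ).coprime_iff_not_dvd, (hΦσirr σ).dvd_irreducible_iff_associated (hΦσirr τ)]
    intro h
    have h1 := h.map (mapRingHom (mF τ⁻¹))
    simp only [coe_mapRingHom, Polynomial.map_map, hmF_mul, inv_mul_cancel, hmF_one] at h1
    rw [hΦσ, hΦF] at h1
    exact hl (τ⁻¹ * σ) (fun h => hστ (by rwa [inv_mul_eq_one, eq_comm] at h)) h1
  -- the norm `H` of `Φ`
  obtain ⟨H, hH⟩ : ∃ H : Polynomial (MvPolynomial (Fin d) E),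
      H.map (MvPolynomial.map (algebraMap E N)) = ∏ σ : N ≃ₐ[E] N, Φ.map (m σ) := by
    apply exists_map_map_eq_of_forall_map_eq
    intro τ
    rw [Polynomial.map_prod]
    refine Fintype.prod_equiv (Equiv.mulLeft τ) _ _ fun σ => ?_
    rw [Polynomial.map_map]
    congr 1
    refine RingHom.ext fun p => MvPolynomial.map_map _ _ _
  have hinj : Function.Injective (MvPolynomial.map (algebraMap E N) :
      MvPolynomial (Fin d) E →+* R) := MvPolynomial.map_injective _ (algebraMap E N).injective
  let j : MvFrac (Fin d) E →+* F := IsFractionRing.map hinj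
  have hj (p) : j (algebraMap (MvPolynomial (Fin d) E) _ p) =
      algebraMap R F (MvPolynomial.map (algebraMap E N) p) := IsLocalization.map_eq _ p
  have hmFj (σ) : (mF σ).comp j = j := by
    apply IsLocalization.ringHom_ext (nonZeroDivisors (MvPolynomial (Fin d) E))
    refine RingHom.ext fun p => ?_
    change mF σ (j (algebraMap (MvPolynomial (Fin d) E) _ p)) =
      j (algebraMap (MvPolynomial (Fin d) E) _ p)
    rw [hj, hmF]
    congr 1
    refine (MvPolynomial.map_map _ _ _).trans ?_
    congr 2
    exact RingHom.ext fun a => σ.commutes a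
  let HF := H.map (algebraMap (MvPolynomial (Fin d) E) (MvFrac (Fin d) E))
  have hHF : HF.map j = ∏ σ : N ≃ₐ[E] N, ΦF.map (mF σ) := by
    have h1 := congrArg (Polynomial.map (algebraMap R F)) hH
    rw [Polynomial.map_prod, Polynomial.map_map] at h1
    simp only [HF, ΦF, Polynomial.map_map]
    rw [show j.comp (algebraMap (MvPolynomial (Fin d) E) _) =
      (algebraMap R F).comp (MvPolynomial.map (algebraMap E N)) from RingHom.ext hj]
    refine h1.trans (Finset.prod_congr rfl fun σ _ => ?_)
    rw [Polynomial.map_map]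
    congr 1
    exact RingHom.ext fun p => (hmF σ p).symm
  -- a factor over `E` that is divisible by one conjugate is divisible by all of them
  have key (A B : (MvFrac (Fin d) E)[X]) (hAB : HF = A * B) (hdvd : ΦF ∣ A.map j) :
      IsUnit B := by
    have h1 : ∏ σ : N ≃ₐ[E] N, ΦF.map (mF σ) ∣ A.map j := by
      refine Fintype.prod_dvd_of_coprime hpair fun σ => ?_
      have h2 := Polynomial.map_dvd (mF σ) hdvd
      rwa [Polynomial.map_map j, hmFj] at h2
    rw [← hHF, hAB, Polynomial.map_mul] at h1
    have hA0 : A.map j ≠ 0 := by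
      intro h0
      have h2 : ∏ σ : N ≃ₐ[E] N, ΦF.map (mF σ) = 0 := by
        rw [← hHF, hAB, Polynomial.map_mul, h0, zero_mul]
      obtain ⟨σ, -, h3⟩ := Finset.prod_eq_zero_iff.1 h2
      exact (hΦσirr σ).ne_zero h3
    have h2 : B.map j ∣ 1 := by
      rw [← mul_dvd_mul_iff_left hA0, mul_one]
      exact h1
    exact (isUnit_map j).1 (isUnit_of_dvd_one h2)
  have hHirr : Irreducible HF := by
    refine ⟨fun hu => ?_, fun A B hAB => ?_⟩
    · have h1 := hu.map (mapRingHom j)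
      rw [coe_mapRingHom, hHF] at h1
      exact (hΦσirr 1).not_isUnit (isUnit_of_dvd_unit (Finset.dvd_prod_of_mem
        (fun σ => ΦF.map (mF σ)) (Finset.mem_univ (1 : N ≃ₐ[E] N))) h1)
    · have h1 : ΦF ∣ A.map j * B.map j := by
        rw [← Polynomial.map_mul, ← hAB, hHF, ← hmF_one ΦF]
        have := Finset.dvd_prod_of_mem (fun σ => ΦF.map (mF σ)) (Finset.mem_univ (1 : N ≃ₐ[E] N))
        simpa only [hmF_one] using this
      rcases hΦirr.prime.dvd_or_dvd h1 with h2 | h2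
      · exact Or.inr (key A B hAB h2)
      · exact Or.inl (key B A (hAB.trans (mul_comm _ _)) h2)
  obtain ⟨α, β, hirr⟩ := exists_irreducible_map_eval_of_adjoin_eq_top hk hx hE d H hHirr
  refine ⟨α, β, ?_⟩
  let s : Fin d → E := fun i => algebraMap k E (α i) + β i * x
  have h1 : Irreducible (Φ.map (MvPolynomial.eval fun i => algebraMap E N (s i))) := by
    refine irreducible_of_prod_map_eq hirr ?_
    have h2 := congrArg (Polynomial.map (MvPolynomial.eval fun i => algebraMap E N (s i))) hH
    rw [Polynomial.map_prod, Polynomial.map_map] at h2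
    have h3 : (MvPolynomial.eval fun i => algebraMap E N (s i)).comp
        (MvPolynomial.map (algebraMap E N)) = (algebraMap E N).comp (MvPolynomial.eval s) := by
      refine MvPolynomial.ringHom_ext (fun r => ?_) (fun i => ?_) <;> simp
    rw [Polynomial.map_map, ← h3, h2]
    refine Finset.prod_congr rfl fun σ _ => ?_
    rw [Polynomial.map_map, Polynomial.map_map]
    congr 1
    refine MvPolynomial.ringHom_ext (fun r => ?_) (fun i => ?_) <;> simp [m]
  rw [map_taylor] at h1
  exact irreducible_taylor_iff.1 h1

end Norm

end LocGlob

/-! ### Persistence of simple roots and polynomials with prescribed values -/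

namespace LocGlob

open Polynomial Topology

section Roots

/-- A simple root of a polynomial over a complete field persists under small changes of the
parameters, by the open mapping form of the implicit function theorem for `(c, y) ↦ (c, P_c(y))`.
The set `W` keeps the root close to the given one. -/
theorem eventually_exists_root {M : Type*} [NontriviallyNormedField M] [CompleteSpace M]
    {σ : Type*} [Finite σ] (P : Polynomial (MvPolynomial σ M)) {c₀ : σ → M} {b : M}
    (h0 : (P.map (MvPolynomial.eval c₀)).eval b = 0)
    (h1 : (derivative (P.map (MvPolynomial.eval c₀))).eval b ≠ 0)
    {W : Set ((σ → M) × M)} (hW : W ∈ 𝓝 (c₀, b)) :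
    ∀ᶠ c in 𝓝 c₀, ∃ y, (c, y) ∈ W ∧ (P.map (MvPolynomial.eval c)).eval y = 0 := by
  have := Fintype.ofFinite σ
  let Φ : (σ → M) × M → M := fun z => (P.map (MvPolynomial.eval z.1)).eval z.2
  have hΦ : AnalyticAt M Φ (c₀, b) := by
    have : Φ = fun z => ∑ i ∈ Finset.range (P.natDegree + 1),
        MvPolynomial.eval z.1 (P.coeff i) * z.2 ^ i := by
      funext z
      simp only [Φ, eval_map, eval₂_eq_sum_range]
    rw [this]
    refine Finset.analyticAt_fun_sum _ fun i _ => ?_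
    refine AnalyticAt.mul ?_ (analyticAt_snd.pow i)
    have h : AnalyticAt M (fun c : σ → M => MvPolynomial.eval c (P.coeff i)) c₀ :=
      AnalyticOnNhd.eval_mvPolynomial (P.coeff i) c₀ trivial
    exact AnalyticAt.comp (g := fun c : σ → M => MvPolynomial.eval c (P.coeff i))
      (f := Prod.fst) (x := (c₀, b)) h analyticAt_fst
  have hd := hΦ.hasStrictFDerivAt
  set f' := fderiv M Φ (c₀, b)
  have hd1 : f' (0, 1) ≠ 0 := by
    have e1 : HasDerivAt (fun y : M => ((c₀, y) : (σ → M) × M)) (0, 1) b :=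
      (hasDerivAt_const b c₀).prodMk (hasDerivAt_id b)
    have e2 := hd.hasFDerivAt.comp_hasDerivAt b e1
    have e3 := (P.map (MvPolynomial.eval c₀)).hasDerivAt b
    rwa [e2.unique e3]
  -- the derivative of `(c, y) ↦ (c, Φ (c, y))` is surjective, as `∂Φ/∂y` is nonzero
  have hg := hasStrictFDerivAt_fst (𝕜 := M) (p := (c₀, b)) |>.prodMk hd
  have hsurj : ((ContinuousLinearMap.fst M (σ → M) M).prod f').range = ⊤ := by
    rw [LinearMap.range_eq_top]
    rintro ⟨u, v⟩
    refine ⟨(u, (v - f' (u, 0)) / f' (0, 1)), ?_⟩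
    have e : ((u, (v - f' (u, 0)) / f' (0, 1)) : (σ → M) × M) =
        (u, 0) + ((v - f' (u, 0)) / f' (0, 1)) • (0, 1) := by simp
    refine Prod.ext rfl ?_
    change f' _ = v
    rw [e, map_add, map_smul, smul_eq_mul, div_mul_cancel₀ _ hd1]
    ring
  have hmap := hg.map_nhds_eq_of_surj hsurj
  have h2 : (fun z : (σ → M) × M => (z.1, Φ z)) '' W ∈ 𝓝 (c₀, (0 : M)) := by
    have h3 := Filter.image_mem_map (m := fun z : (σ → M) × M => (z.1, Φ z)) hW
    rw [hmap] at h3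
    have h4 : Φ (c₀, b) = 0 := h0
    rwa [h4] at h3
  have h4 : Filter.Tendsto (fun c : σ → M => (c, (0 : M))) (𝓝 c₀) (𝓝 (c₀, 0)) :=
    (Continuous.prodMk_left (0 : M)).tendsto c₀
  filter_upwards [h4 h2] with c hc
  obtain ⟨⟨c', y⟩, hW', hcy⟩ := hc
  obtain ⟨rfl, hy⟩ := Prod.mk.inj hcy
  exact ⟨y, hW', hy⟩

theorem continuous_eval_map_eval {M : Type*} [NormedField M]
    {σ : Type*} (P : Polynomial (MvPolynomial σ M)) :
    Continuous fun z : (σ → M) × M => (P.map (MvPolynomial.eval z.1)).eval z.2 := by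
  simp only [eval_map, eval₂_eq_sum_range]
  refine continuous_finsetSum _ fun i _ => ?_
  exact ((MvPolynomial.continuous_eval _).comp continuous_fst).mul (continuous_snd.pow i)

end Roots

section Generic

variable {F M : Type*} [Field F] [Field M] [Algebra F M]

/-- A polynomial that takes values in a subfield `E` at infinitely many natural numbers has its
coefficients in `E`, by Lagrange interpolation. -/
theorem coeff_mem_of_infinite_eval_mem [CharZero M] (E : IntermediateField F M) (p : M[X])
    (h : {n : ℕ | p.eval (n : M) ∈ E}.Infinite) (i : ℕ) : p.coeff i ∈ E := by
  classical
  obtain ⟨s, hs, hcard⟩ := h.exists_subset_card_eq (p.natDegree + 1)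
  let v : ℕ → E := fun n => if hn : p.eval (n : M) ∈ E then ⟨_, hn⟩ else 0
  have : CharZero E := (algebraMap E M).charZero
  let q : E[X] := Lagrange.interpolate s (fun n => (n : E)) v
  have hinj : Set.InjOn (fun n : ℕ => (n : E)) s := fun a _ b _ hab => Nat.cast_injective hab
  have hpq : p = q.map (algebraMap E M) := by
    refine Polynomial.eq_of_degrees_lt_of_eval_finset_eq (s.image fun n : ℕ => (n : M)) ?_ ?_ ?_
    · rw [Finset.card_image_of_injective _ Nat.cast_injective, hcard]
      exact (degree_le_natDegree).trans_lt (by exact_mod_cast Nat.lt_succ_self _)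
    · rw [Finset.card_image_of_injective _ Nat.cast_injective, degree_map]
      exact Lagrange.degree_interpolate_lt _ hinj
    · intro x hx
      obtain ⟨n, hn, rfl⟩ := Finset.mem_image.1 hx
      have h1 : q.eval (n : E) = v n := Lagrange.eval_interpolate_at_node v hinj hn
      have h2 : (n : M) = algebraMap E M n := by simp
      have h3 : p.eval (n : M) ∈ E := hs hn
      conv_rhs => rw [h2, eval_map_algebraMap, aeval_algebraMap_apply, coe_aeval_eq_eval, h1]
      simp only [v, dif_pos h3]
      rfl
  rw [hpq, coeff_map]
  exact (q.coeff i).2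

/-- The value `p(n)` at a natural number generates a field containing a given coefficient of `p`,
with finitely many exceptions `n`: there are only finitely many intermediate fields. -/
theorem finite_setOf_notMem_adjoin_eval [CharZero F] [FiniteDimensional F M] (p : M[X]) (i : ℕ) :
    {n : ℕ | p.coeff i ∉ IntermediateField.adjoin F {p.eval (n : M)}}.Finite := by
  have : CharZero M := charZero_of_injective_algebraMap (algebraMap F M).injective
  have : Finite (IntermediateField F M) :=
    (Field.exists_primitive_element_iff_finite_intermediateField F M).1
      ⟨inferInstance, Field.exists_primitive_element F M⟩
  by_contra h
  have : Infinite {n : ℕ | p.coeff i ∉ IntermediateField.adjoin F {p.eval (n : M)}} :=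
    Set.infinite_coe_iff.2 h
  obtain ⟨E, hE⟩ := Finite.exists_infinite_fiber
    (fun n : {n : ℕ | p.coeff i ∉ IntermediateField.adjoin F {p.eval (n : M)}} =>
      IntermediateField.adjoin F {p.eval ((n : ℕ) : M)})
  obtain ⟨⟨⟨n, hn⟩, hnE⟩⟩ := hE.nonempty
  apply hn
  rw [show IntermediateField.adjoin F {p.eval (n : M)} = E from hnE]
  apply coeff_mem_of_infinite_eval_mem
  have h1 := Set.infinite_coe_iff.1 hE
  refine (h1.image Subtype.val_injective.injOn).mono ?_
  rintro _ ⟨⟨m, hm⟩, hmE, rfl⟩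
  have h2 : IntermediateField.adjoin F {p.eval (m : M)} = E := hmE
  change p.eval (m : M) ∈ E
  rw [← h2]
  exact IntermediateField.mem_adjoin_simple_self _ _

/-- An element of `F(b)` is the value at `b` of a polynomial whose derivative vanishes at `b`: add
to any polynomial with the right value a multiple of the minimal polynomial of `b`. -/
theorem exists_aeval_eq_derivative_eq_zero [CharZero F] [FiniteDimensional F M] {a b : M}
    (ha : a ∈ IntermediateField.adjoin F {b}) :
    ∃ G : F[X], aeval b G = a ∧ aeval b (derivative G) = 0 := by
  have hb : IsIntegral F b := .of_finite F b
  have hmem (z : M) (hz : z ∈ IntermediateField.adjoin F {b}) : ∃ P : F[X], aeval b P = z := by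
    rw [← IntermediateField.mem_toSubalgebra,
      IntermediateField.adjoin_simple_toSubalgebra_of_isAlgebraic hb.isAlgebraic,
      Algebra.adjoin_singleton_eq_range_aeval] at hz
    exact hz
  obtain ⟨P, hP⟩ := hmem a ha
  have hm : aeval b (derivative (minpoly F b)) ≠ 0 :=
    (minpoly.irreducible hb).separable.aeval_derivative_ne_zero (minpoly.aeval F b)
  have hpol (P : F[X]) : aeval b P ∈ IntermediateField.adjoin F {b} :=
    IntermediateField.algebra_adjoin_le_adjoin F _ (aeval_mem_adjoin_singleton F b)
  obtain ⟨R, hR⟩ := hmem (-aeval b (derivative P) / aeval b (derivative (minpoly F b)))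
    (div_mem (neg_mem (hpol _)) (hpol _))
  refine ⟨P + minpoly F b * R, by simp [hP], ?_⟩
  simp only [derivative_mul, map_add, map_mul, minpoly.aeval, hR, zero_mul, add_zero]
  field_simp
  ring

end Generic

end LocGlob

/-! ### Hypersurface models of affine domains -/

namespace LocGlob

open Polynomial

section PrimitiveModel

/-- The evaluation `K[t₁, …, t_d][Y] → B` at a family `t` of parameters and at `y` for the main
variable `Y`. -/
noncomputable def evalPoly {K B σ : Type*} [CommRing K] [CommRing B] [Algebra K B] (t : σ → B)
    (y : B) : Polynomial (MvPolynomial σ K) →ₐ[K] B :=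
  { eval₂RingHom (MvPolynomial.aeval t : MvPolynomial σ K →ₐ[K] B).toRingHom y with
    commutes' := fun r => by
      change eval₂ _ y (C (algebraMap K (MvPolynomial σ K) r)) = _
      rw [eval₂_C]
      exact AlgHom.commutes _ r }

section Basic

variable {K B σ : Type*} [CommRing K] [CommRing B] [Algebra K B] (t : σ → B) (y : B)

theorem evalPoly_apply (g : Polynomial (MvPolynomial σ K)) :
    evalPoly t y g = g.eval₂ (MvPolynomial.aeval t : MvPolynomial σ K →ₐ[K] B).toRingHom y := rfl

@[simp]
theorem evalPoly_C (p : MvPolynomial σ K) : evalPoly t y (C p) = MvPolynomial.aeval t p := by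
  rw [evalPoly_apply, eval₂_C]; rfl

@[simp]
theorem evalPoly_X : evalPoly (K := K) t y X = y := by
  rw [evalPoly_apply, eval₂_X]

theorem eq_evalPoly (Φ : Polynomial (MvPolynomial σ K) →ₐ[K] B) :
    Φ = evalPoly (fun i => Φ (C (MvPolynomial.X i))) (Φ X) := by
  apply AlgHom.coe_ringHom_injective
  refine Polynomial.ringHom_ext' (MvPolynomial.ringHom_ext (fun r => ?_) (fun i => ?_)) ?_
  · have h : (C (MvPolynomial.C r) : Polynomial (MvPolynomial σ K)) = algebraMap K _ r := rfl
    change Φ (C (MvPolynomial.C r)) = evalPoly _ _ (C (MvPolynomial.C r))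
    rw [h, AlgHom.commutes, AlgHom.commutes]
  · change Φ (C (MvPolynomial.X i)) = evalPoly _ _ (C (MvPolynomial.X i))
    rw [evalPoly_C, MvPolynomial.aeval_X]
  · exact (evalPoly_X _ _).symm

theorem map_evalPoly {B' : Type*} [CommRing B'] [Algebra K B'] (φ : B →ₐ[K] B')
    (g : Polynomial (MvPolynomial σ K)) : φ (evalPoly t y g) = evalPoly (φ ∘ t) (φ y) g := by
  have h := DFunLike.congr_fun (eq_evalPoly (φ.comp (evalPoly (K := K) t y))) g
  simpa [Function.comp_def] using h

theorem evalPoly_taylor (c : MvPolynomial σ K) (g : Polynomial (MvPolynomial σ K)) :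
    evalPoly t y (taylor c g) = evalPoly t (y + MvPolynomial.aeval t c) g := by
  have h := DFunLike.congr_fun (eq_evalPoly ((evalPoly (K := K) t y).comp
    ((taylorAlgHom c).restrictScalars K))) g
  simpa using h

theorem evalPoly_map {N : Type*} [CommRing N] [Algebra K N] [Algebra N B] [IsScalarTower K N B]
    (g : Polynomial (MvPolynomial σ K)) :
    evalPoly (K := N) t y (g.map (MvPolynomial.map (algebraMap K N))) = evalPoly t y g := by
  rw [evalPoly_apply, evalPoly_apply, eval₂_map]
  congr 1
  refine RingHom.ext fun p => ?_
  exact MvPolynomial.aeval_map_algebraMap N t p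

end Basic

theorem finiteDimensional_of_essFiniteType (F Q : Type*) [Field F] [Field Q] [Algebra F Q]
    [Algebra.EssFiniteType F Q] [Algebra.IsAlgebraic F Q] : FiniteDimensional F Q := by
  obtain ⟨s, hs⟩ := IntermediateField.fg_top F Q
  have : FiniteDimensional F (IntermediateField.adjoin F (s : Set Q)) :=
    IntermediateField.finiteDimensional_adjoin fun x _ => Algebra.IsIntegral.isIntegral x
  rw [hs] at this
  exact Module.Finite.equiv (IntermediateField.topEquiv (F := F) (E := Q)).toLinearEquiv

/-- Every affine domain `B` over a field of characteristic zero is birationally a hypersurface: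
there are `t₁, …, t_d, y ∈ B` whose ideal of relations is generated by one polynomial `f(t, Y)`,
with `∂f/∂Y` nonzero on `B`, such that `B` becomes `K[t, y]` after inverting a nonzero polynomial
`q(t)`. -/
theorem exists_primitive_model (K B : Type*) [Field K] [CharZero K] [CommRing B] [IsDomain B]
    [Algebra K B] [Algebra.FiniteType K B] :
    ∃ (d : ℕ) (t : Fin d → B) (y : B) (f : Polynomial (MvPolynomial (Fin d) K))
      (q : MvPolynomial (Fin d) K), MvPolynomial.aeval t q ≠ 0 ∧
      (∀ g, evalPoly t y g = 0 ↔ f ∣ g) ∧ evalPoly t y (derivative f) ≠ 0 ∧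
      ∀ b : B, ∃ (n : ℕ) (g : Polynomial (MvPolynomial (Fin d) K)),
        MvPolynomial.aeval t q ^ n * b = evalPoly t y g := by
  classical
  obtain ⟨S, hS⟩ := Algebra.FiniteType.out (R := K) (A := B)
  obtain ⟨d, t, ht⟩ : ∃ (d : ℕ) (t : Fin d → B), IsTranscendenceBasis K t := by
    have : Algebra.IsAlgebraic (Algebra.adjoin K (S : Set B)) B := by
      refine ⟨fun b => ?_⟩
      exact isAlgebraic_algebraMap (⟨b, hS ▸ Algebra.mem_top⟩ : Algebra.adjoin K (S : Set B))
    obtain ⟨T, hTS, hT⟩ := exists_isTranscendenceBasis_subset (R := K) (S : Set B)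
    have : Finite T := (S.finite_toSet.subset hTS)
    obtain ⟨d, ⟨e⟩⟩ := Finite.exists_equiv_fin T
    exact ⟨d, _, (isTranscendenceBasis_equiv e.symm).2 hT⟩
  let R := MvPolynomial (Fin d) K
  let : Algebra R B := (MvPolynomial.aeval t).toAlgebra
  have hRB : ∀ p : R, algebraMap R B p = MvPolynomial.aeval t p := fun p => rfl
  have : IsScalarTower K R B := .of_algebraMap_eq fun r => by
    rw [hRB, MvPolynomial.algebraMap_eq, MvPolynomial.aeval_C]
  have hinj : Function.Injective (algebraMap R B) := ht.1
  have : FaithfulSMul R B := (faithfulSMul_iff_algebraMap_injective _ _).2 hinj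
  have halg : Algebra.IsAlgebraic R B := by
    have := ht.isAlgebraic
    refine ⟨fun b => ?_⟩
    refine (Algebra.IsAlgebraic.isAlgebraic (R := Algebra.adjoin K (Set.range t))
      b).ringHom_of_comp_eq (ht.1.aevalEquiv.symm : _ →+* R) (RingHom.id B)
      ht.1.aevalEquiv.symm.injective ?_
    refine RingHom.ext fun z => ?_
    obtain ⟨p, rfl⟩ := ht.1.aevalEquiv.surjective z
    simp [hRB]
  let F := FractionRing R
  let Q := FractionRing B
  let : Algebra F Q := FractionRing.liftAlgebra R Q
  have : IsScalarTower R F Q := FractionRing.isScalarTower_liftAlgebra R Q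
  have : Algebra.IsAlgebraic B Q := IsLocalization.isAlgebraic Q (nonZeroDivisors B)
  have : Algebra.IsAlgebraic R Q := .trans R B Q
  have : Algebra.IsAlgebraic F Q := .extendScalars (R := R) (IsFractionRing.injective R F)
  have : Algebra.EssFiniteType B Q := .of_isLocalization _ (nonZeroDivisors B)
  have : Algebra.EssFiniteType K Q := .comp K B Q
  have : IsScalarTower K F Q := by
    refine .of_algebraMap_eq fun r => ?_
    rw [IsScalarTower.algebraMap_apply K R F, ← IsScalarTower.algebraMap_apply R F Q,
      ← IsScalarTower.algebraMap_apply K R Q]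
  have : Algebra.EssFiniteType F Q := .of_comp K F Q
  have : FiniteDimensional F Q := finiteDimensional_of_essFiniteType F Q
  have : CharZero F := charZero_of_injective_algebraMap (algebraMap K F).injective
  obtain ⟨θ, hθ⟩ := Field.exists_primitive_element F Q
  have hFQ : ∀ p : R, algebraMap F Q (algebraMap R F p) = algebraMap B Q (algebraMap R B p) :=
    fun p => by rw [← IsScalarTower.algebraMap_apply R F Q, ← IsScalarTower.algebraMap_apply R B Q]
  have hF0 : ∀ {p : R}, p ≠ 0 → algebraMap R F p ≠ 0 := fun hp => by
    rwa [Ne, map_eq_zero_iff _ (IsFractionRing.injective R F)]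
  -- a primitive element in `B`
  obtain ⟨y, hy⟩ : ∃ y : B, IntermediateField.adjoin F {algebraMap B Q y} = ⊤ := by
    obtain ⟨a, b, hb, rfl⟩ := IsFractionRing.div_surjective (A := B) θ
    obtain ⟨c, r, hr, h⟩ := (Algebra.IsAlgebraic.isAlgebraic (R := R) b).exists_smul_eq_mul a hb
    refine ⟨c, ?_⟩
    rw [← hθ]
    have hb0 : algebraMap B Q b ≠ 0 := IsFractionRing.to_map_ne_zero_of_mem_nonZeroDivisors hb
    have h1 : algebraMap B Q c = algebraMap F Q (algebraMap R F r) *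
        (algebraMap B Q a / algebraMap B Q b) := by
      rw [hFQ, mul_div_assoc', eq_div_iff hb0, ← map_mul, ← map_mul, mul_comm c b, ← h,
        Algebra.smul_def]
    have hr0 : algebraMap F Q (algebraMap R F r) ≠ 0 := by
      rw [Ne, map_eq_zero]; exact hF0 hr
    apply le_antisymm <;> rw [IntermediateField.adjoin_simple_le_iff]
    · rw [h1]
      exact mul_mem (IntermediateField.algebraMap_mem _ _)
        (IntermediateField.mem_adjoin_simple_self _ _)
    · rw [show algebraMap B Q a / algebraMap B Q b =
        algebraMap B Q c / algebraMap F Q (algebraMap R F r) by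
          rw [h1, mul_div_cancel_left₀ _ hr0]]
      exact div_mem (IntermediateField.mem_adjoin_simple_self _ _)
        (IntermediateField.algebraMap_mem _ _)
  let ψ : Polynomial R →ₐ[K] B := evalPoly t y
  have hψ : ∀ g : Polynomial R, algebraMap B Q (ψ g) =
      aeval (algebraMap B Q y) (g.map (algebraMap R F)) := by
    intro g
    rw [aeval_def, eval₂_map]
    change algebraMap B Q (g.eval₂ _ y) = _
    rw [hom_eval₂]
    congr 1
    exact RingHom.ext fun p => (hFQ p).symm
  have hψC : ∀ r : R, ψ (C r) = algebraMap R B r := fun r => evalPoly_C t y r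
  -- the equation of `y`
  obtain ⟨f, hf, hfy⟩ : ∃ f : Polynomial R, Irreducible f ∧ ψ f = 0 := by
    obtain ⟨g, hg0, hg⟩ := Algebra.IsAlgebraic.isAlgebraic (R := R) y
    have hg' : ψ g = 0 := hg
    have hu : ¬ IsUnit g := fun hu => by
      have := hu.map ψ
      rw [hg'] at this
      exact not_isUnit_zero this
    induction g using WfDvdMonoid.induction_on_irreducible with
    | zero => exact absurd rfl hg0
    | unit u hu' => exact absurd hu' hu
    | mul a i ha hi ih =>
      rw [map_mul] at hg'
      rcases mul_eq_zero.1 hg' with h | h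
      · exact ⟨i, hi, h⟩
      · refine ih ha h h fun hu => ?_
        have := hu.map ψ
        rw [h] at this
        exact not_isUnit_zero this
  have hfdeg : f.natDegree ≠ 0 := by
    intro h
    rw [eq_C_of_natDegree_eq_zero h, hψC, map_eq_zero_iff _ hinj] at hfy
    apply hf.ne_zero
    rw [eq_C_of_natDegree_eq_zero h, hfy, C_0]
  have hfF : Irreducible (f.map (algebraMap R F)) :=
    (hf.isPrimitive hfdeg).irreducible_iff_irreducible_map_fraction_map.1 hf
  have hker : ∀ g, ψ g = 0 ↔ f ∣ g := by
    intro g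
    refine ⟨fun hg => ?_, fun ⟨h, hh⟩ => by rw [hh, map_mul, hfy, zero_mul]⟩
    have h1 : aeval (algebraMap B Q y) (f.map (algebraMap R F)) = 0 := by
      rw [← hψ, hfy, map_zero]
    have h2 : f.map (algebraMap R F) ∣ g.map (algebraMap R F) := by
      have h3 := minpoly.dvd F _ h1
      have h4 := (minpoly.irreducible
        (Algebra.IsIntegral.isIntegral (algebraMap B Q y))).associated_of_dvd hfF h3
      refine h4.symm.dvd.trans (minpoly.dvd F _ ?_)
      rw [← hψ, hg, map_zero]
    obtain ⟨h, hh⟩ := h2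
    obtain ⟨r, hr, hrh⟩ := IsLocalization.integerNormalization_spec (nonZeroDivisors R) h
    have hr0 : r ≠ 0 := nonZeroDivisors.ne_zero hr
    have h5 : C r * g = f * IsLocalization.integerNormalization (nonZeroDivisors R) h := by
      apply map_injective _ (IsFractionRing.injective R F)
      rw [Polynomial.map_mul, Polynomial.map_mul, hrh, hh, map_C]
      rw [Algebra.smul_def, Polynomial.algebraMap_apply]
      ring
    have h6 : f ∣ C r * g := ⟨_, h5⟩
    refine (hf.prime.dvd_or_dvd h6).resolve_left fun h7 => hfdeg ?_
    have := natDegree_le_of_dvd h7 (C_ne_zero.2 hr0)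
    rwa [natDegree_C, Nat.le_zero] at this
  have hcl : ∀ b : B, ∃ r : R, r ≠ 0 ∧ ∃ g, algebraMap R B r * b = ψ g := by
    intro b
    have h1 : algebraMap B Q b ∈ IntermediateField.adjoin F {algebraMap B Q y} :=
      hy ▸ IntermediateField.mem_top
    rw [← IntermediateField.mem_toSubalgebra,
      IntermediateField.adjoin_simple_toSubalgebra_of_isAlgebraic
        (Algebra.IsAlgebraic.isAlgebraic _), Algebra.adjoin_singleton_eq_range_aeval] at h1
    obtain ⟨P, hP⟩ := h1
    obtain ⟨r, hr, hrP⟩ := IsLocalization.integerNormalization_spec (nonZeroDivisors R) P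
    refine ⟨r, nonZeroDivisors.ne_zero hr,
      IsLocalization.integerNormalization (nonZeroDivisors R) P, ?_⟩
    apply IsFractionRing.injective B Q
    rw [hψ, hrP, map_mul, ← hFQ, ← hP, Algebra.smul_def,
      Polynomial.algebraMap_apply, map_mul, aeval_C]
    rfl
  -- `q` is a common denominator of the generators of `B`
  choose r hr0 g hg using hcl
  refine ⟨d, t, y, f, ∏ b ∈ S, r b, ?_, hker, ?_, fun b => ?_⟩
  · rw [← hRB, Ne, map_eq_zero_iff _ hinj, Finset.prod_eq_zero_iff]
    rintro ⟨b, -, hb⟩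
    exact hr0 b hb
  · rw [Ne]
    change ¬ ψ _ = 0
    rw [hker]
    intro h
    have h0 : derivative f ≠ 0 := fun h0 => hfdeg (derivative_eq_zero.1 h0)
    exact absurd (natDegree_le_of_dvd h h0) (not_le.2 (natDegree_derivative_lt hfdeg))
  · rw [← hRB]
    set q := ∏ b ∈ S, r b
    have hb : b ∈ Algebra.adjoin K (S : Set B) := hS ▸ Algebra.mem_top
    change ∃ n g, algebraMap R B q ^ n * b = ψ g
    induction hb using Algebra.adjoin_induction with
    | mem b hb =>
      refine ⟨1, C (∏ b ∈ S.erase b, r b) * g b, ?_⟩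
      have : q = r b * ∏ b ∈ S.erase b, r b := (Finset.mul_prod_erase S r hb).symm
      rw [pow_one, map_mul, ← hg, hψC, this, map_mul]
      ring
    | algebraMap c => exact ⟨0, algebraMap K _ c, by rw [AlgHom.commutes, pow_zero, one_mul]⟩
    | add a b _ _ ha hb =>
      obtain ⟨n, g, h⟩ := ha
      obtain ⟨n', g', h'⟩ := hb
      refine ⟨n + n', C q ^ n' * g + C q ^ n * g', ?_⟩
      rw [map_add, map_mul, map_mul, map_pow, map_pow, hψC, ← h, ← h']
      ring
    | mul a b _ _ ha hb =>
      obtain ⟨n, g, h⟩ := ha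
      obtain ⟨n', g', h'⟩ := hb
      refine ⟨n + n', g * g', ?_⟩
      rw [map_mul, ← h, ← h']
      ring

end PrimitiveModel

end LocGlob

/-! ### Base change and points of hypersurface models -/

namespace LocGlob

open Polynomial TensorProduct

section BaseChange

variable {K B : Type*} [Field K] [CommRing B] [Algebra K B] {σ : Type*}

/-- If `N ⊗ B` is a domain, the equation `f` of `B` stays prime over `N`: it generates the kernel of
the evaluation `N[t][Y] → N ⊗ B`. -/
theorem prime_map_of_isDomain_tensorProduct (N : Type*) [Field N] [Algebra K N]
    [IsDomain (N ⊗[K] B)] {t : σ → B} {y : B} {f : Polynomial (MvPolynomial σ K)} (hf0 : f ≠ 0)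
    (hf : ∀ g, evalPoly t y g = 0 ↔ f ∣ g) :
    Prime (f.map (MvPolynomial.map (algebraMap K N))) := by
  classical
  let e := Module.Free.chooseBasis K N
  let i : B →ₐ[K] N ⊗[K] B := Algebra.TensorProduct.includeRight
  let lift : Polynomial (MvPolynomial σ K) →+* Polynomial (MvPolynomial σ N) :=
    mapRingHom (MvPolynomial.map (algebraMap K N))
  let cc : N →+* Polynomial (MvPolynomial σ N) := C.comp MvPolynomial.C
  let ψ : Polynomial (MvPolynomial σ N) →ₐ[N] N ⊗[K] B := evalPoly (i ∘ t) (i y)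
  have hlift : ∀ g, ψ (lift g) = i (evalPoly t y g) := fun g =>
    (evalPoly_map (N := N) (i ∘ t) (i y) g).trans (map_evalPoly t y i g).symm
  have hcc : ∀ a, ψ (cc a) = a ⊗ₜ 1 := fun a => AlgHom.commutes ψ a
  -- decomposition with respect to a basis of the extension
  have hdec : ∀ g : Polynomial (MvPolynomial σ N), ∃ c : _ →₀ Polynomial (MvPolynomial σ K),
      g = c.sum fun j p => cc (e j) * lift p := by
    have hadd : ∀ g g' : Polynomial (MvPolynomial σ N),
        (∃ c : _ →₀ Polynomial (MvPolynomial σ K), g = c.sum fun j p => cc (e j) * lift p) →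
        (∃ c : _ →₀ Polynomial (MvPolynomial σ K), g' = c.sum fun j p => cc (e j) * lift p) →
        ∃ c : _ →₀ Polynomial (MvPolynomial σ K), g + g' = c.sum fun j p => cc (e j) * lift p := by
      rintro _ _ ⟨c, rfl⟩ ⟨c', rfl⟩
      refine ⟨c + c', (Finsupp.sum_add_index' ?_ ?_).symm⟩
      · simp
      · intro j a b; rw [map_add, mul_add]
    have hmul : ∀ (g : Polynomial (MvPolynomial σ N)) (p : Polynomial (MvPolynomial σ K)),
        (∃ c : _ →₀ Polynomial (MvPolynomial σ K), g = c.sum fun j p => cc (e j) * lift p) →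
        ∃ c : _ →₀ Polynomial (MvPolynomial σ K),
          g * lift p = c.sum fun j p => cc (e j) * lift p := by
      rintro _ p ⟨c, rfl⟩
      refine ⟨c.mapRange (· * p) (zero_mul p), ?_⟩
      rw [Finsupp.sum_mapRange_index (by simp), Finsupp.sum_mul]
      refine Finsupp.sum_congr fun j _ => ?_
      rw [map_mul, mul_assoc]
    have hconst : ∀ a : N, ∃ c : _ →₀ Polynomial (MvPolynomial σ K),
        cc a = c.sum fun j p => cc (e j) * lift p := by
      intro a
      refine ⟨(e.repr a).mapRange (algebraMap K _) (map_zero _), ?_⟩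
      rw [Finsupp.sum_mapRange_index (by simp)]
      conv_lhs => rw [← e.linearCombination_repr a, Finsupp.linearCombination_apply,
        Finsupp.sum, map_sum]
      refine Finset.sum_congr rfl fun j _ => ?_
      rw [Algebra.smul_def, map_mul, mul_comm]
      congr 1
      change _ = lift (C (MvPolynomial.C _))
      simp [lift, cc]
    intro g
    induction g using Polynomial.induction_on' with
    | add p q hp hq => exact hadd p q hp hq
    | monomial n a =>
      have : monomial n a = C a * lift (X ^ n) := by simp [lift, C_mul_X_pow_eq_monomial]
      rw [this]
      apply hmul
      induction a using MvPolynomial.induction_on with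
      | C a => exact hconst a
      | add p q hp hq =>
        rw [C_add]
        exact hadd _ _ (hp (by simp [lift, C_mul_X_pow_eq_monomial]))
          (hq (by simp [lift, C_mul_X_pow_eq_monomial]))
      | mul_X p i hp =>
        have : C (p * MvPolynomial.X i) = C p * lift (C (MvPolynomial.X i)) := by simp [lift]
        rw [this]
        exact hmul _ _ (hp (by simp [lift, C_mul_X_pow_eq_monomial]))
  -- the kernel of `ψ` is computed coefficientwise, as `N ⊗[K] B` is free over `B` on the basis `e`
  have hker : ∀ g, ψ g = 0 ↔ lift f ∣ g := by
    intro g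
    constructor
    · intro hg
      obtain ⟨c, rfl⟩ := hdec g
      have h1 : c.sum (fun j p => e j ⊗ₜ[K] evalPoly t y p) = 0 := by
        rw [← hg, Finsupp.sum, Finsupp.sum, map_sum]
        refine Finset.sum_congr rfl fun j _ => ?_
        rw [map_mul, hcc, hlift, Algebra.TensorProduct.includeRight_apply,
          Algebra.TensorProduct.tmul_mul_tmul, mul_one, one_mul]
      have h2 : ∀ j, evalPoly t y (c j) = 0 := by
        have h3 : (TensorProduct.equivFinsuppOfBasisLeft (N := B) e)
            (c.sum fun j p => e j ⊗ₜ[K] evalPoly t y p) = 0 := by rw [h1, map_zero]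
        intro j
        have h4 := DFunLike.congr_fun h3 j
        rw [Finsupp.sum, map_sum, Finsupp.finsetSum_apply] at h4
        simp only [TensorProduct.equivFinsuppOfBasisLeft_apply_tmul_apply, Module.Basis.repr_self,
          Finsupp.zero_apply] at h4
        rw [Finset.sum_eq_single j] at h4
        · simpa using h4
        · intro j' _ hj'
          rw [Finsupp.single_eq_of_ne hj'.symm, zero_smul]
        · intro hj
          rw [Finsupp.notMem_support_iff.1 hj, map_zero, smul_zero]
      refine Finset.dvd_sum fun j _ => Dvd.dvd.mul_left ?_ _
      exact map_dvd lift ((hf _).1 (h2 j))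
    · rintro ⟨h, rfl⟩
      rw [map_mul, hlift, (hf f).2 dvd_rfl, map_zero, zero_mul]
  refine ⟨?_, fun hu => ?_, fun a b hab => ?_⟩
  · exact (map_ne_zero_iff lift (map_injective _ (MvPolynomial.map_injective _
      (algebraMap K N).injective))).2 hf0
  · have h1 := (hker 1).2 (isUnit_iff_dvd_one.1 hu)
    rw [map_one] at h1
    exact one_ne_zero h1
  · change lift f ∣ a ∨ lift f ∣ b
    rw [← hker, ← hker, ← mul_eq_zero, ← map_mul, hker]
    exact hab

end BaseChange

section Points

/-- A zero `(τ, r)` of the equation `f` of `B` with `q(τ) ≠ 0` extends to a `K`-algebra homomorphism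
`B → M`, as `B` and the ring generated by `t` and `y` agree after inverting `q(t)`. -/
theorem nonempty_algHom_of_evalPoly_eq_zero {K B M σ : Type*} [Field K] [CommRing B]
    [Algebra K B] [Field M] [Algebra K M] {t : σ → B} {y : B}
    {f : Polynomial (MvPolynomial σ K)} {q : MvPolynomial σ K}
    (hf : ∀ g, evalPoly t y g = 0 ↔ f ∣ g)
    (hB : ∀ b : B, ∃ (n : ℕ) (g : Polynomial (MvPolynomial σ K)),
      MvPolynomial.aeval t q ^ n * b = evalPoly t y g)
    {τ : σ → M} {r : M} (hfM : evalPoly τ r f = 0) (hqM : MvPolynomial.aeval τ q ≠ 0) :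
    Nonempty (B →ₐ[K] M) := by
  have hzero : ∀ g, evalPoly t y g = 0 → evalPoly τ r g = 0 := fun g hg => by
    obtain ⟨h, rfl⟩ := (hf g).1 hg
    rw [map_mul, hfM, zero_mul]
  choose n g hg using hB
  let φ : B → M := fun b => evalPoly τ r (g b) / MvPolynomial.aeval τ q ^ n b
  have key : ∀ (b : B) (m : ℕ) (h : Polynomial (MvPolynomial σ K)),
      MvPolynomial.aeval t q ^ m * b = evalPoly t y h →
      φ b = evalPoly τ r h / MvPolynomial.aeval τ q ^ m := by
    intro b m h hb
    have h1 := hzero (C q ^ m * g b - C q ^ n b * h) (by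
      rw [map_sub, map_mul, map_mul, map_pow, map_pow, evalPoly_C, ← hg, ← hb]
      ring)
    rw [map_sub, map_mul, map_mul, map_pow, map_pow, evalPoly_C, sub_eq_zero] at h1
    rw [div_eq_div_iff (pow_ne_zero _ hqM) (pow_ne_zero _ hqM), mul_comm, h1, mul_comm]
  have halg : ∀ a : K, φ (algebraMap K B a) = algebraMap K M a := fun a => by
    rw [key _ 0 (algebraMap K _ a) (by rw [AlgHom.commutes, pow_zero, one_mul]), AlgHom.commutes,
      pow_zero, div_one]
  refine ⟨{
    toFun := φ
    map_one' := ?_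
    map_mul' := fun a b => ?_
    map_zero' := ?_
    map_add' := fun a b => ?_
    commutes' := halg }⟩
  · have := halg 1; rwa [map_one, map_one] at this
  · rw [key (a * b) (n a + n b) (g a * g b) (by rw [map_mul, ← hg, ← hg]; ring), map_mul]
    simp only [φ]
    field_simp
    ring
  · have := halg 0; rwa [map_zero, map_zero] at this
  · rw [key (a + b) (n a + n b) (C q ^ n b * g a + C q ^ n a * g b) (by
      rw [map_add, map_mul, map_mul, map_pow, map_pow, evalPoly_C, ← hg, ← hg]; ring), map_add,
      map_mul, map_mul, map_pow, map_pow, evalPoly_C]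
    simp only [φ]
    field_simp
    ring

end Points

end LocGlob

/-! ### Substitution of the parameters -/

namespace LocGlob

open Polynomial Topology

section Substitution

theorem evalPoly_algHom_ext {K B σ : Type*} [CommRing K] [CommRing B] [Algebra K B]
    {Φ Φ' : Polynomial (MvPolynomial σ K) →ₐ[K] B}
    (h : ∀ i, Φ (C (MvPolynomial.X i)) = Φ' (C (MvPolynomial.X i))) (hX : Φ X = Φ' X) :
    Φ = Φ' := by
  rw [eq_evalPoly Φ, eq_evalPoly Φ', hX]
  simp only [h]

variable {R σ : Type*} [Field R]

/-- The substitution `t_i ↦ g_i(Y) + ϖ s_i` in `R[t][Y]`. The new parameters `s_i` carry the names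
of the old ones. -/
noncomputable def substPoly (g : σ → R[X]) (ϖ : R) :
    Polynomial (MvPolynomial σ R) →ₐ[R] Polynomial (MvPolynomial σ R) :=
  evalPoly (fun i => (g i).map MvPolynomial.C + C (MvPolynomial.C ϖ * MvPolynomial.X i)) X

/-- For `ϖ ≠ 0` the substitution `t_i ↦ g_i(Y) + ϖ s_i` is an automorphism of the polynomial ring,
so it preserves primes. -/
theorem prime_substPoly (g : σ → R[X]) {ϖ : R} (hϖ : ϖ ≠ 0) {f : Polynomial (MvPolynomial σ R)}
    (hf : Prime f) : Prime (substPoly g ϖ f) := by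
  let inv : Polynomial (MvPolynomial σ R) →ₐ[R] Polynomial (MvPolynomial σ R) :=
    evalPoly (fun i => C (MvPolynomial.C ϖ⁻¹) *
      (C (MvPolynomial.X i) - (g i).map MvPolynomial.C)) X
  have hconst (Φ : Polynomial (MvPolynomial σ R) →ₐ[R] Polynomial (MvPolynomial σ R)) (a : R) :
      Φ (C (MvPolynomial.C a)) = C (MvPolynomial.C a) := Φ.commutes a
  have hpoly (Φ : Polynomial (MvPolynomial σ R) →ₐ[R] Polynomial (MvPolynomial σ R))
      (hΦ : Φ X = X) (p : R[X]) : Φ (p.map MvPolynomial.C) = p.map MvPolynomial.C := by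
    induction p using Polynomial.induction_on' with
    | add p q hp hq => rw [Polynomial.map_add, map_add, hp, hq]
    | monomial n a =>
      rw [Polynomial.map_monomial, ← C_mul_X_pow_eq_monomial, map_mul, map_pow, hΦ, hconst]
  have hX₁ : substPoly g ϖ X = X := evalPoly_X _ _
  have hX₂ : inv X = X := evalPoly_X _ _
  have hcc : (C (MvPolynomial.C ϖ) * C (MvPolynomial.C ϖ⁻¹) :
      Polynomial (MvPolynomial σ R)) = 1 := by
    rw [← C_mul, ← MvPolynomial.C_mul, mul_inv_cancel₀ hϖ, MvPolynomial.C_1, C_1]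
  have h₁ : (substPoly g ϖ).comp inv = AlgHom.id R _ := by
    refine evalPoly_algHom_ext (fun i => ?_) ?_
    · change substPoly g ϖ (evalPoly _ _ _) = C (MvPolynomial.X i)
      rw [evalPoly_C, MvPolynomial.aeval_X, map_mul, map_sub, hconst, hpoly _ hX₁]
      change _ * (evalPoly _ _ _ - _) = _
      rw [evalPoly_C, MvPolynomial.aeval_X, add_sub_cancel_left, C_mul]
      linear_combination (C (MvPolynomial.X i)) * hcc
    · change substPoly g ϖ (inv X) = X
      rw [hX₂, hX₁]
  have h₂ : inv.comp (substPoly g ϖ) = AlgHom.id R _ := by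
    refine evalPoly_algHom_ext (fun i => ?_) ?_
    · change inv (evalPoly _ _ _) = C (MvPolynomial.X i)
      rw [evalPoly_C, MvPolynomial.aeval_X, map_add, C_mul, map_mul, hconst, hpoly _ hX₂]
      change _ + _ * (evalPoly _ _ _) = _
      rw [evalPoly_C, MvPolynomial.aeval_X]
      linear_combination (C (MvPolynomial.X i) - (g i).map MvPolynomial.C) * hcc
    · change inv (substPoly g ϖ X) = X
      rw [hX₁, hX₂]
  exact (MulEquiv.prime_iff (AlgEquiv.ofAlgHom _ _ h₁ h₂)).2 hf

theorem map_eval_substPoly (g : σ → R[X]) (ϖ : R) (s : σ → R)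
    (f : Polynomial (MvPolynomial σ R)) :
    (substPoly g ϖ f).map (MvPolynomial.eval s) = evalPoly (fun i => g i + C (ϖ * s i)) X f := by
  have : (mapAlgHom (MvPolynomial.aeval s : MvPolynomial σ R →ₐ[R] R)).comp (substPoly g ϖ) =
      evalPoly (fun i => g i + C (ϖ * s i)) X := by
    refine evalPoly_algHom_ext (fun i => ?_) ?_
    · simp [substPoly, Polynomial.map_map]
      convert Polynomial.map_id
      ext a
      simp
    · simp [substPoly]
  exact DFunLike.congr_fun this f

theorem map_substPoly {N : Type*} [Field N] [Algebra R N] (g : σ → R[X]) (ϖ : R)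
    (f : Polynomial (MvPolynomial σ R)) :
    (substPoly g ϖ f).map (MvPolynomial.map (algebraMap R N)) =
      substPoly (fun i => (g i).map (algebraMap R N)) (algebraMap R N ϖ)
        (f.map (MvPolynomial.map (algebraMap R N))) := by
  let m : Polynomial (MvPolynomial σ R) →ₐ[R] Polynomial (MvPolynomial σ N) :=
    mapAlgHom (MvPolynomial.mapAlgHom (Algebra.ofId R N))
  have : m.comp (substPoly g ϖ) = ((substPoly (fun i => (g i).map (algebraMap R N))
      (algebraMap R N ϖ)).restrictScalars R).comp m := by
    refine evalPoly_algHom_ext (fun i => ?_) ?_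
    · simp [substPoly, m, Polynomial.map_map]
    · simp [substPoly, m]
  exact DFunLike.congr_fun this f

theorem map_evalPoly_polynomial {N : Type*} [Field N] [Algebra R N] (G : σ → R[X])
    (f : Polynomial (MvPolynomial σ R)) :
    (evalPoly G X f).map (algebraMap R N) =
      evalPoly (K := R) (fun i => (G i).map (algebraMap R N)) X f := by
  have := map_evalPoly G X (mapAlgHom (Algebra.ofId R N)) f
  simpa [Function.comp_def] using this

theorem eval_evalPoly {M : Type*} [Field M] [Algebra R M] (G : σ → M[X]) (b : M)
    (f : Polynomial (MvPolynomial σ R)) :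
    (evalPoly G X f).eval b = evalPoly (fun i => (G i).eval b) b f := by
  have := map_evalPoly G X ((aeval b : M[X] →ₐ[M] M).restrictScalars R) f
  simpa [Function.comp_def] using this

/-- If the derivatives of the `G_i` vanish at `b`, the derivative of `f(G(Y), Y)` at `b` is the
partial derivative `∂f/∂Y` at the point `(G(b), b)`. -/
theorem eval_derivative_evalPoly {M : Type*} [Field M] [Algebra R M] {G : σ → M[X]} {b : M}
    (hG : ∀ i, (derivative (G i)).eval b = 0) (f : Polynomial (MvPolynomial σ R)) :
    (derivative (evalPoly G X f)).eval b =
      evalPoly (fun i => (G i).eval b) b (derivative f) := by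
  have h0 (p : MvPolynomial σ R) : (derivative (MvPolynomial.aeval G p)).eval b = 0 := by
    induction p using MvPolynomial.induction_on with
    | C a => rw [MvPolynomial.aeval_C, Polynomial.algebraMap_apply, derivative_C, eval_zero]
    | add p q hp hq => rw [map_add, derivative_add, eval_add, hp, hq, add_zero]
    | mul_X p i hp =>
      rw [map_mul, MvPolynomial.aeval_X, derivative_mul, eval_add, eval_mul, eval_mul, hp, hG]
      ring
  have h1 (p : MvPolynomial σ R) : (MvPolynomial.aeval G p).eval b =
      MvPolynomial.aeval (fun i => (G i).eval b) p := by
    have := eval_evalPoly G b (C p)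
    rwa [evalPoly_C, evalPoly_C] at this
  induction f using Polynomial.induction_on' with
  | add p q hp hq => rw [map_add, derivative_add, eval_add, hp, hq, derivative_add, map_add]
  | monomial n a =>
    rw [derivative_monomial, ← C_mul_X_pow_eq_monomial, ← C_mul_X_pow_eq_monomial]
    simp only [map_mul, map_pow, evalPoly_C, evalPoly_X, derivative_mul, derivative_X_pow,
      eval_add, eval_mul, h0, h1, map_natCast]
    simp
    ring

end Substitution

section Local

/-- The family of polynomials of degree at most `D`, indexed by `σ`, with coefficients `c (i, j)`.
-/
noncomputable def coeffPoly {R : Type*} [CommSemiring R] {σ : Type*} {D : ℕ}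
    (c : σ × Fin (D + 1) → R) (i : σ) : R[X] := ∑ j, C (c (i, j)) * X ^ (j : ℕ)

theorem coeffPoly_coeff {R : Type*} [CommSemiring R] {σ : Type*} {D : ℕ} (G : σ → R[X])
    (hG : ∀ i, (G i).natDegree ≤ D) :
    coeffPoly (D := D) (fun z => (G z.1).coeff z.2) = G := by
  funext i
  rw [coeffPoly, Fin.sum_univ_eq_sum_range (fun j => C ((G i).coeff j) * X ^ j)]
  exact ((G i).as_sum_range_C_mul_X_pow' (Nat.lt_succ_of_le (hG i))).symm

theorem coeffPoly_map {R S : Type*} [CommSemiring R] [CommSemiring S] {σ : Type*} {D : ℕ}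
    (φ : R →+* S) (c : σ × Fin (D + 1) → R) (i : σ) :
    (coeffPoly c i).map φ = coeffPoly (φ ∘ c) i := by
  simp [coeffPoly, Polynomial.map_sum]

/-- Let `b` be a root of `f(G(Y), Y)` that gives a point where `∂f/∂Y` and `q` do not vanish, the
`G_i` having zero derivative at `b`. Then `f(G'(Y), Y)` has a simple root with `q(G') ≠ 0` for all
families `G'` with coefficients close to those of `G`. -/
theorem eventually_exists_point {K M σ : Type*} [Field K] [NontriviallyNormedField M]
    [CompleteSpace M] [Algebra K M] [Finite σ] {D : ℕ} (f : Polynomial (MvPolynomial σ K))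
    (q : MvPolynomial σ K) (c₀ : σ × Fin (D + 1) → M) (b : M)
    (hG : ∀ i, (derivative (coeffPoly c₀ i)).eval b = 0)
    (hf : evalPoly (fun i => (coeffPoly c₀ i).eval b) b f = 0)
    (hf' : evalPoly (fun i => (coeffPoly c₀ i).eval b) b (derivative f) ≠ 0)
    (hq : MvPolynomial.aeval (fun i => (coeffPoly c₀ i).eval b) q ≠ 0) :
    ∀ᶠ c in 𝓝 c₀, ∃ y, (evalPoly (coeffPoly c) X f).eval y = 0 ∧
      (derivative (evalPoly (coeffPoly c) X f)).eval y ≠ 0 ∧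
      MvPolynomial.aeval (fun i => (coeffPoly c i).eval y) q ≠ 0 := by
  -- the coefficients of the polynomials are the parameters of `eventually_exists_root`
  let 𝒢 : σ → Polynomial (MvPolynomial (σ × Fin (D + 1)) M) := coeffPoly MvPolynomial.X
  have h𝒢 (c : σ × Fin (D + 1) → M) (i : σ) : (𝒢 i).map (MvPolynomial.eval c) = coeffPoly c i := by
    rw [coeffPoly_map]
    congr 1
    funext z
    simp
  let ev (g : Polynomial (MvPolynomial σ K)) : Polynomial (MvPolynomial (σ × Fin (D + 1)) M) :=
    evalPoly 𝒢 X g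
  have hev (g) (c : σ × Fin (D + 1) → M) :
      (ev g).map (MvPolynomial.eval c) = evalPoly (coeffPoly c) X g := by
    have := map_evalPoly 𝒢 X ((mapAlgHom (MvPolynomial.aeval c :
      MvPolynomial (σ × Fin (D + 1)) M →ₐ[M] M)).restrictScalars K) g
    simp only [AlgHom.restrictScalars_apply, coe_mapAlgHom, map_X, Function.comp_def] at this
    refine this.trans ?_
    congr 2
    funext i
    exact h𝒢 c i
  have hq' (c : σ × Fin (D + 1) → M) (y : M) : MvPolynomial.aeval
      (fun i => (coeffPoly c i).eval y) q = ((ev (C q)).map (MvPolynomial.eval c)).eval y := by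
    rw [hev, eval_evalPoly, evalPoly_C]
  have hder (c : σ × Fin (D + 1) → M) : (derivative (ev f)).map (MvPolynomial.eval c) =
      derivative (evalPoly (coeffPoly c) X f) := by
    rw [← derivative_map, hev]
  have h1 := eventually_exists_root (ev f) (c₀ := c₀) (b := b)
    (by rw [hev, eval_evalPoly, hf])
    (by rw [hev, eval_derivative_evalPoly hG]; exact hf')
    (W := {z | ((derivative (ev f)).map (MvPolynomial.eval z.1)).eval z.2 ≠ 0 ∧
      ((ev (C q)).map (MvPolynomial.eval z.1)).eval z.2 ≠ 0})
    (((isOpen_ne_fun (continuous_eval_map_eval _) continuous_const).inter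
      (isOpen_ne_fun (continuous_eval_map_eval _) continuous_const)).mem_nhds
      ⟨by
        change eval b _ ≠ 0
        rw [hder, eval_derivative_evalPoly hG]; exact hf', by
        change eval b _ ≠ 0
        rw [← hq']; exact hq⟩)
  filter_upwards [h1] with c hc
  obtain ⟨y, ⟨hy1, hy2⟩, hy⟩ := hc
  refine ⟨y, by rwa [← hev], ?_, ?_⟩
  · rw [← hder]; exact hy1
  · rw [hq']; exact hy2

end Local

end LocGlob

/-! ### Linear disjointness and weak approximation -/

namespace LocGlob

open Polynomial Topology IntermediateField

section Disjoint

/-- There is a finite extension `N` of `K`, Galois over the subfield `E`, that contains all the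
conjugates of `L` over `K`. -/
theorem exists_isGalois_intermediateField {E K L : Type*} [Field E] [Field K] [CharZero E]
    [Algebra E K] [FiniteDimensional E K] [Field L] [Algebra K L] [FiniteDimensional K L] :
    ∃ N : IntermediateField K (AlgebraicClosure K), FiniteDimensional E N ∧ IsGalois E N ∧
      FiniteDimensional K N ∧ ∀ i : L →ₐ[K] AlgebraicClosure K, i.fieldRange ≤ N := by
  let Ω := AlgebraicClosure K
  let 𝓛 : IntermediateField K Ω := ⨆ i : L →ₐ[K] Ω, i.fieldRange
  have : Finite (L →ₐ[K] Ω) := inferInstance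
  have hfin : FiniteDimensional K 𝓛 := by
    have : ∀ i : L →ₐ[K] Ω, FiniteDimensional K i.fieldRange := fun i =>
      (LinearMap.finiteDimensional_range i.toLinearMap :)
    exact IntermediateField.finiteDimensional_iSup_of_finite
  have : FiniteDimensional E 𝓛 := .trans E K 𝓛
  have : Algebra.IsAlgebraic E Ω := .trans E K Ω
  have : IsScalarTower E 𝓛 Ω := .of_algebraMap_eq fun _ => rfl
  have : IsAlgClosure E Ω := ⟨inferInstance, inferInstance⟩
  have : Normal E Ω := inferInstance
  let N₀ : IntermediateField E Ω := normalClosure E 𝓛 Ω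
  have hle : ∀ z : Ω, z ∈ 𝓛 → z ∈ N₀ := by
    intro z hz
    have : (IsScalarTower.toAlgHom E 𝓛 Ω).fieldRange ≤ N₀ := AlgHom.fieldRange_le_normalClosure _
    exact this ⟨⟨z, hz⟩, rfl⟩
  let N : IntermediateField K Ω := { N₀.toSubfield with
    algebraMap_mem' := fun r => hle _ (𝓛.algebraMap_mem r) }
  let e : N₀ ≃ₐ[E] N := { RingEquiv.refl N₀ with commutes' := fun r => rfl }
  have hN₀ : FiniteDimensional E N₀ := inferInstance
  have hgal : IsGalois E N₀ := ⟨⟩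
  have h1 : FiniteDimensional E N := e.toLinearEquiv.finiteDimensional
  refine ⟨N, h1, .of_algEquiv e, .right E K N, fun i z hz => hle z ?_⟩
  exact (le_iSup (fun i : L →ₐ[K] Ω => i.fieldRange) i) hz

/-- If `P` stays irreducible over `N`, then every image of `K[Y]/(P)` is linearly disjoint over `K`
from the subfields of `N`. -/
theorem linearDisjoint_adjoinRoot {K L Ω : Type*} [Field K] [Field L] [Algebra K L] [Field Ω]
    [Algebra K Ω] (N : IntermediateField K Ω) {P : K[X]} [Fact (Irreducible P)]
    (hP : Irreducible (P.map (algebraMap K N))) (i : L →ₐ[K] Ω) (hi : i.fieldRange ≤ N)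
    (j : AdjoinRoot P →ₐ[K] Ω) : i.fieldRange.LinearDisjoint j.fieldRange := by
  refine IntermediateField.LinearDisjoint.of_le_left (A := N) ?_ hi
  have hP0 : P ≠ 0 := (Fact.out : Irreducible P).ne_zero
  let r : Ω := j (AdjoinRoot.root P)
  have hr : aeval r P = 0 := by
    rw [aeval_algHom_apply, AdjoinRoot.aeval_eq, AdjoinRoot.mk_self, map_zero]
  let b := (AdjoinRoot.powerBasis hP0).basis.map (AlgEquiv.ofInjectiveField j).toLinearEquiv
  refine IntermediateField.LinearDisjoint.of_basis_right b ?_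
  have hb : (fun m => ((b m : j.fieldRange) : Ω)) =
      fun m : Fin (AdjoinRoot.powerBasis hP0).dim => r ^ (m : ℕ) := by
    funext m
    change j ((AdjoinRoot.powerBasis hP0).basis m) = _
    rw [PowerBasis.basis_eq_pow, AdjoinRoot.powerBasis_gen, map_pow]
  change LinearIndependent N (fun m => ((b m : j.fieldRange) : Ω))
  rw [hb]
  have hdeg : (AdjoinRoot.powerBasis hP0).dim = (minpoly N r).natDegree := by
    rw [AdjoinRoot.powerBasis_dim, ← natDegree_map (algebraMap K N),
      ← minpoly.eq_of_irreducible hP (x := r) (by rw [aeval_map_algebraMap, hr]),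
      natDegree_mul_C (inv_ne_zero (leadingCoeff_ne_zero.2 hP.ne_zero))]
  exact (linearIndependent_pow (K := N) r).comp (Fin.cast hdeg) (Fin.cast_injective hdeg)

end Disjoint

section Approximation

/-- Weak approximation of local coefficients `c₀` by `c + ϖ s`, uniformly in the parameters `s` of
norm at most `2`, with a nonzero `ϖ` that is small in each of the fields. -/
theorem exists_approximation {K σ ι : Type*} [Field K] [Finite ι] [Finite σ] {Kw : ι → Type*}
    [∀ w, NontriviallyNormedField (Kw w)] [∀ w, Algebra K (Kw w)]
    (hdense : DenseRange fun (x : K) w => algebraMap K (Kw w) x)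
    (c₀ : ∀ w, σ → Kw w) (U : ∀ w, Set (σ → Kw w)) (hU : ∀ w, U w ∈ 𝓝 (c₀ w)) :
    ∃ (c : σ → K) (ϖ : K), (∀ w, 0 < ‖algebraMap K (Kw w) ϖ‖ ∧ ‖algebraMap K (Kw w) ϖ‖ < 1) ∧
      ∀ w (s : σ → Kw w), (∀ i, ‖s i‖ ≤ 2) →
        (fun i => algebraMap K (Kw w) (c i) + algebraMap K (Kw w) ϖ * s i) ∈ U w := by
  have := Fintype.ofFinite σ
  have hε : ∀ w, ∃ ε > 0, Metric.ball (c₀ w) ε ⊆ U w := fun w => Metric.mem_nhds_iff.1 (hU w)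
  choose ε hε0 hε using hε
  obtain ⟨ϖ, hϖ⟩ : ∃ ϖ : K, ∀ w, 0 < ‖algebraMap K (Kw w) ϖ‖ ∧
      ‖algebraMap K (Kw w) ϖ‖ < min 1 (ε w / 4) := by
    have hopen : IsOpen (Set.univ.pi fun w : ι =>
        {z : Kw w | 0 < ‖z‖ ∧ ‖z‖ < min 1 (ε w / 4)}) :=
      isOpen_set_pi Set.finite_univ fun w _ =>
        (isOpen_lt continuous_const continuous_norm).inter
          (isOpen_lt continuous_norm continuous_const)
    have hne : (Set.univ.pi fun w : ι =>
        {z : Kw w | 0 < ‖z‖ ∧ ‖z‖ < min 1 (ε w / 4)}).Nonempty := by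
      choose z hz using fun w => NormedField.exists_norm_lt (Kw w)
        (lt_min one_pos (div_pos (hε0 w) four_pos))
      exact ⟨z, fun w _ => hz w⟩
    obtain ⟨ϖ, h⟩ := hdense.exists_mem_open hopen hne
    exact ⟨ϖ, fun w => h w trivial⟩
  have hc : ∀ i, ∃ c : K, ∀ w, ‖algebraMap K (Kw w) c - c₀ w i‖ < ε w / 4 := by
    intro i
    have hopen : IsOpen (Set.univ.pi fun w : ι => Metric.ball (c₀ w i) (ε w / 4)) :=
      isOpen_set_pi Set.finite_univ fun w _ => Metric.isOpen_ball
    obtain ⟨c, h⟩ := hdense.exists_mem_open hopen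
      ⟨fun w => c₀ w i, fun w _ => Metric.mem_ball_self (div_pos (hε0 w) four_pos)⟩
    exact ⟨c, fun w => by simpa [dist_eq_norm] using h w trivial⟩
  choose c hc using hc
  refine ⟨c, ϖ, fun w => ⟨(hϖ w).1, (hϖ w).2.trans_le (min_le_left _ _)⟩, fun w s hs => hε w ?_⟩
  rw [Metric.mem_ball, dist_pi_lt_iff (hε0 w)]
  intro i
  rw [dist_eq_norm]
  have h1 : ‖algebraMap K (Kw w) ϖ * s i‖ ≤ ε w / 4 * 2 := by
    rw [norm_mul]
    exact mul_le_mul ((hϖ w).2.le.trans (min_le_right _ _)) (hs i) (norm_nonneg _)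
      (div_pos (hε0 w) four_pos).le
  calc _ = ‖(algebraMap K (Kw w) (c i) - c₀ w i) + algebraMap K (Kw w) ϖ * s i‖ := by ring_nf
    _ ≤ _ := norm_add_le _ _
    _ < ε w := by have := hc i w; linarith [hε0 w]

end Approximation

section Core

/-- Adding to the `b w` the same linear combination of the coordinates `a w i`, with coefficients
powers of a natural number `n`, produces elements that generate all the coordinates over `Kw w`. -/
theorem exists_generic_shift {ι : Type*} [Finite ι] {d : ℕ} {Kw Mw : ι → Type*}
    [∀ w, Field (Kw w)] [∀ w, Field (Mw w)] [∀ w, CharZero (Kw w)] [∀ w, Algebra (Kw w) (Mw w)]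
    [∀ w, FiniteDimensional (Kw w) (Mw w)] (a : ∀ w, Fin d → Mw w) (b : ∀ w, Mw w) :
    ∃ n : ℕ, ∀ w i, a w i ∈ IntermediateField.adjoin (Kw w)
      {b w + ∑ j : Fin d, (n : Mw w) ^ ((j : ℕ) + 1) * a w j} := by
  -- the shifted element is the value at `n` of a polynomial with coefficients `b w` and `a w j`
  let p (w : ι) : (Mw w)[X] := C (b w) + ∑ j : Fin d, C (a w j) * X ^ ((j : ℕ) + 1)
  have hp (w : ι) (i : Fin d) : (p w).coeff ((i : ℕ) + 1) = a w i := by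
    simp only [p, coeff_add, coeff_C_succ, finsetSum_coeff, coeff_C_mul, coeff_X_pow, zero_add]
    rw [Finset.sum_eq_single i]
    · simp
    · intro j _ hj
      rw [if_neg, mul_zero]
      intro h
      exact hj (Fin.ext (by omega))
    · simp
  have hfin : (⋃ z : ι × Fin d, {n : ℕ | (p z.1).coeff ((z.2 : ℕ) + 1) ∉
      IntermediateField.adjoin (Kw z.1) {(p z.1).eval (n : Mw z.1)}}).Finite :=
    Set.finite_iUnion fun z => finite_setOf_notMem_adjoin_eval (p z.1) _
  obtain ⟨n, hn⟩ := hfin.exists_notMem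
  refine ⟨n, fun w i => ?_⟩
  by_contra h
  refine hn (Set.mem_iUnion.2 ⟨(w, i), ?_⟩)
  change (p w).coeff ((i : ℕ) + 1) ∉ IntermediateField.adjoin (Kw w) {(p w).eval (n : Mw w)}
  rw [hp]
  convert h using 3
  simp only [p, eval_add, eval_C, eval_finsetSum, eval_mul, eval_pow, eval_X, mul_comm]

end Core

end LocGlob

/-! ### The extension attached to local points of an affine variety -/

namespace LocGlob

open Polynomial Topology IntermediateField TensorProduct

section Core

theorem evalPoly_taylor_neg {K B σ : Type*} [CommRing K] [CommRing B] [Algebra K B] (t : σ → B)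
    (y : B) (c : MvPolynomial σ K) (g : Polynomial (MvPolynomial σ K)) :
    evalPoly t (y + MvPolynomial.aeval t c) (taylor (-c) g) = evalPoly t y g := by
  rw [← evalPoly_taylor, taylor_taylor, add_neg_cancel, taylor_zero]

theorem derivative_taylor' {R : Type*} [CommRing R] (c : R) (g : R[X]) :
    derivative (taylor c g) = taylor c (derivative g) := by
  rw [taylor_apply, taylor_apply, derivative_comp]
  simp

theorem taylor_dvd_iff {R : Type*} [CommRing R] (c : R) (f g : R[X]) :
    taylor (-c) f ∣ g ↔ f ∣ taylor c g := by
  rw [← map_dvd_iff (taylorEquiv (-c)) (a := f)]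
  change _ ↔ taylor (-c) f ∣ taylor (-c) (taylor c g)
  rw [taylor_taylor, neg_add_cancel, taylor_zero]

/-- A hypersurface model of `B` adapted to finitely many local points. The variable `y` is replaced
by `y + ∑ n ^ (j + 1) t_j`, so that at each `w` the value `b` of `y` generates the values of the
`t_i` over `Kw w`; the latter are then `G_i(b)` for polynomials `G_i` over `Kw w`, chosen with zero
derivative at `b` so that `b` is a simple root of `f(G(Y), Y)`. -/
theorem exists_model_of_points {K B ι : Type*} [Field K] [CharZero K] [CommRing B] [IsDomain B]
    [Algebra K B] [Algebra.FiniteType K B] [Finite ι] {Kw Mw : ι → Type*}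
    [∀ w, Field (Kw w)] [∀ w, Field (Mw w)] [∀ w, Algebra (Kw w) (Mw w)]
    [∀ w, FiniteDimensional (Kw w) (Mw w)] [∀ w, Algebra K (Kw w)] [∀ w, Algebra K (Mw w)]
    [∀ w, IsScalarTower K (Kw w) (Mw w)]
    (hpt : ∀ w (q : B), q ≠ 0 → ∃ φ : B →ₐ[K] Mw w, φ q ≠ 0) :
    ∃ (d : ℕ) (t : Fin d → B) (y : B) (f : Polynomial (MvPolynomial (Fin d) K))
      (q : MvPolynomial (Fin d) K), f ≠ 0 ∧
      (∀ g, evalPoly t y g = 0 ↔ f ∣ g) ∧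
      (∀ b : B, ∃ (n : ℕ) (g : Polynomial (MvPolynomial (Fin d) K)),
        MvPolynomial.aeval t q ^ n * b = evalPoly t y g) ∧
      ∀ w, ∃ (G : Fin d → (Kw w)[X]) (b : Mw w), (∀ i, aeval b (derivative (G i)) = 0) ∧
        evalPoly (fun i => aeval b (G i)) b f = 0 ∧
        evalPoly (fun i => aeval b (G i)) b (derivative f) ≠ 0 ∧
        MvPolynomial.aeval (fun i => aeval b (G i)) q ≠ 0 := by
  obtain ⟨d, t, y, f, q, hq, hf, hf', hB⟩ := exists_primitive_model K B
  have hpt' : ∀ w, ∃ φ : B →ₐ[K] Mw w,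
      φ (evalPoly t y (derivative f) * MvPolynomial.aeval t q) ≠ 0 :=
    fun w => hpt w _ (mul_ne_zero hf' hq)
  choose φ hφ using hpt'
  have : ∀ w, CharZero (Kw w) := fun w =>
    charZero_of_injective_algebraMap (algebraMap K (Kw w)).injective
  obtain ⟨n, hn⟩ := exists_generic_shift (Kw := Kw) (fun w => φ w ∘ t) (fun w => φ w y)
  let c : MvPolynomial (Fin d) K :=
    ∑ j : Fin d, (n : MvPolynomial (Fin d) K) ^ ((j : ℕ) + 1) * MvPolynomial.X j
  have hc (w : ι) : φ w y + ∑ j : Fin d, (n : Mw w) ^ ((j : ℕ) + 1) * (φ w ∘ t) j =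
      φ w y + MvPolynomial.aeval (φ w ∘ t) c := by
    simp [c]
  refine ⟨d, t, y + MvPolynomial.aeval t c, taylor (-c) f, q, ?_, fun g => ?_, fun b => ?_,
    fun w => ?_⟩
  · rw [Ne, taylor_eq_zero]
    rintro rfl
    simp at hf'
  · rw [← evalPoly_taylor, hf, taylor_dvd_iff]
  · obtain ⟨n, g, h⟩ := hB b
    exact ⟨n, taylor (-c) g, by rw [evalPoly_taylor_neg, h]⟩
  · have h1 := hn w
    rw [hc] at h1
    choose G hG hG' using fun i => exists_aeval_eq_derivative_eq_zero (h1 i)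
    refine ⟨G, φ w y + MvPolynomial.aeval (φ w ∘ t) c, hG', ?_⟩
    simp only [hG]
    change evalPoly (φ w ∘ t) _ _ = 0 ∧ evalPoly (φ w ∘ t) _ _ ≠ 0 ∧
      MvPolynomial.aeval (φ w ∘ t) q ≠ 0
    rw [derivative_taylor', evalPoly_taylor_neg, evalPoly_taylor_neg, ← map_evalPoly,
      ← map_evalPoly, (hf f).2 dvd_rfl, map_zero]
    have h3 := hφ w
    rw [map_mul] at h3
    have h2 : MvPolynomial.aeval (φ w ∘ t) q = φ w (MvPolynomial.aeval t q) :=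
      (DFunLike.congr_fun (MvPolynomial.comp_aeval t (φ w)) q).symm
    refine ⟨rfl, left_ne_zero_of_mul h3, ?_⟩
    rw [h2]
    exact right_ne_zero_of_mul h3

/-- Gauss's lemma for polynomials over `N[X₁, …, X_d]`. -/
theorem irreducible_map_mvFrac_of_prime {N : Type*} [Field N] {d : ℕ}
    {Ψ : Polynomial (MvPolynomial (Fin d) N)} (hΨ : Prime Ψ) (hdeg : Ψ.natDegree ≠ 0) :
    Irreducible (Ψ.map (algebraMap _ (MvFrac (Fin d) N))) :=
  (hΨ.irreducible.isPrimitive hdeg).irreducible_iff_irreducible_map_fraction_map.1 hΨ.irreducible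

/-- A polynomial over `K` with parameters that stays prime over all finite extensions of `K` has
specialisations with values `α + β x`, irreducible over an extension `N` of `K` that contains all
the conjugates of `L`. -/
theorem exists_irreducible_specialisation {k E K : Type*} [Field k] [CharZero k] [Field E]
    [Algebra k E] [Field K] [Algebra E K] [Algebra k K] [IsScalarTower k E K]
    [FiniteDimensional E K] (hk : Cardinal.aleph0 < Cardinal.mk k) {x : E}
    (hx : Transcendental k x) (hE : IntermediateField.adjoin k {x} = ⊤)
    (L : Type*) [Field L] [Algebra K L] [FiniteDimensional K L] {d : ℕ}
    (Ψ : Polynomial (MvPolynomial (Fin d) K)) (hdeg : Ψ.natDegree ≠ 0)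
    (hΨ : ∀ N : IntermediateField K (AlgebraicClosure K), FiniteDimensional K N →
      Prime (Ψ.map (MvPolynomial.map (algebraMap K N)))) :
    ∃ (N : IntermediateField K (AlgebraicClosure K)) (α : Fin d → k) (β : Fin d → ℕ),
      (∀ i : L →ₐ[K] AlgebraicClosure K, i.fieldRange ≤ N) ∧
      Irreducible ((Ψ.map (MvPolynomial.eval fun i =>
        algebraMap k K (α i) + β i * algebraMap E K x)).map (algebraMap K N)) := by
  have : CharZero E := charZero_of_injective_algebraMap (algebraMap k E).injective
  obtain ⟨N, hEN, hgal, hKN, hLN⟩ := exists_isGalois_intermediateField (E := E) (K := K) (L := L)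
  have : CharZero N := charZero_of_injective_algebraMap (algebraMap E N).injective
  have hΨNirr := irreducible_map_mvFrac_of_prime (hΨ N hKN) (by
    rwa [natDegree_map_eq_of_injective (MvPolynomial.map_injective _ (algebraMap K N).injective)])
  obtain ⟨α, β, hirr⟩ := exists_irreducible_map_eval hk hx hE d _ hΨNirr
  refine ⟨N, α, β, hLN, ?_⟩
  convert hirr using 1
  rw [Polynomial.map_map, Polynomial.map_map]
  congr 1
  refine MvPolynomial.ringHom_ext (fun r => ?_) (fun i => ?_)
  · simp
  · simp only [RingHom.comp_apply, MvPolynomial.eval_X, MvPolynomial.map_X, map_add, map_mul,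
      map_natCast, IsScalarTower.algebraMap_apply k E K, IsScalarTower.algebraMap_apply E K N]

set_option maxHeartbeats 1000000 in
/-- The required extension for an affine variety `Spec B` with Zariski dense local points, in terms
of normed fields. For the model `f(t, Y)` of `B` adapted to the local points, the polynomial `Ψ(s,
Y) = f(g(Y) + ϖ s, Y)` stays prime over all finite extensions of `K`. Weak approximation provides
`g` and `ϖ` over `K` for which `Ψ(s, Y)` has a root in each `Mw w` as long as the `s_i` have norm at
most `2`. The element `ϖ` is not algebraic over `k`, being small and nonzero, so Hilbert
irreducibility over `k(ϖ)` applies: it gives values `s_i = α_i + β_i ϖ`, which are bounded, for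
which `P = Ψ(s, Y)` is irreducible over the conjugates of `L`. The extension is `K[Y]/(P)`. -/
theorem exists_extension_of_local_points {k K : Type*} [Field k] [CharZero k] [Field K]
    [Algebra k K] (hk : Cardinal.aleph0 < Cardinal.mk k)
    (hK : ∀ x : K, Transcendental k x → FiniteDimensional k⟮x⟯ K)
    {ι : Type*} [Finite ι] [Nonempty ι] {Kw Mw : ι → Type*}
    [∀ w, NontriviallyNormedField (Kw w)] [∀ w, Algebra K (Kw w)]
    (hdense : DenseRange fun (x : K) w => algebraMap K (Kw w) x)
    (hconst : ∀ w (x : K), IsAlgebraic k x → ‖algebraMap K (Kw w) x‖ ≤ 1)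
    [∀ w, NontriviallyNormedField (Mw w)] [∀ w, CompleteSpace (Mw w)]
    [∀ w, NormedAlgebra (Kw w) (Mw w)] [∀ w, FiniteDimensional (Kw w) (Mw w)]
    [∀ w, Algebra K (Mw w)] [∀ w, IsScalarTower K (Kw w) (Mw w)]
    {B : Type*} [CommRing B] [IsDomain B] [Algebra K B] [Algebra.FiniteType K B]
    (hB : ∀ N : IntermediateField K (AlgebraicClosure K), FiniteDimensional K N →
      IsDomain (N ⊗[K] B))
    (hpt : ∀ w (q : B), q ≠ 0 → ∃ φ : B →ₐ[K] Mw w, φ q ≠ 0)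
    (L : Type*) [Field L] [Algebra K L] [FiniteDimensional K L] :
    ∃ (P : K[X]) (_ : Fact (Irreducible P)), Nonempty (B →ₐ[K] AdjoinRoot P) ∧
      (∀ w, Nonempty (AdjoinRoot P →ₐ[K] Mw w)) ∧ LinearlyDisjoint K L (AdjoinRoot P) := by
  have : CharZero K := charZero_of_injective_algebraMap (algebraMap k K).injective
  obtain ⟨d, t, y, f, q, hf0, hf, hBq, hloc⟩ := exists_model_of_points (Kw := Kw) hpt
  choose G b hGb hfb hfb' hqb using hloc
  obtain ⟨D, hD⟩ : ∃ D : ℕ, ∀ w i, (G w i).natDegree ≤ D := by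
    have := Fintype.ofFinite ι
    exact ⟨Finset.univ.sup fun z : ι × Fin d => (G z.1 z.2).natDegree, fun w i =>
      Finset.le_sup (f := fun z : ι × Fin d => (G z.1 z.2).natDegree) (Finset.mem_univ (w, i))⟩
  let c₀ (w : ι) (z : Fin d × Fin (D + 1)) : Kw w := (G w z.1).coeff z.2
  have hc₀ (w : ι) (i : Fin d) : coeffPoly (algebraMap (Kw w) (Mw w) ∘ c₀ w) i =
      (G w i).map (algebraMap (Kw w) (Mw w)) := by
    rw [← coeffPoly_map, coeffPoly_coeff (G w) (hD w)]
  have hU (w : ι) : ∀ᶠ c in 𝓝 (c₀ w), ∃ y,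
      (evalPoly (coeffPoly (algebraMap (Kw w) (Mw w) ∘ c)) X f).eval y = 0 ∧
      (derivative (evalPoly (coeffPoly (algebraMap (Kw w) (Mw w) ∘ c)) X f)).eval y ≠ 0 ∧
      MvPolynomial.aeval
        (fun i => (coeffPoly (algebraMap (Kw w) (Mw w) ∘ c) i).eval y) q ≠ 0 := by
    have hcont : Continuous fun c : Fin d × Fin (D + 1) → Kw w => algebraMap (Kw w) (Mw w) ∘ c :=
      continuous_pi fun z => (algebraMapCLM (Kw w) (Mw w)).continuous.comp (continuous_apply z)
    refine hcont.continuousAt.eventually (eventually_exists_point f q _ (b w) ?_ ?_ ?_ ?_)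
    · intro i
      rw [hc₀, derivative_map, eval_map_algebraMap, hGb]
    all_goals simp only [hc₀, eval_map_algebraMap]
    · exact hfb w
    · exact hfb' w
    · exact hqb w
  obtain ⟨c, ϖ, hϖ, hcU⟩ := exists_approximation hdense c₀ _ hU
  obtain ⟨w₀⟩ := ‹Nonempty ι›
  have hϖ0 : ϖ ≠ 0 := by
    rintro rfl
    simpa using (hϖ w₀).1
  -- the inverse of `ϖ` is not integral at `w₀`, unlike the elements algebraic over `k`
  have hx : Transcendental k ϖ := by
    intro h
    have h1 := hconst w₀ ϖ⁻¹ h.inv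
    rw [map_inv₀, norm_inv] at h1
    exact absurd h1 (not_le.2 ((one_lt_inv₀ (hϖ w₀).1).2 (hϖ w₀).2))
  -- `x` is `ϖ`, as an element of `E = k(ϖ)`
  have := hK ϖ hx
  let E := k⟮ϖ⟯
  let x : E := IntermediateField.AdjoinSimple.gen k ϖ
  have hx' : Transcendental k x := fun h => hx (h.algHom E.val)
  have hE : IntermediateField.adjoin k {x} = ⊤ := by
    rw [eq_top_iff]
    rintro ⟨z, hz⟩ -
    obtain ⟨p, r, rfl⟩ := (IntermediateField.mem_adjoin_simple_iff k z).1 hz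
    have hpx (p : k[X]) : aeval ϖ p = E.val (aeval x p) := by
      rw [← aeval_algHom_apply]; rfl
    have : (⟨aeval ϖ p / aeval ϖ r, hz⟩ : E) = aeval x p / aeval x r := by
      apply Subtype.val_injective
      change aeval ϖ p / aeval ϖ r = E.val (aeval x p / aeval x r)
      rw [map_div₀, hpx, hpx]
    rw [this]
    exact (IntermediateField.mem_adjoin_simple_iff k _).2 ⟨p, r, rfl⟩
  -- the polynomial `Ψ(s, Y)`, with parameters `s`
  let g : Fin d → K[X] := coeffPoly c
  let Ψ := substPoly g ϖ f
  have hmap (w : ι) (c : Fin d × Fin (D + 1) → K) : (evalPoly (coeffPoly c) X f).map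
      (algebraMap K (Mw w)) =
      evalPoly (coeffPoly (algebraMap (Kw w) (Mw w) ∘ algebraMap K (Kw w) ∘ c)) X f := by
    rw [map_evalPoly_polynomial]
    congr 2
    funext i
    rw [coeffPoly_map]
    congr 1
    funext z
    exact IsScalarTower.algebraMap_apply K (Kw w) (Mw w) _
  -- at `s = 0` the polynomial `Ψ` has a simple root in `Mw w₀`, so it is not constant in `Y`
  have hdeg : Ψ.natDegree ≠ 0 := by
    intro h
    obtain ⟨r, hr⟩ := natDegree_eq_zero.1 h
    obtain ⟨y, -, hy, -⟩ := hcU w₀ 0 (by simp)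
    apply hy
    have h1 : evalPoly g X f = C (MvPolynomial.eval 0 r) := by
      have h2 := map_eval_substPoly g ϖ 0 f
      simp only [Pi.zero_apply, mul_zero, C_0, add_zero] at h2
      rw [← h2]
      change Polynomial.map _ Ψ = _
      rw [← hr, map_C]
    have h3 := hmap w₀ c
    change (evalPoly g X f).map _ = _ at h3
    rw [h1, map_C] at h3
    simp only [Pi.zero_apply, mul_zero, add_zero]
    change (derivative (evalPoly (coeffPoly (algebraMap (Kw w₀) (Mw w₀) ∘
      algebraMap K (Kw w₀) ∘ c)) X f)).eval y = 0
    rw [← h3, derivative_C, eval_zero]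
  have hΨ (N : IntermediateField K (AlgebraicClosure K)) (hN : FiniteDimensional K N) :
      Prime (Ψ.map (MvPolynomial.map (algebraMap K N))) := by
    have := hB N hN
    have h1 := prime_map_of_isDomain_tensorProduct N hf0 hf
    have h2 := prime_substPoly (fun i => (g i).map (algebraMap K N))
      (ϖ := algebraMap K N ϖ) (by rwa [Ne, map_eq_zero]) h1
    rwa [← map_substPoly] at h2
  obtain ⟨N, α, β, hLN, hPN⟩ := exists_irreducible_specialisation hk hx' hE L Ψ hdeg hΨ
  let s : Fin d → K := fun i => algebraMap k K (α i) + β i * ϖ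
  have hs : ∀ w i, ‖algebraMap K (Kw w) (s i)‖ ≤ 2 := by
    intro w i
    have h1 : ‖algebraMap K (Kw w) (algebraMap k K (α i))‖ ≤ 1 :=
      hconst w _ (isAlgebraic_algebraMap _)
    have h2 : ‖algebraMap K (Kw w) (β i : K)‖ ≤ 1 :=
      hconst w _ (isAlgebraic_natCast _)
    calc _ = ‖algebraMap K (Kw w) (algebraMap k K (α i)) +
        algebraMap K (Kw w) (β i : K) * algebraMap K (Kw w) ϖ‖ := by
          rw [← map_mul, ← map_add]
      _ ≤ 1 + 1 * 1 := by
          refine (norm_add_le _ _).trans (add_le_add h1 ?_)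
          rw [norm_mul]
          exact mul_le_mul h2 (hϖ w).2.le (norm_nonneg _) zero_le_one
      _ = 2 := by norm_num
  let P : K[X] := Ψ.map (MvPolynomial.eval s)
  replace hPN : Irreducible (P.map (algebraMap K N)) := hPN
  have hP : Fact (Irreducible P) := ⟨irreducible_of_irreducible_map_field _ hPN⟩
  -- replacing `g_i` by `g_i + ϖ s_i` changes the constant coefficients only
  let c' : Fin d × Fin (D + 1) → K := fun z => c z + ϖ * if z.2 = 0 then s z.1 else 0
  have hc' : coeffPoly c' = fun i => g i + C (ϖ * s i) := by
    funext i
    simp only [coeffPoly, c', g, C_add, add_mul, Finset.sum_add_distrib]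
    congr 1
    rw [Finset.sum_eq_single 0]
    · simp
    · intro j _ hj
      simp [hj]
    · simp
  have hP' : P = evalPoly (coeffPoly c') X f := by
    rw [hc']
    exact map_eval_substPoly g ϖ s f
  -- roots of `P` in the local fields
  have hroot (w : ι) : ∃ y : Mw w, aeval y P = 0 ∧
      MvPolynomial.aeval (fun i => aeval y (coeffPoly c' i)) q ≠ 0 := by
    obtain ⟨y, hy, -, hq⟩ := hcU w (fun z => algebraMap K (Kw w) (if z.2 = 0 then s z.1 else 0))
      (fun z => by
        split_ifs
        · exact hs w _
        · simp)
    have h1 : (fun i => algebraMap K (Kw w) (c i) + algebraMap K (Kw w) ϖ *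
        algebraMap K (Kw w) (if i.2 = 0 then s i.1 else 0)) = algebraMap K (Kw w) ∘ c' := by
      funext z
      simp only [c', Function.comp_apply, map_add, map_mul]
    rw [h1] at hy hq
    refine ⟨y, ?_, ?_⟩
    · rw [← eval_map_algebraMap, hP', hmap]
      exact hy
    · convert hq using 3
      funext i
      rw [← eval_map_algebraMap, coeffPoly_map]
      congr 2
      funext z
      exact IsScalarTower.algebraMap_apply K (Kw w) (Mw w) _
  have hemb (w : ι) : ∃ j : AdjoinRoot P →ₐ[K] Mw w,
      MvPolynomial.aeval (fun i => aeval (j (AdjoinRoot.root P)) (coeffPoly c' i)) q ≠ 0 := by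
    obtain ⟨y, hy, hq⟩ := hroot w
    have hy' : P.eval₂ (Algebra.ofId K (Mw w) : K →+* Mw w) y = 0 := hy
    refine ⟨AdjoinRoot.liftAlgHom P (Algebra.ofId K _) y hy', ?_⟩
    rwa [AdjoinRoot.liftAlgHom_root]
  refine ⟨P, hP, ?_, fun w => ⟨(hemb w).choose⟩, fun i j => linearDisjoint_adjoinRoot N hPN i
    (hLN i) j⟩
  refine nonempty_algHom_of_evalPoly_eq_zero (τ := fun i => aeval (AdjoinRoot.root P)
    (coeffPoly c' i)) (r := AdjoinRoot.root P) hf hBq ?_ ?_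
  · have h1 : aeval (AdjoinRoot.root P) P = 0 := by
      rw [AdjoinRoot.aeval_eq, AdjoinRoot.mk_self]
    have h2 := map_evalPoly (coeffPoly c') X (aeval (R := K) (AdjoinRoot.root P)) f
    rw [← hP', h1, aeval_X] at h2
    exact h2.symm
  -- `q` does not vanish at the global point, since it does not vanish at the point over `Mw w₀`
  · obtain ⟨j, hj⟩ := hemb w₀
    intro h
    apply hj
    have h1 := congrArg j h
    rw [map_zero] at h1
    rw [← h1]
    refine Eq.trans ?_ (DFunLike.congr_fun (MvPolynomial.comp_aeval _ j) q).symm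
    congr 2
    funext i
    exact aeval_algHom_apply _ _ _

end Core

end LocGlob

/-! ### Density of points of smooth varieties over complete fields -/

namespace LocGlob

open Polynomial Topology

/-- A nonzero polynomial over a nontrivially normed field does not vanish on any open set. -/
theorem frequently_eval_ne_zero {M : Type*} [NontriviallyNormedField M] {σ : Type*} [Finite σ]
    {q : MvPolynomial σ M} (hq : q ≠ 0) (a : σ → M) :
    ∃ᶠ c in 𝓝 a, MvPolynomial.eval c q ≠ 0 := by
  intro h
  rw [nhds_pi, Filter.Eventually, Filter.mem_pi'] at h
  obtain ⟨I, s, hs, hsub⟩ := h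
  apply hq
  refine MvPolynomial.funext_set s (fun i => infinite_of_mem_nhds (a i) (hs i)) fun x hx => ?_
  simpa using hsub (fun i _ => hx i (Set.mem_univ i))

/-- A nonzero element of a standard étale domain over a domain `R` divides the image of a nonzero
element of `R`. -/
theorem exists_dvd_algebraMap_of_isStandardEtale {R S : Type*} [CommRing R] [IsDomain R]
    [CommRing S] [IsDomain S] [Algebra R S] (P : StandardEtalePresentation R S)
    {g : S} (hg : g ≠ 0) : ∃ q : R, q ≠ 0 ∧ g ∣ algebraMap R S q := by
  obtain ⟨p, n, h⟩ := P.exists_mul_aeval_x_g_pow_eq_aeval_x g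
  have hx : IsIntegral R P.x := ⟨P.f, P.monic_f, P.hasMap.1⟩
  have hv : IsIntegral R (aeval P.x p) :=
    adjoin_le_integralClosure hx (aeval_mem_adjoin_singleton R P.x)
  have h0 : aeval P.x p ≠ 0 := by
    rw [← h]
    exact mul_ne_zero hg (pow_ne_zero _ P.hasMap.2.ne_zero)
  obtain ⟨q, hq, hd⟩ := hv.isAlgebraic.exists_nonzero_dvd (mem_nonZeroDivisors_of_ne_zero h0)
  exact ⟨q, hq, (Dvd.intro _ h).trans hd⟩

open Algebra in
/-- On a smooth integral affine variety over `K`, the points with values in a complete field `M` are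
Zariski dense as soon as there is one. Near the given point the variety is étale over an affine
space; by `eventually_exists_root` the nearby points of the affine space lift, and they can be
chosen outside any given proper closed subset. -/
theorem exists_algHom_apply_ne_zero {K A M : Type*} [Field K] [CommRing A] [IsDomain A]
    [Algebra K A] [Algebra.Smooth K A] [NontriviallyNormedField M] [CompleteSpace M] [Algebra K M]
    (φ : A →ₐ[K] M) {g : A} (hg : g ≠ 0) : ∃ φ' : A →ₐ[K] M, φ' g ≠ 0 := by
  have : (RingHom.ker φ).IsPrime := RingHom.ker_isPrime φ
  obtain ⟨s, hs, n, _, _, _⟩ :=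
    IsSmoothAt.exists_isStandardEtale_mvPolynomial (R := K) (p := RingHom.ker φ)
  have hs0 : s ≠ 0 := by rintro rfl; exact hs (zero_mem _)
  set S := Localization.Away s
  set R := MvPolynomial (Fin n) K
  have hSd : IsDomain S := IsLocalization.isDomain_localization
    (powers_le_nonZeroDivisors_of_noZeroDivisors hs0)
  have hAS : Function.Injective (algebraMap A S) := IsLocalization.injective S
    (powers_le_nonZeroDivisors_of_noZeroDivisors hs0)
  obtain ⟨P⟩ := IsStandardEtale.nonempty_standardEtalePresentation (R := R) (S := S)
  -- it suffices to find a point near the given one whose image in affine space is not a zero of `q`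
  obtain ⟨q, hq, hdvd⟩ := exists_dvd_algebraMap_of_isStandardEtale P
    (show algebraMap A S g ≠ 0 by simpa using hAS.ne hg)
  have hu : IsUnit (φ s) := (show φ s ≠ 0 from hs).isUnit
  let ψ : S →ₐ[K] M := IsLocalization.Away.liftAlgHom s (f := φ) hu
  let a : Fin n → M := fun i => ψ (algebraMap R S (MvPolynomial.X i))
  let b : M := ψ P.x
  let ev : (Fin n → M) → R →ₐ[K] M := fun c => MvPolynomial.aeval c
  have hev : ψ.toRingHom.comp (algebraMap R S) = ev a := by
    exact congrArg AlgHom.toRingHom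
      (MvPolynomial.aeval_unique (ψ.comp (IsScalarTower.toAlgHom K (MvPolynomial (Fin n) K) S)))
  let T : R[X] → Polynomial (MvPolynomial (Fin n) M) :=
    Polynomial.map (MvPolynomial.map (algebraMap K M))
  have hT : ∀ c (p : R[X]), (T p).map (MvPolynomial.eval c) = p.map (ev c : R →+* M) := by
    intro c p
    simp only [T, Polynomial.map_map]
    congr 1
    refine MvPolynomial.ringHom_ext (fun x => ?_) fun i => ?_
    · exact Eq.trans (by simp) (MvPolynomial.aeval_C c x).symm
    · exact Eq.trans (by simp) (MvPolynomial.aeval_X c i).symm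
  have hb : ∀ p : R[X], (p.map (ev a : R →+* M)).eval b = ψ (aeval P.x p) := by
    intro p
    rw [← hev, eval_map, aeval_def, AlgHom.toRingHom_eq_coe, ← AlgHom.coe_toRingHom, hom_eval₂]
    rfl
  have h0 : ((T P.f).map (MvPolynomial.eval a)).eval b = 0 := by
    rw [hT, hb, P.hasMap.1, map_zero]
  have h1 : (derivative ((T P.f).map (MvPolynomial.eval a))).eval b ≠ 0 := by
    rw [hT, derivative_map, hb]
    exact (P.hasMap.isUnit_derivative_f.map ψ).ne_zero
  have h2 : ((T P.g).map (MvPolynomial.eval a)).eval b ≠ 0 := by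
    rw [hT, hb]
    exact (P.hasMap.2.map ψ).ne_zero
  have hq' : MvPolynomial.map (algebraMap K M) q ≠ 0 := by
    simpa using (MvPolynomial.map_injective (σ := Fin n) _ (algebraMap K M).injective).ne hq
  have hW : {z : (Fin n → M) × M | ((T P.g).map (MvPolynomial.eval z.1)).eval z.2 ≠ 0} ∈ 𝓝 (a, b) :=
    (isOpen_ne_fun (continuous_eval_map_eval (T P.g)) continuous_const).mem_nhds h2
  obtain ⟨c, hc, y, hyW, hy⟩ := ((frequently_eval_ne_zero hq' a).and_eventually
    (eventually_exists_root (T P.f) h0 h1 hW)).exists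
  rw [hT] at hy
  simp only [Set.mem_ofPred_eq, hT] at hyW
  let : Algebra R M := (ev c).toRingHom.toAlgebra
  have : IsScalarTower K R M := .of_algebraMap_eq fun x => ((ev c).commutes x).symm
  have hmap : P.HasMap y := by
    refine ⟨?_, Ne.isUnit ?_⟩
    · rw [aeval_def, ← eval_map]; exact hy
    · rw [aeval_def, ← eval_map]; exact hyW
  let χ : S →ₐ[R] M := (P.lift y hmap).comp P.equivRing.toAlgHom
  refine ⟨((χ.restrictScalars K).comp (IsScalarTower.toAlgHom K A S)), fun h => hc ?_⟩
  obtain ⟨d, hd⟩ := hdvd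
  have h3 : χ (algebraMap R S q) = 0 := by
    rw [hd, map_mul, show χ (algebraMap A S g) = 0 from h, zero_mul]
  rw [AlgHom.commutes] at h3
  rw [MvPolynomial.eval_map, ← MvPolynomial.aeval_def]
  exact h3

end LocGlob

/-! ### Affine charts -/

namespace LocGlob

open Polynomial Topology AlgebraicGeometry CategoryTheory Limits TensorProduct

section Charts

variable {K : Type u} [Field K] {Z : Scheme.{u}} (π : Z ⟶ Spec (.of K))

/-- Every point of a `K`-scheme lies in an affine chart `Spec B` with `B` a `K`-algebra. -/
theorem exists_affine_chart (x : Z) :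
    ∃ (B : Type u) (_ : CommRing B) (_ : Algebra K B) (i : Spec (.of B) ⟶ Z),
      IsOpenImmersion i ∧ i ≫ π = Spec.map (CommRingCat.ofHom (algebraMap K B)) ∧
        x ∈ Set.range i := by
  obtain ⟨B, i, hi, hx, -⟩ :=
    Scheme.exists_affine_mem_range_and_range_subset (X := Z) (x := x) (U := ⊤) trivial
  obtain ⟨f, hf⟩ := Spec.map_surjective (i ≫ π)
  let := f.hom.toAlgebra
  exact ⟨B, inferInstance, inferInstance, i, hi, hf.symm, hx⟩

variable {π} {B : Type u} [CommRing B] [Algebra K B] {i : Spec (.of B) ⟶ Z}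

theorem HasPoint.of_algHom
    (hi : i ≫ π = Spec.map (CommRingCat.ofHom (algebraMap K B))) {F : Type u} [Field F]
    [Algebra K F] (φ : B →ₐ[K] F) : HasPoint π F := by
  refine ⟨Spec.map (CommRingCat.ofHom φ.toRingHom) ≫ i, ?_⟩
  rw [Category.assoc, hi, ← Spec.map_comp, ← CommRingCat.ofHom_comp]
  exact congrArg _ (congrArg _ φ.comp_algebraMap)

/-- A field-valued point of `Z` whose image lies in an affine chart is a `K`-algebra morphism. -/
theorem exists_algHom_of_comp_eq
    (hi : i ≫ π = Spec.map (CommRingCat.ofHom (algebraMap K B))) {F : Type u} [Field F]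
    [Algebra K F] {t : Spec (.of F) ⟶ Spec (.of B)}
    (h : (t ≫ i) ≫ π = Spec.map (CommRingCat.ofHom (algebraMap K F))) :
    ∃ φ : B →ₐ[K] F, t = Spec.map (CommRingCat.ofHom φ.toRingHom) := by
  obtain ⟨f, rfl⟩ := Spec.map_surjective t
  rw [Category.assoc, hi, ← Spec.map_comp] at h
  have h1 := Spec.map_injective h
  refine ⟨{ f.hom with commutes' := fun x => ?_ }, rfl⟩
  exact congrArg (fun g => g.hom x) h1

theorem finiteType_of_chart [IsOpenImmersion i]
    (hi : i ≫ π = Spec.map (CommRingCat.ofHom (algebraMap K B)))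
    [LocallyOfFiniteType π] : Algebra.FiniteType K B := by
  have : LocallyOfFiniteType (i ≫ π) := inferInstance
  rw [hi, HasRingHomProperty.Spec_iff (P := @LocallyOfFiniteType)] at this
  exact RingHom.finiteType_algebraMap.1 this

theorem smooth_of_chart [IsOpenImmersion i]
    (hi : i ≫ π = Spec.map (CommRingCat.ofHom (algebraMap K B)))
    [Smooth π] : Algebra.Smooth K B := by
  have : Smooth (i ≫ π) := inferInstance
  rw [hi, HasRingHomProperty.Spec_iff (P := @Smooth)] at this
  exact RingHom.smooth_algebraMap.1 this

theorem isDomain_of_chart (i : Spec (.of B) ⟶ Z) [IsOpenImmersion i] [IsIntegral Z]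
    [Nontrivial B] : IsDomain B := by
  have := isIntegral_of_isOpenImmersion i
  exact (affine_isIntegral_iff (.of B)).1 this

/-- The coordinate ring of an affine chart of a geometrically integral scheme remains a domain
after any extension of the base field. -/
theorem isDomain_tensorProduct_of_chart [IsOpenImmersion i]
    (hi : i ≫ π = Spec.map (CommRingCat.ofHom (algebraMap K B)))
    [GeometricallyIntegral π] [Nontrivial B] (N : Type u)
    [Field N] [Algebra K N] : IsDomain (N ⊗[K] B) := by
  have hP : IsIntegral (pullback (Spec.map (CommRingCat.ofHom (algebraMap K N))) π) :=
    pullback_of_geometrically' GeometricallyIntegral.geometrically_isIntegral N _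
  have h1 := isPullback_SpecMap_of_isPushout _ _ _ _ (CommRingCat.isPushout_tensorProduct K N B)
  rw [← hi] at h1
  let l := pullback.lift _ _ (h1.w.trans (Category.assoc _ _ _).symm)
  have h2 : IsPullback l
      (Spec.map (CommRingCat.ofHom Algebra.TensorProduct.includeRight.toRingHom))
      (pullback.snd (Spec.map (CommRingCat.ofHom (algebraMap K N))) π) i := by
    refine .of_right (h₁₂ := pullback.fst _ _) ?_ (pullback.lift_snd _ _ _)
      (IsPullback.of_hasPullback (Spec.map (CommRingCat.ofHom (algebraMap K N))) π)
    rw [pullback.lift_fst]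
    exact h1
  have : IsOpenImmersion l := MorphismProperty.of_isPullback h2.flip ‹_›
  have := isIntegral_of_isOpenImmersion l
  exact (affine_isIntegral_iff (.of (N ⊗[K] B))).1 this

/-- A smooth integral `K`-scheme with a point over a complete field `M` has such points in every
affine chart `Spec B`, outside the zero locus of any nonzero `q ∈ B`. -/
theorem exists_algHom_apply_ne_zero_of_hasPoint [IsOpenImmersion i]
    (hi : i ≫ π = Spec.map (CommRingCat.ofHom (algebraMap K B)))
    [IsIntegral Z] [Smooth π] {M : Type u}
    [NontriviallyNormedField M] [CompleteSpace M] [Algebra K M] (hM : HasPoint π M) [IsDomain B]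
    {q : B} (hq : q ≠ 0) : ∃ φ : B →ₐ[K] M, φ q ≠ 0 := by
  obtain ⟨s, hs⟩ := hM
  let pt : Spec (.of M) := (⊥ : PrimeSpectrum M)
  obtain ⟨A, _, _, j, hj, hjπ, hx⟩ := exists_affine_chart π (s pt)
  have hA : Algebra.Smooth K A := smooth_of_chart hjπ
  have hrange {X : Scheme.{u}} (t : Spec (.of M) ⟶ X) {Y : Set X} (h : t pt ∈ Y) :
      Set.range t ⊆ Y := by
    rintro _ ⟨y, rfl⟩
    rwa [Subsingleton.elim y pt]
  obtain ⟨φ, hφ⟩ := exists_algHom_of_comp_eq (B := A) hjπ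
    (t := IsOpenImmersion.lift j s (hrange s hx)) (by rw [IsOpenImmersion.lift_fac, hs])
  have : Nontrivial A := φ.toRingHom.domain_nontrivial
  have : IsDomain A := isDomain_of_chart j
  -- the open subset `D(q)` of `Z` meets the chart `Spec A`
  let D : Z.Opens := i ''ᵁ (PrimeSpectrum.basicOpen q)
  have hD : (D : Set Z).Nonempty :=
    ⟨_, (⊥ : PrimeSpectrum B), show q ∉ (⊥ : Ideal B) from hq, rfl⟩
  obtain ⟨_, hzD, z, rfl⟩ := nonempty_preirreducible_inter D.2 hj.base_open.isOpen_range hD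
    ⟨_, hx⟩
  obtain ⟨_, ⟨g, rfl⟩, hzg, hgD⟩ :=
    PrimeSpectrum.isTopologicalBasis_basic_opens.exists_subset_of_mem_open
      (show z ∈ (j ⁻¹ᵁ D : Set (Spec (.of A))) from hzD) (j ⁻¹ᵁ D).2
  have hg : g ≠ 0 := by
    rintro rfl
    exact (show (0 : A) ∉ PrimeSpectrum.asIdeal z from hzg) (zero_mem _)
  obtain ⟨φ', hφ'⟩ := exists_algHom_apply_ne_zero φ hg
  let s' : Spec (.of M) ⟶ Z := Spec.map (CommRingCat.ofHom φ'.toRingHom) ≫ j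
  have hs' : s' pt ∈ D := hgD (show φ' g ∉ (⊥ : Ideal M) from hφ')
  have hsi : s' pt ∈ Set.range i := by
    obtain ⟨y, -, hy⟩ := hs'
    exact ⟨y, hy⟩
  obtain ⟨ψ, hψ⟩ := exists_algHom_of_comp_eq hi (t := IsOpenImmersion.lift i s' (hrange s' hsi)) (by
    rw [IsOpenImmersion.lift_fac, Category.assoc, hjπ, ← Spec.map_comp, ← CommRingCat.ofHom_comp]
    exact congrArg _ (congrArg _ φ'.comp_algebraMap))
  obtain ⟨y, hyq, hy⟩ := hs'
  have h1 : i (Spec.map (CommRingCat.ofHom ψ.toRingHom) pt) = s' pt := by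
    rw [← hψ, ← Scheme.Hom.comp_apply, IsOpenImmersion.lift_fac]
  rw [← hy] at h1
  rw [← i.isOpenEmbedding.injective h1] at hyq
  exact ⟨ψ, hyq⟩

end Charts

end LocGlob

/-! ### Schemes over completely valued fields -/

namespace LocGlob

open Polynomial Topology AlgebraicGeometry CategoryTheory TensorProduct

/-- Weak approximation for a field with dense embeddings into finitely many nontrivially normed
fields, the norms being pairwise inequivalent on it. -/
theorem denseRange_pi_of_dense {K : Type*} [Field K] {ι : Type*} [Finite ι] {Kw : ι → Type*}
    [∀ w, NontriviallyNormedField (Kw w)] [∀ w, Algebra K (Kw w)]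
    (hd : ∀ w, DenseRange (algebraMap K (Kw w)))
    (hne : ∀ w w', w ≠ w' → ∃ x : K, ‖algebraMap K (Kw w) x‖ < 1 ∧ 1 ≤ ‖algebraMap K (Kw w') x‖) :
    DenseRange fun (x : K) w => algebraMap K (Kw w) x := by
  let v : ∀ w, AbsoluteValue K ℝ := fun w =>
    (NormedField.toAbsoluteValue (Kw w)).comp (algebraMap K (Kw w)).injective
  have hv : ∀ w x, v w x = ‖algebraMap K (Kw w) x‖ := fun w x => rfl
  have h1 : ∀ w, (v w).IsNontrivial := by
    intro w
    obtain ⟨y, hy⟩ := NormedField.exists_one_lt_norm (Kw w)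
    obtain ⟨x, hx⟩ := (hd w).exists_mem_open (isOpen_lt continuous_const continuous_norm) ⟨y, hy⟩
    have hx : 1 < ‖algebraMap K (Kw w) x‖ := hx
    refine ⟨x, ?_, by rw [hv]; exact hx.ne'⟩
    rintro rfl
    rw [map_zero, norm_zero] at hx
    exact hx.not_gt zero_lt_one
  have h2 : Pairwise fun i j => ¬ (v i).IsEquiv (v j) := by
    intro i j hij h
    obtain ⟨x, hx, hx'⟩ := hne i j hij
    exact hx'.not_gt (h.lt_one_iff.1 hx)
  have h3 := AbsoluteValue.denseRange_algebraMap_pi h1 h2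
  have h4 : ∀ w, Continuous fun x : WithAbs (v w) => algebraMap K (Kw w) (WithAbs.equiv _ x) := by
    intro w
    refine (AddMonoidHomClass.isometry_of_norm
      ((algebraMap K (Kw w)).comp (WithAbs.equiv (v w)).toRingHom) fun x => ?_).continuous
    rfl
  have h5 : ∀ w, DenseRange fun x : WithAbs (v w) => algebraMap K (Kw w) (WithAbs.equiv _ x) := by
    intro w
    have := (WithAbs.equiv (v w)).surjective.range_comp (algebraMap K (Kw w))
    exact (congrArg Dense this).mpr (hd w)
  exact (DenseRange.piMap h5).comp h3 (.piMap h4)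

open WithZero in
/-- The form of `exists_extension_of_local_points` for schemes and for complete fields with discrete
valuations. The finite extensions `Mw w` carry the spectral norm, for which they are complete. -/
theorem exists_extension_of_hasPoint {k K : Type u} [Field k] [CharZero k] [Field K] [Algebra k K]
    (hk : Cardinal.aleph0 < Cardinal.mk k)
    (hK : ∀ x : K, Transcendental k x → FiniteDimensional (IntermediateField.adjoin k {x}) K)
    {Z : Scheme.{u}} {π : Z ⟶ Spec (.of K)} [LocallyOfFiniteType π] [Smooth π]
    [GeometricallyIntegral π]
    {ι : Type*} [Finite ι] [Nonempty ι] {Kw Mw : ι → Type u}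
    [∀ w, Field (Kw w)] [∀ w, Valued (Kw w) ℤᵐ⁰] [∀ w, CompleteSpace (Kw w)]
    [∀ w, (Valued.v : Valuation (Kw w) ℤᵐ⁰).IsNontrivial] [∀ w, Algebra K (Kw w)]
    (hd : ∀ w, DenseRange (algebraMap K (Kw w)))
    (hne : ∀ w w', w ≠ w' → ∃ x : K, (Valued.v (algebraMap K (Kw w) x) : ℤᵐ⁰) < 1 ∧
      (1 : ℤᵐ⁰) ≤ Valued.v (algebraMap K (Kw w') x))
    (hconst : ∀ w (x : K), IsAlgebraic k x → (Valued.v (algebraMap K (Kw w) x) : ℤᵐ⁰) ≤ 1)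
    [∀ w, Field (Mw w)] [∀ w, Algebra (Kw w) (Mw w)] [∀ w, FiniteDimensional (Kw w) (Mw w)]
    [∀ w, Algebra K (Mw w)] [∀ w, IsScalarTower K (Kw w) (Mw w)]
    (hpt : ∀ w, HasPoint π (Mw w))
    (L : Type*) [Field L] [Algebra K L] [FiniteDimensional K L] :
    ∃ (M : Type u) (_ : Field M) (_ : Algebra K M), FiniteDimensional K M ∧ HasPoint π M ∧
      (∀ w, Nonempty (M →ₐ[K] Mw w)) ∧ LinearlyDisjoint K L M := by
  have : IsIntegral Z := GeometricallyIntegral.isIntegral_of_subsingleton π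
  obtain ⟨z⟩ := (inferInstance : Nonempty Z)
  obtain ⟨B, _, _, i, hi, hiπ, z', -⟩ := exists_affine_chart π z
  have : Nontrivial B := PrimeSpectrum.nontrivial z'
  have : IsDomain B := isDomain_of_chart i
  have : Algebra.FiniteType K B := finiteType_of_chart hiπ
  let (w : ι) : (Valued.v : Valuation (Kw w) ℤᵐ⁰).RankOne :=
    (Valuation.nonempty_rankOne_iff_mulArchimedean.2 inferInstance).some
  let (w : ι) : NontriviallyNormedField (Kw w) := Valued.toNontriviallyNormedField _ ℤᵐ⁰
  have (w : ι) : IsUltrametricDist (Kw w) := inferInstance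
  let (w : ι) : NontriviallyNormedField (Mw w) := spectralNorm.nontriviallyNormedField (Kw w) (Mw w)
  let (w : ι) : NormedAlgebra (Kw w) (Mw w) := spectralNorm.normedAlgebra (Kw w) (Mw w)
  have (w : ι) : CompleteSpace (Mw w) := spectralNorm.completeSpace (Kw w) (Mw w)
  have hdense := denseRange_pi_of_dense hd fun w w' h => by
    obtain ⟨x, hx, hx'⟩ := hne w w' h
    exact ⟨x, Valued.toNormedField.norm_lt_one_iff.2 hx, Valued.toNormedField.one_le_norm_iff.2 hx'⟩
  obtain ⟨P, hP, ⟨φ⟩, hM, hdisj⟩ := exists_extension_of_local_points (Mw := Mw) hk hK hdense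
    (fun w x hx => Valued.toNormedField.norm_le_one_iff.2 (hconst w x hx)) (B := B)
    (fun N _ => isDomain_tensorProduct_of_chart hiπ N)
    (fun w q hq => exists_algHom_apply_ne_zero_of_hasPoint hiπ (hpt w) hq) L
  have : Module.Finite K (AdjoinRoot P) := (AdjoinRoot.powerBasis hP.out.ne_zero).finite
  exact ⟨AdjoinRoot P, inferInstance, inferInstance, inferInstance, .of_algHom hiπ φ, hM, hdisj⟩

/-! ### Function fields of transcendence degree one -/

/-- The fraction field of a standard smooth domain of relative dimension one has transcendence
degree at most one: it is finite over `k(t)` for an étale coordinate `t`. -/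
theorem trdeg_le_one_of_isStandardSmooth {k A K : Type u} [Field k] [CommRing A] [IsDomain A]
    [Algebra k A] [Algebra.IsStandardSmoothOfRelativeDimension 1 k A] [Field K] [Algebra A K]
    [IsFractionRing A K] [Algebra k K] [IsScalarTower k A K] : Algebra.trdeg k K ≤ 1 := by
  obtain ⟨g, hg⟩ := Algebra.IsStandardSmoothOfRelativeDimension.exists_etale_mvPolynomial 1 k A
  let R := MvPolynomial (Fin 1) k
  let : Algebra R A := g.toRingHom.toAlgebra
  have : Algebra.Etale R A := hg
  have : IsScalarTower k R A := .of_algebraMap_eq' g.comp_algebraMap.symm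
  let : Algebra R K := ((algebraMap A K).comp (algebraMap R A)).toAlgebra
  have : IsScalarTower R A K := .of_algebraMap_eq' rfl
  have : IsScalarTower k R K := .to₁₂₄ k R A K
  have : FaithfulSMul R A := inferInstance
  have : FaithfulSMul R K := .trans R A K
  let F := FractionRing R
  let : Algebra F K := FractionRing.liftAlgebra R K
  have : IsScalarTower R F K := FractionRing.isScalarTower_liftAlgebra R K
  have : Algebra.FormallyEtale A K := .of_isLocalization (nonZeroDivisors A)
  have : Algebra.FormallyEtale R K := .comp R A K
  have : Algebra.FormallyUnramified F K := .of_restrictScalars R F K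
  have : Algebra.EssFiniteType A K := .of_isLocalization _ (nonZeroDivisors A)
  have : Algebra.EssFiniteType R K := .comp R A K
  have : Algebra.EssFiniteType F K := .of_comp R F K
  have : Module.Finite F K := Algebra.FormallyUnramified.finite_of_free F K
  have : Algebra.IsAlgebraic R F := IsLocalization.isAlgebraic F (nonZeroDivisors R)
  have : Algebra.IsAlgebraic R K := .trans R F K
  rw [← trdeg_add_eq k R (A := K), MvPolynomial.trdeg_of_isDomain,
    trdeg_eq_zero]
  simp

theorem finiteDimensional_adjoin_of_trdeg_le_one {k K : Type u} [Field k] [Field K] [Algebra k K]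
    [Algebra.EssFiniteType k K] (h : Algebra.trdeg k K ≤ 1) {x : K} (hx : Transcendental k x) :
    FiniteDimensional (IntermediateField.adjoin k {x}) K := by
  have h1 : AlgebraicIndependent k fun _ : PUnit.{u + 1} => x :=
    (algebraicIndependent_unique_type_iff).2 hx
  have h2 := h1.isTranscendenceBasis_of_trdeg_le_of_finite (by simpa using h)
  have := h2.isAlgebraic_field
  rw [Set.range_const] at this
  have : Algebra.EssFiniteType (IntermediateField.adjoin k {x}) K := .of_comp k _ K
  exact finiteDimensional_of_essFiniteType _ _

/-- If the structure morphism `Spec A ⟶ Spec k` is smooth of relative dimension one, the fraction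
field of `A` is a function field of transcendence degree one over `k`: it is finite over `k(x)` for
each transcendental `x`. -/
theorem finiteDimensional_adjoin_of_smoothOfRelativeDimension_one {k A K : Type u} [Field k]
    [CommRing A] [IsDomain A] [Algebra k A]
    (h : SmoothOfRelativeDimension 1 (Spec.map (CommRingCat.ofHom (algebraMap k A)))) [Field K]
    [Algebra A K] [IsFractionRing A K] [Algebra k K] [IsScalarTower k A K] {x : K}
    (hx : Transcendental k x) : FiniteDimensional (IntermediateField.adjoin k {x}) K := by
  rw [HasRingHomProperty.Spec_iff (P := @SmoothOfRelativeDimension 1)] at h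
  obtain ⟨s, hs, hsm⟩ := h
  obtain ⟨t, hts, ht⟩ : ∃ t ∈ s, t ≠ 0 := by
    by_contra! h0
    exact one_ne_zero ((Ideal.span_eq_bot.2 h0 ▸ hs ▸ Submodule.mem_top : (1 : A) ∈ (⊥ : Ideal A)))
  have hst : Algebra.IsStandardSmoothOfRelativeDimension 1 k (Localization.Away t) := by
    rw [← RingHom.isStandardSmoothOfRelativeDimension_algebraMap]
    exact hsm t hts
  have hM := powers_le_nonZeroDivisors_of_noZeroDivisors ht
  have : IsDomain (Localization.Away t) := IsLocalization.isDomain_localization hM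
  let : Algebra (Localization.Away t) K := (IsLocalization.Away.lift t (g := algebraMap A K)
    ((map_ne_zero_iff _ (IsFractionRing.injective A K)).2 ht).isUnit).toAlgebra
  have : IsScalarTower A (Localization.Away t) K :=
    .of_algebraMap_eq' (IsLocalization.Away.lift_comp t _).symm
  have : IsScalarTower k (Localization.Away t) K := .to₁₃₄ k A (Localization.Away t) K
  have : IsFractionRing (Localization.Away t) K :=
    .isFractionRing_of_isDomain_of_isLocalization (.powers t) _ _
  have := Algebra.IsStandardSmoothOfRelativeDimension.isStandardSmooth (R := k)
    (S := Localization.Away t) 1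
  have : Algebra.EssFiniteType (Localization.Away t) K :=
    .of_isLocalization _ (nonZeroDivisors (Localization.Away t))
  have : Algebra.EssFiniteType k K := .comp k (Localization.Away t) K
  exact finiteDimensional_adjoin_of_trdeg_le_one
    (trdeg_le_one_of_isStandardSmooth (A := Localization.Away t)) hx

/-! ### Closed points and valuations of a curve -/

theorem ringHom_eq_of_SpecMap_eq {A B : Type u} [CommRing A] [CommRing B] {f g : A →+* B}
    (h : Spec.map (CommRingCat.ofHom f) = Spec.map (CommRingCat.ofHom g)) : f = g :=
  congrArg CommRingCat.Hom.hom (Spec.map_injective h)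

/-- The uniqueness part of the valuative criterion: two morphisms from the spectrum of a valuation
ring to a separated scheme agree if they agree at the generic point. -/
theorem eq_of_SpecMap_algebraMap_comp_eq {X Y : Scheme.{u}} (f : X ⟶ Y) [IsSeparated f]
    (R K : Type u) [CommRing R] [IsDomain R] [ValuationRing R] [Field K] [Algebra R K]
    [IsFractionRing R K] {l₁ l₂ : Spec (.of R) ⟶ X}
    (h : Spec.map (CommRingCat.ofHom (algebraMap R K)) ≫ l₁ =
      Spec.map (CommRingCat.ofHom (algebraMap R K)) ≫ l₂)
    (hf : l₁ ≫ f = l₂ ≫ f) : l₁ = l₂ := by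
  let S : ValuativeCommSq f :=
    { R := R
      K := K
      i₁ := Spec.map (CommRingCat.ofHom (algebraMap R K)) ≫ l₁
      i₂ := l₁ ≫ f
      commSq := ⟨Category.assoc _ _ _⟩ }
  have := IsSeparated.valuativeCriterion f S
  let t₁ : S.commSq.LiftStruct := ⟨l₁, rfl, rfl⟩
  let t₂ : S.commSq.LiftStruct := ⟨l₂, h.symm, hf.symm⟩
  exact congrArg CommSq.LiftStruct.l (Subsingleton.elim t₁ t₂)

namespace SmoothProjectiveCurve

variable {k : Type u} [Field k] (C : SmoothProjectiveCurve k)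

/-- The constants `k → 𝒪_{C,x}` in the local ring of a curve at a point. -/
noncomputable def const (x : C.carrier) : k →+* C.carrier.presheaf.stalk x :=
  (Spec.preimage (C.carrier.fromSpecStalk x ≫ C.hom)).hom

theorem map_const (x : C.carrier) : Spec.map (CommRingCat.ofHom (C.const x)) =
    C.carrier.fromSpecStalk x ≫ C.hom :=
  Spec.map_preimage _

theorem algebraMap_comp_const (x : C.carrier) :
    (algebraMap (C.carrier.presheaf.stalk x) C.functionField).comp (C.const x) =
      C.const (genericPoint C.carrier) := by
  refine ringHom_eq_of_SpecMap_eq (Eq.trans ?_ (C.map_const _).symm)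
  refine (Spec.map_comp (CommRingCat.ofHom (C.const x)) (CommRingCat.ofHom
    (algebraMap (C.carrier.presheaf.stalk x) C.functionField))).trans ?_
  rw [map_const, ← Category.assoc]
  exact congrArg (· ≫ C.hom) (Scheme.SpecMap_stalkSpecializes_fromSpecStalk
    ((genericPoint_spec C.carrier).specializes trivial))

theorem isSeparated_hom : IsSeparated C.hom := by
  obtain ⟨n, i, hi, h⟩ := C.projective
  rw [← h, projectiveSpaceHom]
  infer_instance

theorem nonempty_closedPoint : Nonempty C.ClosedPoint := by
  have : Smooth C.hom := SmoothOfRelativeDimension.smooth 1 C.hom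
  have : JacobsonSpace C.carrier := LocallyOfFiniteType.jacobsonSpace C.hom
  by_contra h
  have h1 := closure_inter_closedPoints (X := C.carrier) isClosed_univ
  rw [Set.univ_inter, Set.isEmpty_coe_sort.1 (not_nonempty_iff.1 h), closure_empty] at h1
  exact Set.empty_ne_univ h1

/-- By the valuative criterion of separatedness, distinct closed points of a curve have
incomparable local rings. -/
theorem eq_of_localRing_le [CharZero k] {w w' : C.ClosedPoint}
    (f : localRing w' →+* localRing w)
    (hf : (algebraMap (localRing w) C.functionField).comp f =
      algebraMap (localRing w') C.functionField) : w = w' := by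
  have := C.isSeparated_hom
  have hfc : f.comp (C.const w') = C.const w := by
    refine RingHom.ext fun x => IsFractionRing.injective (localRing w) C.functionField ?_
    have h1 := C.algebraMap_comp_const w'
    rw [← hf, ← C.algebraMap_comp_const w] at h1
    exact congrArg (fun g => g x) h1
  have hgen (v : C.ClosedPoint) :
      Spec.map (CommRingCat.ofHom (algebraMap (localRing v) C.functionField)) ≫
        C.carrier.fromSpecStalk v = C.carrier.fromSpecStalk (genericPoint C.carrier) :=
    Scheme.SpecMap_stalkSpecializes_fromSpecStalk
      ((genericPoint_spec C.carrier).specializes trivial)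
  have h1 : C.carrier.fromSpecStalk w =
      Spec.map (CommRingCat.ofHom f) ≫ C.carrier.fromSpecStalk w' := by
    refine eq_of_SpecMap_algebraMap_comp_eq C.hom (localRing w) C.functionField ?_ ?_
    · refine (hgen w).trans ((hgen w').symm.trans ?_)
      rw [← hf]
      refine (congrArg (· ≫ _) (Spec.map_comp (CommRingCat.ofHom f) (CommRingCat.ofHom
        (algebraMap (localRing w) C.functionField)))).trans (Category.assoc _ _ _)
    · refine (C.map_const w).symm.trans ?_
      rw [← hfc]
      refine (Spec.map_comp (CommRingCat.ofHom (C.const w')) (CommRingCat.ofHom f)).trans ?_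
      rw [C.map_const]
      exact (Category.assoc _ _ _).symm
  have h2 : (w : C.carrier) ∈ Set.range (C.carrier.fromSpecStalk w') :=
    ⟨Spec.map (CommRingCat.ofHom f) (IsLocalRing.closedPoint (localRing w)),
      (congrArg (fun g : Spec (.of (localRing w)) ⟶ C.carrier =>
        g (IsLocalRing.closedPoint (localRing w))) h1.symm).trans Scheme.fromSpecStalk_closedPoint⟩
  rw [Scheme.range_fromSpecStalk] at h2
  have h3 := h2.mem_closed (IsClosed.closure_eq w.2 ▸ isClosed_closure) (Set.mem_singleton _)
  exact Subtype.ext h3.symm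

open WithZero in
theorem valued_algebraMap [CharZero k] (w : C.ClosedPoint) (x : C.functionField) :
    (Valued.v (algebraMap C.functionField (completion w) x) : ℤᵐ⁰) =
      (IsDiscreteValuationRing.maximalIdeal (localRing w)).valuation C.functionField x :=
  IsDedekindDomain.HeightOneSpectrum.adicCompletion.valued_coe _ _ x

/-- The valuations at distinct closed points are inequivalent on the function field. -/
theorem exists_valuation_lt_one [CharZero k] {w w' : C.ClosedPoint} (h : w ≠ w') :
    ∃ x : C.functionField,
      (IsDiscreteValuationRing.maximalIdeal (localRing w)).valuation C.functionField x < 1 ∧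
      1 ≤ (IsDiscreteValuationRing.maximalIdeal (localRing w')).valuation C.functionField x := by
  by_contra! hlt
  apply h
  have hinj := IsFractionRing.injective (localRing w) C.functionField
  have hmem (x : localRing w') : ∃ y : localRing w,
      algebraMap (localRing w) C.functionField y = algebraMap (localRing w') C.functionField x := by
    -- if `x` had a pole at `w`, then `x⁻¹` would be small at `w`, hence at `w'`
    apply IsDiscreteValuationRing.exists_lift_of_le_one
    by_contra! hx
    have h1 := hlt (algebraMap (localRing w') C.functionField x)⁻¹ (by
      rw [map_inv₀]; exact inv_lt_one_of_one_lt₀ hx)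
    rw [map_inv₀] at h1
    have h2 := (IsDiscreteValuationRing.maximalIdeal (localRing w')).valuation_le_one
      (K := C.functionField) x
    have h3 : algebraMap (localRing w') C.functionField x ≠ 0 := by
      rintro h0
      rw [h0, map_zero] at hx
      exact not_lt_zero hx
    exact h1.not_ge ((one_le_inv₀ (zero_lt_iff.2 ((Valuation.ne_zero_iff _).2 h3))).2 h2)
  choose f hf using hmem
  refine C.eq_of_localRing_le
    { toFun := f
      map_one' := hinj (by rw [hf, map_one, map_one])
      map_mul' := fun x y => hinj (by rw [hf, map_mul, map_mul, hf, hf])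
      map_zero' := hinj (by rw [hf, map_zero, map_zero])
      map_add' := fun x y => hinj (by rw [hf, map_add, map_add, hf, hf]) } (RingHom.ext hf)

/-- The constants of the function field, and the elements algebraic over them, are integral at
each closed point. -/
theorem valuation_le_one_of_isAlgebraic [CharZero k] (w : C.ClosedPoint) {x : C.functionField}
    (hx : letI := (C.const (genericPoint C.carrier)).toAlgebra; IsAlgebraic k x) :
    (IsDiscreteValuationRing.maximalIdeal (localRing w)).valuation C.functionField x ≤ 1 := by
  let := (C.const (genericPoint C.carrier)).toAlgebra
  let := (C.const w).toAlgebra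
  have : IsScalarTower k (localRing w) C.functionField :=
    .of_algebraMap_eq' (C.algebraMap_comp_const w).symm
  have h1 : IsIntegral (localRing w) x := (isAlgebraic_iff_isIntegral.1 hx).tower_top
  obtain ⟨y, rfl⟩ := IsIntegrallyClosed.isIntegral_iff.1 h1
  exact (IsDiscreteValuationRing.maximalIdeal (localRing w)).valuation_le_one y

/-- The function field of a curve is finite over `k(x)` for every `x` transcendental over the field
`k` of constants. -/
theorem finiteDimensional_adjoin {x : C.functionField}
    (hx : letI := (C.const (genericPoint C.carrier)).toAlgebra; Transcendental k x) :
    letI := (C.const (genericPoint C.carrier)).toAlgebra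
    FiniteDimensional (IntermediateField.adjoin k {x}) C.functionField := by
  let := (C.const (genericPoint C.carrier)).toAlgebra
  obtain ⟨U, hU, hx', -⟩ := exists_isAffineOpen_mem_and_subset (X := C.carrier)
    (x := genericPoint C.carrier) (U := ⊤) trivial
  have : Nonempty U := ⟨⟨_, hx'⟩⟩
  obtain ⟨f, hf⟩ := Spec.map_surjective (hU.fromSpec ≫ C.hom)
  let : Algebra k Γ(C.carrier, U) := f.hom.toAlgebra
  have hs : SmoothOfRelativeDimension 1
      (Spec.map (CommRingCat.ofHom (algebraMap k Γ(C.carrier, U)))) := by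
    have : SmoothOfRelativeDimension (0 + 1) (hU.fromSpec ≫ C.hom) := inferInstance
    rw [← hf] at this
    exact this
  have := functionField_isFractionRing_of_isAffineOpen C.carrier U hU
  have : IsScalarTower k Γ(C.carrier, U) C.functionField := by
    refine .of_algebraMap_eq' ?_
    refine ringHom_eq_of_SpecMap_eq ((C.map_const _).trans ?_)
    refine Eq.trans ?_ (Spec.map_comp f (C.carrier.presheaf.germ U _ hx')).symm
    rw [hf, ← hU.fromSpecStalk_eq_fromSpecStalk hx', IsAffineOpen.fromSpecStalk, Category.assoc]
  exact finiteDimensional_adjoin_of_smoothOfRelativeDimension_one hs hx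

end SmoothProjectiveCurve

/-! ### Extensions of the function field of a curve -/

/-- By the Nullstellensatz, a nonempty scheme locally of finite type over `K` acquires a point over
a finite extension of any given extension `F` of `K`. -/
theorem exists_finiteDimensional_hasPoint {K : Type u} [Field K] {Z : Scheme.{u}} [Nonempty Z]
    (π : Z ⟶ Spec (.of K)) [LocallyOfFiniteType π] (F : Type u) [Field F] [Algebra K F] :
    ∃ (M : Type u) (_ : Field M) (_ : Algebra F M) (_ : Algebra K M),
      IsScalarTower K F M ∧ FiniteDimensional F M ∧ HasPoint π M := by
  obtain ⟨z⟩ := (inferInstance : Nonempty Z)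
  obtain ⟨B, _, _, i, hi, hiπ, z', -⟩ := exists_affine_chart π z
  have : Nontrivial B := PrimeSpectrum.nontrivial z'
  have : Algebra.FiniteType K B := finiteType_of_chart hiπ
  obtain ⟨m, hm⟩ := Ideal.exists_maximal (F ⊗[K] B)
  let : Field ((F ⊗[K] B) ⧸ m) := Ideal.Quotient.field m
  have : Algebra.FiniteType F ((F ⊗[K] B) ⧸ m) :=
    .of_surjective (Ideal.Quotient.mkₐ F m) (Ideal.Quotient.mkₐ_surjective F m)
  exact ⟨(F ⊗[K] B) ⧸ m, inferInstance, inferInstance, inferInstance, inferInstance,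
    finite_of_finite_type_of_isJacobsonRing F _,
    .of_algHom hiπ ((Ideal.Quotient.mkₐ K m).comp Algebra.TensorProduct.includeRight)⟩

theorem aleph0_lt_mk_of_algebra_padic (p : ℕ) [Fact p.Prime] (k : Type u) [Field k]
    [Algebra ℚ_[p] k] : Cardinal.aleph0 < Cardinal.mk k := by
  have h1 := (continuum_le_cardinal_of_nontriviallyNormedField ℚ_[p])
  have h2 := Cardinal.lift_mk_le_lift_mk_of_injective (algebraMap ℚ_[p] k).injective
  have h3 := (Cardinal.lift_le.{u}.2 h1).trans h2
  rw [Cardinal.lift_continuum, Cardinal.lift_uzero] at h3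
  exact Cardinal.aleph0_lt_continuum.trans_le h3

/-- The existence of the extension for a finite nonempty family of distinct closed points of a curve
over an uncountable field of characteristic zero. -/
theorem SmoothProjectiveCurve.exists_extension_of_family {k : Type u} [Field k] [CharZero k]
    (hk : Cardinal.aleph0 < Cardinal.mk k) (C : SmoothProjectiveCurve k)
    {Z : Scheme.{u}} (π : Z ⟶ Spec (.of C.functionField)) [LocallyOfFiniteType π] [Smooth π]
    [GeometricallyIntegral π] {ι : Type*} [Finite ι] [Nonempty ι] {pt : ι → C.ClosedPoint}
    (hpt : Function.Injective pt) (L : Type*) [Field L] [Algebra C.functionField L]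
    [FiniteDimensional C.functionField L] (Mloc : ι → Type u) [∀ w, Field (Mloc w)]
    [∀ w, Algebra (completion (pt w)) (Mloc w)]
    [∀ w, FiniteDimensional (completion (pt w)) (Mloc w)]
    [∀ w, Algebra C.functionField (Mloc w)]
    [∀ w, IsScalarTower C.functionField (completion (pt w)) (Mloc w)]
    (hM : ∀ w, HasPoint π (Mloc w)) :
    ∃ (M : Type u) (_ : Field M) (_ : Algebra C.functionField M),
      FiniteDimensional C.functionField M ∧ HasPoint π M ∧
      (∀ w, Nonempty (M →ₐ[C.functionField] Mloc w)) ∧ LinearlyDisjoint C.functionField L M := by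
  let : Algebra k C.functionField := (C.const (genericPoint C.carrier)).toAlgebra
  have (w : ι) : (Valued.v : Valuation (completion (pt w)) _).IsNontrivial := by
    obtain ⟨x, hx, hx'⟩ := Valuation.IsNontrivial.exists_val_nontrivial
      (v := (IsDiscreteValuationRing.maximalIdeal (localRing (pt w))).valuation C.functionField)
    exact ⟨algebraMap _ _ x, by rwa [C.valued_algebraMap], by rwa [C.valued_algebraMap]⟩
  refine exists_extension_of_hasPoint (k := k) hk (fun x hx => C.finiteDimensional_adjoin hx)
    (Kw := fun w => completion (pt w)) (Mw := Mloc)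
    (fun w => IsDedekindDomain.HeightOneSpectrum.denseRange_algebraMap _ _) (fun w w' h => ?_)
    (fun w x hx => ?_) hM L
  · obtain ⟨x, hx, hx'⟩ := C.exists_valuation_lt_one (hpt.ne h)
    exact ⟨x, by rwa [C.valued_algebraMap], by rwa [C.valued_algebraMap]⟩
  · rw [C.valued_algebraMap]
    exact C.valuation_le_one_of_isAlgebraic _ hx

end LocGlob

theorem mainTheorem11
    (p : ℕ) [Fact p.Prime]
    (k : Type u) [Field k] [CharZero k] [Algebra ℚ_[p] k] [FiniteDimensional ℚ_[p] k]
    (C : LocGlob.SmoothProjectiveCurve k)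
    (Z : AlgebraicGeometry.Scheme.{u})
    (π : Z ⟶ AlgebraicGeometry.Spec (.of C.functionField))
    (hZ : LocGlob.IsVariety π)
    (hZ_smooth : AlgebraicGeometry.Smooth π)
    (hZ_int : AlgebraicGeometry.GeometricallyIntegral π)
    (T : Finset C.ClosedPoint)
    (L : Type*) [Field L] [Algebra C.functionField L] [FiniteDimensional C.functionField L]
    (Mloc : T → Type u) [∀ w, Field (Mloc w)]
    [∀ w : T, Algebra (LocGlob.SmoothProjectiveCurve.completion w.1) (Mloc w)]
    [∀ w : T, FiniteDimensional (LocGlob.SmoothProjectiveCurve.completion w.1) (Mloc w)]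
    [∀ w, Algebra C.functionField (Mloc w)]
    [∀ w : T, IsScalarTower C.functionField
      (LocGlob.SmoothProjectiveCurve.completion w.1) (Mloc w)]
    (hMloc : ∀ w, LocGlob.HasPoint π (Mloc w)) :
    ∃ (M : Type u) (_ : Field M) (_ : Algebra C.functionField M),
      FiniteDimensional C.functionField M ∧
      LocGlob.HasPoint π M ∧
      (∀ w, Nonempty (M →ₐ[C.functionField] Mloc w)) ∧
      LocGlob.LinearlyDisjoint C.functionField L M := by
  have := hZ.locallyOfFiniteType
  have hk := LocGlob.aleph0_lt_mk_of_algebra_padic p k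
  by_cases hT : Nonempty T
  · exact C.exists_extension_of_family hk π Subtype.val_injective L Mloc hMloc
  -- if `T` is empty, impose a local condition at an auxiliary closed point
  have : AlgebraicGeometry.IsIntegral Z :=
    AlgebraicGeometry.GeometricallyIntegral.isIntegral_of_subsingleton π
  obtain ⟨c⟩ := C.nonempty_closedPoint
  obtain ⟨N, _, _, _, _, _, hN⟩ :=
    LocGlob.exists_finiteDimensional_hasPoint π (LocGlob.SmoothProjectiveCurve.completion c)
  obtain ⟨M, hM₁, hM₂, hM₃, hM₄, -, hM₅⟩ := C.exists_extension_of_family hk π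
    (pt := fun _ : Unit => c) (fun _ _ _ => rfl) L (fun _ => N) (fun _ => hN)
  exact ⟨M, hM₁, hM₂, hM₃, hM₄, fun w => (hT ⟨w⟩).elim, hM₅⟩
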